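/- **Setting.** Let $({\sf X},{\cal B})$ be a measurable space with ${\cal B}$ countably generated, and let $P$ be a Markov transition kernel on it that is geometrically ergodic with Lyapunov function $V:{\sf X}\to[1,\infty)$. That is, with $R_\theta=\sum_{n\ge0}(1-e^{-\theta})e^{-\theta n}P^n$ and $R=R_1$: * $P$ is $\psi$-irreducible for a nonzero $\sigma$-finite measure $\psi$ (for some $\theta>0$, $R_\theta(x,s)>0$ for all $x$ whenever $s\ge 0$ and $\psi(s)>0$), $\psi$ being maximal with this property with respect to absolute continuity, and $P$ is aperiodic ($P^t(x,s)>0$ for all large $t$, for every $x$ and every such $s$); * for some probability measure $\nu$, some $b<\infty$, $\delta>0$ and some measurable $s:{\sf X}\to(0,1]$, we have $PV-V\le-\delta V+bs$ and $R\ge s\otimes\nu$. Let $\pi$ be the invariant probability measure of $P$ and suppose $\pi(V^2)<\infty$. Let $F:{\sf X}\to[-1,1]$ be measurable with $\pi(F)=0$. For $w:{\sf X}\to(0,\infty)$ let $L_\infty^w$ be the space of measurable $h:{\sf X}\to\mathbb C$ with $\|h\|_w=\sup_x|h(x)|/w(x)<\infty$, and ${\cal M}_1^w$ the space of complex measures $\mu$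 with $|\mu|(w)<\infty$, normed by $|\mu|(w)$. For a bounded operator $T$ on $L_\infty^w$ let ${\cal S}(T)$ be the set of nonzero $z\in\mathbb C$ for which $zI-T$ has no bounded inverse, and $\xi=\lim_n\|T^n\|_w^{1/n}$. At an isolated point $z_0$ of ${\cal S}(T)$ let $Q=\frac1{2\pi i}\oint(zI-T)^{-1}dz$ (over a small circle about $z_0$). The point $z_0$ is a *pole of finite multiplicity* if $Q$ is a finite linear combination of operators $s_i\otimes\nu_j$ with $s_i\in L_\infty^w$, $\nu_j\in{\cal M}_1^w$; it is a *pole of multiplicity one* if $Q=m\,s\otimes\nu$ and ${\cal S}(T-z_0Q)\subset\{|z|\le\xi-\varepsilon\}$ for some $\varepsilon>0$. $T$ is *$w$-uniform* if, for some $\varepsilon>0$, ${\cal S}(T)\cap\{|z|\ge\xi-\varepsilon\}$ is finite and contains only poles of finite multiplicity, and there is a unique pole $\lambda$ of multiplicity one with $|\lambda|=\xi$. A kernel is $w$-uniform if it acts as a bounded, $w$-uniform operator on $L_\infty^w$; $\lambda$ is its *generalized principal eigenvalue*. For $a\in\mathbb R$ let $\widehat P_a(x,dy)=e^{aF(x)}P(x,dy)$;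 when $\widehat P_a$ is $V$-uniform, $\lambda_a$ denotes its generalized principal eigenvalue. **Proposition.** Suppose that $\widehat P_{a_0}$ is $V$-uniform for a given real $a_0$, and that some $h\in L_\infty^V$ with $\widehat P_{a_0}h=\lambda_{a_0}h$ does not vanish $\pi$-a.e. Then there is an open set $O\subset\mathbb R$ containing $a_0$ such that for every $a\in O$: $\widehat P_a$ is $V$-uniform, $\lambda_a>0$, and there are unique $\check f_a\in L_\infty^V$ and $\check\mu_a\in{\cal M}_1^V$ with $$\widehat P_a\check f_a=\lambda_a\check f_a,\qquad \check\mu_a\widehat P_a=\lambda_a\check\mu_a,\qquad \check\mu_a(\check f_a)=\check\mu_a({\sf X})=1;$$ moreover $\check f_a(x)>0$ for all $x\in{\sf X}$. There are $s_0\in L_\infty^V$, $\nu_0\in{\cal M}_1^V$ and $\varepsilon>0$ for which $zI-\widehat P_{a_0}+s_0\otimes\nu_0$ has a bounded inverse for all $|z|\ge\lambda_{a_0}-\varepsilon$. For every such $s_0,\nu_0$ and all $a$ sufficiently near $a_0$, the inverse $U=[\lambda_aI-\widehat P_a+s_0\otimes\nu_0]^{-1}$ exists as a bounded operator, and $$\check\mu_a=\frac{\nu_0U}{\nu_0U{\bf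 1}},\qquad \check f_a=\frac{Us_0}{\check\mu_aUs_0}$$ with nonzero denominators. For $a\in O$ put $\Lambda(a)=\log\lambda_a$, $\check V_a=V/\check f_a$, and let $\check P_a(x,dy)=\lambda_a^{-1}\check f_a(x)^{-1}\widehat P_a(x,dy)\check f_a(y)$ be the twisted kernel. Then $\check P_a$ is a Markov transition kernel, and: 1. $\check P_a$ is $\check V_a$-uniform. 2. $\check P_a$ has a unique invariant probability measure $\check\pi_a$, $\Lambda$ is differentiable at $a$, and $\Lambda'(a)=\check\pi_a(F)$. 3. The derivative $\widehat F_a(x)=\frac{d}{da}\log\check f_a(x)$ exists for every $x$, is $\check P_a(x,\cdot)$-integrable for every $x$, and solves the Poisson equation $\check P_a\widehat F_a=\widehat F_a-F+\check\pi_a(F)$. If $0\in O$, then for $a=0$ it is the unique real-valued solution in $L_\infty^V$ of $P\widehat F=\widehat F-F+\pi(F)$ with $\pi(\widehat F)=0$. 4. $a\mapsto\check f_a$ is differentiable at $a$ in $L_\infty^V$ and $a\mapsto\check\mu_a$ is differentiable at $a$ in ${\cal M}_1^V$; in particular $\frac{d}{da}\check f_a\in L_\infty^V$ and $\frac{d}{da}\check\mu_a\in{\cal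 M}_1^V$. 5. $\widehat F_a$ lies in $L_\infty^{1+\log^+\check V_a}$, where $\log^+=\max(\log,0)$: it is measurable and $|\widehat F_a|\le C\,(1+\log^+\check V_a)$ for a constant $C$ (depending on $a$). -/

import Mathlib

open MeasureTheory ProbabilityTheory Filter Topology
open scoped NNReal ENNReal

noncomputable section

namespace VGeo

variable {X : Type*} [MeasurableSpace X]

/-! ### The weighted spaces `L_∞^w` and `M_1^w` -/

/-- The measurable functions `h : X → ℂ` with `|h| ≤ C w` for some constant `C`. -/
def lInfSubmodule (w : X → ℝ≥0) : Submodule ℂ (X → ℂ) where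
  carrier := {h | Measurable h ∧ ∃ C : ℝ≥0, ∀ x, ‖h x‖ ≤ C * w x}
  zero_mem' := ⟨measurable_zero, 0, fun x => by simp⟩
  add_mem' := by
    rintro g h ⟨hg, C, hC⟩ ⟨hh, D, hD⟩
    refine ⟨hg.add hh, C + D, fun x => ?_⟩
    calc ‖g x + h x‖ ≤ ‖g x‖ + ‖h x‖ := norm_add_le _ _
      _ ≤ C * w x + D * w x := add_le_add (hC x) (hD x)
      _ = ((C + D : ℝ≥0) : ℝ) * w x := by push_cast; ring
  smul_mem' := by
    rintro c h ⟨hh, C, hC⟩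
    refine ⟨hh.const_smul c, ‖c‖₊ * C, fun x => ?_⟩
    calc ‖c • h x‖ = ‖c‖ * ‖h x‖ := norm_smul _ _
      _ ≤ ‖c‖ * (C * w x) := mul_le_mul_of_nonneg_left (hC x) (norm_nonneg _)
      _ = ((‖c‖₊ * C : ℝ≥0) : ℝ) * w x := by push_cast; ring

/-- The space `L_∞^w` of complex measurable functions `h` with
`‖h‖_w = sup_x |h x| / w x < ∞`, normed by `‖·‖_w`. -/
def LInf (w : X → ℝ≥0) : Type _ := ↥(lInfSubmodule w)

namespace LInf

variable {w : X → ℝ≥0}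

instance : AddCommGroup (LInf w) := inferInstanceAs (AddCommGroup ↥(lInfSubmodule w))

instance : Module ℂ (LInf w) := inferInstanceAs (Module ℂ ↥(lInfSubmodule w))

/-- The underlying function of an element of `L_∞^w`. -/
def toFun (h : LInf w) : X → ℂ := (show ↥(lInfSubmodule w) from h).1

instance : CoeFun (LInf w) (fun _ => X → ℂ) := ⟨toFun⟩

/-- The element of `L_∞^w` given by a function. -/
def mk (h : X → ℂ) (hm : Measurable h) (hb : ∃ C : ℝ≥0, ∀ x, ‖h x‖ ≤ C * w x) : LInf w :=
  show ↥(lInfSubmodule w) from ⟨h, hm, hb⟩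

theorem mk_apply (h : X → ℂ) (hm : Measurable h) (hb : ∃ C : ℝ≥0, ∀ x, ‖h x‖ ≤ C * w x)
    (x : X) : (mk h hm hb : LInf w) x = h x := rfl

theorem ext' {g h : LInf w} (e : ∀ x, g x = h x) : g = h := Subtype.ext (funext e)

theorem measurable (h : LInf w) : Measurable (h : X → ℂ) := h.2.1

theorem bound (h : LInf w) : ∃ C : ℝ≥0, ∀ x, ‖h x‖ ≤ C * w x := h.2.2

theorem add_apply (g h : LInf w) (x : X) : (g + h) x = g x + h x := rfl

theorem smul_apply (c : ℂ) (h : LInf w) (x : X) : (c • h) x = c * h x := rfl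

theorem zero_apply (x : X) : (0 : LInf w) x = 0 := rfl

theorem sub_apply (g h : LInf w) (x : X) : (g - h) x = g x - h x := rfl

instance : Norm (LInf w) := ⟨fun h => ⨆ x, ‖h x‖ / w x⟩

theorem norm_def (h : LInf w) : ‖h‖ = ⨆ x, ‖h x‖ / w x := rfl

theorem norm_le {h : LInf w} {C : ℝ} (hC : 0 ≤ C) (hb : ∀ x, ‖h x‖ ≤ C * w x) : ‖h‖ ≤ C :=
  Real.iSup_le (fun x => div_le_of_le_mul₀ (w x).2 hC (hb x)) hC

theorem le_norm (h : LInf w) (x : X) : ‖h x‖ ≤ ‖h‖ * w x := by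
  obtain ⟨C, hC⟩ := h.bound
  have hbdd : BddAbove (Set.range fun x => ‖h x‖ / (w x : ℝ)) :=
    ⟨C, by rintro _ ⟨y, rfl⟩; exact div_le_of_le_mul₀ (w y).2 C.2 (hC y)⟩
  rcases eq_or_ne (w x : ℝ) 0 with h0 | h0
  · have := hC x
    rw [h0] at this ⊢
    simpa using this
  · have h1 : ‖h x‖ / (w x : ℝ) ≤ ‖h‖ := le_ciSup hbdd x
    exact (div_le_iff₀ (lt_of_le_of_ne (w x).2 (Ne.symm h0))).1 h1

theorem norm_nonneg' (h : LInf w) : 0 ≤ ‖h‖ :=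
  Real.iSup_nonneg fun x => div_nonneg (norm_nonneg _) (w x).2

theorem core : NormedSpace.Core ℂ (LInf w) where
  norm_nonneg := norm_nonneg'
  norm_smul c h := by
    rw [norm_def, norm_def, Real.mul_iSup_of_nonneg (norm_nonneg c)]
    refine congrArg _ (funext fun x => ?_)
    rw [smul_apply, norm_mul, mul_div_assoc]
  norm_triangle g h := by
    refine norm_le (add_nonneg (norm_nonneg' g) (norm_nonneg' h)) fun x => ?_
    rw [add_apply, add_mul]
    exact (norm_add_le _ _).trans (add_le_add (le_norm g x) (le_norm h x))
  norm_eq_zero_iff h := by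
    constructor
    · intro h0
      refine ext' fun x => ?_
      have := le_norm h x
      rw [h0, zero_mul] at this
      exact norm_le_zero_iff.1 this
    · rintro rfl
      exact le_antisymm (norm_le le_rfl fun x => by simp [zero_apply]) (norm_nonneg' _)

instance : NormedAddCommGroup (LInf w) := NormedAddCommGroup.ofCore core

instance : NormedSpace ℂ (LInf w) := NormedSpace.ofCore core

instance : CompleteSpace (LInf w) := by
  refine Metric.complete_of_cauchySeq_tendsto fun u hu => ?_
  have hpt : ∀ x, CauchySeq fun n => u n x := by
    intro x
    rw [Metric.cauchySeq_iff'] at hu ⊢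
    intro ε hε
    obtain ⟨N, hN⟩ := hu (ε / (w x + 1)) (by positivity)
    refine ⟨N, fun n hn => ?_⟩
    have h1 := hN n hn
    rw [dist_eq_norm] at h1 ⊢
    have h2 := le_norm (u n - u N) x
    rw [sub_apply] at h2
    have hw : (0 : ℝ) ≤ w x := (w x).2
    calc ‖u n x - u N x‖ ≤ ‖u n - u N‖ * w x := h2
      _ ≤ ‖u n - u N‖ * (w x + 1) :=
          mul_le_mul_of_nonneg_left (by linarith) (norm_nonneg _)
      _ < ε / (w x + 1) * (w x + 1) := mul_lt_mul_of_pos_right h1 (by positivity)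
      _ = ε := div_mul_cancel₀ _ (by positivity)
  choose g hg using fun x => cauchySeq_tendsto_of_complete (hpt x)
  have key : ∀ ε > 0, ∃ N, ∀ n ≥ N, ∀ x, ‖u n x - g x‖ ≤ ε * w x := by
    intro ε hε
    obtain ⟨N, hN⟩ := Metric.cauchySeq_iff.1 hu ε hε
    refine ⟨N, fun n hn x => ?_⟩
    have hlim : Tendsto (fun m => ‖u n x - u m x‖) atTop (𝓝 ‖u n x - g x‖) :=
      (tendsto_const_nhds.sub (hg x)).norm
    refine le_of_tendsto hlim (eventually_atTop.2 ⟨N, fun m hm => ?_⟩)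
    have h1 := hN n hn m hm
    rw [dist_eq_norm] at h1
    exact (le_norm (u n - u m) x).trans (mul_le_mul_of_nonneg_right h1.le (w x).2)
  have hgm : Measurable g :=
    measurable_of_tendsto_metrizable (fun n => (u n).measurable) (tendsto_pi_nhds.2 hg)
  obtain ⟨N, hN⟩ := key 1 one_pos
  obtain ⟨C, hC⟩ := (u N).bound
  have hgb : ∃ C : ℝ≥0, ∀ x, ‖g x‖ ≤ C * w x := by
    refine ⟨C + 1, fun x => ?_⟩
    have e : g x = u N x - (u N x - g x) := by ring
    calc ‖g x‖ ≤ ‖u N x‖ + ‖u N x - g x‖ := by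
          conv_lhs => rw [e]
          exact norm_sub_le _ _
      _ ≤ C * w x + 1 * w x := add_le_add (hC x) (hN N le_rfl x)
      _ = ((C + 1 : ℝ≥0) : ℝ) * w x := by push_cast; ring
  refine ⟨mk g hgm hgb, Metric.tendsto_atTop.2 fun ε hε => ?_⟩
  obtain ⟨M, hM⟩ := key (ε / 2) (by positivity)
  refine ⟨M, fun n hn => ?_⟩
  rw [dist_eq_norm]
  refine lt_of_le_of_lt (norm_le (by positivity) fun x => ?_) (half_lt_self hε)
  exact hM n hn x

/-- The constant function `1`, as an element of `L_∞^w` when `w ≥ 1`. -/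
def one (hw : ∀ x, 1 ≤ w x) : LInf w :=
  mk (fun _ => 1) measurable_const ⟨1, fun x => by simpa using hw x⟩

theorem integrable_of_lintegral_ne_top (h : LInf w) {m : Measure X}
    (hm : ∫⁻ y, w y ∂m ≠ ∞) : Integrable (h : X → ℂ) m := by
  obtain ⟨C, hC⟩ := h.bound
  refine ⟨h.measurable.aestronglyMeasurable, ?_⟩
  have hle : ∀ y, ‖h y‖ₑ ≤ (C : ℝ≥0∞) * w y := fun y => by
    have : ‖h y‖₊ ≤ C * w y := by exact_mod_cast hC y
    rw [enorm_eq_nnnorm, ← ENNReal.coe_mul]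
    exact_mod_cast this
  refine lt_of_le_of_lt (lintegral_mono hle) ?_
  rw [lintegral_const_mul' _ _ ENNReal.coe_ne_top]
  exact ENNReal.mul_lt_top ENNReal.coe_lt_top hm.lt_top

theorem lintegral_enorm_le (h : LInf w) (m : Measure X) :
    ∫⁻ y, ‖h y‖ₑ ∂m ≤ ENNReal.ofReal ‖h‖ * ∫⁻ y, w y ∂m := by
  rw [← lintegral_const_mul' _ _ ENNReal.ofReal_ne_top]
  refine lintegral_mono fun y => ?_
  rw [← ofReal_norm, ← ENNReal.ofReal_coe_nnreal (p := w y),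
    ← ENNReal.ofReal_mul h.norm_nonneg']
  exact ENNReal.ofReal_le_ofReal (h.le_norm y)

end LInf

/-- The space `M_1^w` of complex measures `μ` with `|μ|(w) < ∞`, where `|μ|` is the total
variation. -/
structure M1 (w : X → ℝ≥0) where
  toComplexMeasure : ComplexMeasure X
  finite' : ∫⁻ y, w y ∂toComplexMeasure.variation ≠ ∞

namespace M1

variable {w : X → ℝ≥0}

/-- The integral `μ(h) = ∫ h dμ` of a function against a complex measure. -/
def integral (μ : ComplexMeasure X) (h : X → ℂ) : ℂ :=
  VectorMeasure.integral μ h (ContinuousLinearMap.mul ℝ ℂ)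

/-- The bounded linear functional `h ↦ μ(h)` on `L_∞^w` given by `μ ∈ M_1^w`.  Its operator norm
is the `w`-weighted total variation norm of `μ`. -/
def toDual (μ : M1 w) : LInf w →L[ℂ] ℂ :=
  LinearMap.mkContinuous
    { toFun := fun h => integral μ.toComplexMeasure h
      map_add' := fun g h =>
        VectorMeasure.integral_add (g.integrable_of_lintegral_ne_top μ.finite')
          (h.integrable_of_lintegral_ne_top μ.finite')
      map_smul' := fun c h =>
        setToFun_smul _ (fun c s x => by
          change c • x * _ = c • (x * _)
          rw [smul_mul_assoc]) c _ }
    (‖ContinuousLinearMap.mul ℝ ℂ‖ * (∫⁻ y, w y ∂μ.toComplexMeasure.variation).toReal)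
    (fun h => by
      have h1 := VectorMeasure.enorm_integral_le_lintegral_enorm (μ := μ.toComplexMeasure)
        (f := (h : X → ℂ)) (B := ContinuousLinearMap.mul ℝ ℂ)
      have h2 := h1.trans (mul_le_mul_right
        (h.lintegral_enorm_le μ.toComplexMeasure.variation) _)
      have h3 := ENNReal.toReal_mono (ENNReal.mul_ne_top enorm_ne_top
        (ENNReal.mul_ne_top ENNReal.ofReal_ne_top μ.finite')) h2
      rw [ENNReal.toReal_mul, ENNReal.toReal_mul, ENNReal.toReal_ofReal h.norm_nonneg',
        toReal_enorm, toReal_enorm] at h3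
      refine h3.trans (le_of_eq ?_)
      ring)

end M1

/-! ### Kernels as bounded operators on `L_∞^w` -/

/-- The kernel `Q` has finite `w`-norm: `sup_x (Q w)(x) / w x < ∞`. -/
def HasFiniteNorm (Q : Kernel X X) (w : X → ℝ≥0) : Prop :=
  ∃ C : ℝ≥0, ∀ x, ∫⁻ y, w y ∂(Q x) ≤ C * w x

theorem integrable_of_hasFiniteNorm {Q : Kernel X X} {w : X → ℝ≥0} (hQ : HasFiniteNorm Q w)
    (h : LInf w) (x : X) : Integrable (h : X → ℂ) (Q x) := by
  obtain ⟨C, hC⟩ := hQ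
  exact h.integrable_of_lintegral_ne_top
    ((hC x).trans_lt (ENNReal.mul_lt_top ENNReal.coe_lt_top ENNReal.coe_lt_top)).ne

theorem norm_integral_kernel_le {Q : Kernel X X} {w : X → ℝ≥0} {C : ℝ≥0}
    (hC : ∀ x, ∫⁻ y, w y ∂(Q x) ≤ C * w x) (h : LInf w) (x : X) :
    ‖∫ y, h y ∂(Q x)‖ ≤ ‖h‖ * C * w x := by
  have h1 : ‖∫ y, h y ∂(Q x)‖ₑ ≤ ENNReal.ofReal ‖h‖ * (C * w x) :=
    (enorm_integral_le_lintegral_enorm _).trans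
      ((h.lintegral_enorm_le (Q x)).trans (mul_le_mul_right (hC x) _))
  have h2 := ENNReal.toReal_mono (ENNReal.mul_ne_top ENNReal.ofReal_ne_top
    (ENNReal.mul_ne_top ENNReal.coe_ne_top ENNReal.coe_ne_top)) h1
  rw [toReal_enorm, ENNReal.toReal_mul, ENNReal.toReal_mul,
    ENNReal.toReal_ofReal h.norm_nonneg', ENNReal.coe_toReal, ENNReal.coe_toReal] at h2
  rw [mul_assoc]
  exact h2

/-- The function `(Q h)(x) = ∫ h(y) Q(x, dy)`, as an element of `L_∞^w`. -/
def kernelApply (Q : Kernel X X) [IsSFiniteKernel Q] {w : X → ℝ≥0} (hQ : HasFiniteNorm Q w)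
    (h : LInf w) : LInf w :=
  LInf.mk (fun x => ∫ y, h y ∂(Q x))
    (StronglyMeasurable.integral_kernel_prod_right' (κ := Q)
      (f := fun p : X × X => h p.2)
      (h.measurable.comp measurable_snd).stronglyMeasurable).measurable
    (by
      obtain ⟨C, hC⟩ := hQ
      exact ⟨‖h‖₊ * C, fun x => by exact_mod_cast norm_integral_kernel_le hC h x⟩)

/-- The bounded operator on `L_∞^w` given by a kernel of finite `w`-norm. -/
def boundedKernelOp (Q : Kernel X X) [IsSFiniteKernel Q] {w : X → ℝ≥0}
    (hQ : HasFiniteNorm Q w) : LInf w →L[ℂ] LInf w :=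
  LinearMap.mkContinuousOfExistsBound
    { toFun := kernelApply Q hQ
      map_add' := fun g h => LInf.ext' fun x =>
        integral_add (integrable_of_hasFiniteNorm hQ g x) (integrable_of_hasFiniteNorm hQ h x)
      map_smul' := fun c h => LInf.ext' fun x => integral_const_mul c (h : X → ℂ) }
    (by
      obtain ⟨C, hC⟩ := id hQ
      refine ⟨C, fun h => LInf.norm_le (mul_nonneg C.2 h.norm_nonneg') fun x => ?_⟩
      rw [mul_comm (C : ℝ)]
      exact norm_integral_kernel_le hC h x)

open scoped Classical in
/-- The operator on `L_∞^w` given by a kernel `Q`; it is only used when `Q` has finite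
`w`-norm. -/
def kernelOp (Q : Kernel X X) [IsSFiniteKernel Q] (w : X → ℝ≥0) : LInf w →L[ℂ] LInf w :=
  if hQ : HasFiniteNorm Q w then boundedKernelOp Q hQ else 0

theorem kernelOp_apply {Q : Kernel X X} [IsSFiniteKernel Q] {w : X → ℝ≥0}
    (hQ : HasFiniteNorm Q w) (h : LInf w) (x : X) :
    kernelOp Q w h x = ∫ y, h y ∂(Q x) := by
  rw [kernelOp, dif_pos hQ]
  rfl

/-! ### Spectrum, poles and `w`-uniform operators -/

section Spectrum

variable {w : X → ℝ≥0}

/-- The spectrum of a bounded operator `T` on `L_∞^w`: the nonzero `z` for which `z I - T` has no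
bounded inverse. -/
def opSpectrum (T : LInf w →L[ℂ] LInf w) : Set ℂ := {z | z ≠ 0 ∧ z ∈ spectrum ℂ T}

/-- `ξ = lim_n ‖T^n‖^{1/n}`. -/
def IsSpectralRadius (T : LInf w →L[ℂ] LInf w) (ξ : ℝ) : Prop :=
  Tendsto (fun n : ℕ => ‖T ^ n‖ ^ (1 / (n : ℝ))) atTop (𝓝 ξ)

/-- The rank one operator `s ⊗ ν : h ↦ ν(h) s`. -/
def rankOne (s : LInf w) (ν : M1 w) : LInf w →L[ℂ] LInf w := ν.toDual.smulRight s

/-- The point `z₀` is isolated in the spectrum of `T`, being the only point of the spectrum in the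
closed disc of radius `r` about `z₀` (which does not contain `0`). -/
def IsolatedWithin (T : LInf w →L[ℂ] LInf w) (z₀ : ℂ) (r : ℝ) : Prop :=
  0 < r ∧ r < ‖z₀‖ ∧ opSpectrum T ∩ Metric.closedBall z₀ r = {z₀}

/-- The projection `(2πi)⁻¹ ∮ (z I - T)⁻¹ dz` over the circle of radius `r` about `z₀`. -/
def spectralProj (T : LInf w →L[ℂ] LInf w) (z₀ : ℂ) (r : ℝ) : LInf w →L[ℂ] LInf w :=
  (2 * Real.pi * Complex.I : ℂ)⁻¹ • ∮ z in C(z₀, r), resolvent T z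

/-- `z₀` is a pole of finite multiplicity of `T`: the spectral projection at `z₀` is a finite
linear combination of operators `s_i ⊗ ν_j`. -/
def IsPoleOfFiniteMultiplicity (T : LInf w →L[ℂ] LInf w) (z₀ : ℂ) : Prop :=
  ∃ r, IsolatedWithin T z₀ r ∧
    ∃ (n : ℕ) (m : Fin n → Fin n → ℂ) (s : Fin n → LInf w) (ν : Fin n → M1 w),
      spectralProj T z₀ r = ∑ i, ∑ j, m i j • rankOne (s i) (ν j)

/-- `z₀` is a pole of multiplicity one of `T`, where `ξ` is the spectral radius of `T`: the
spectral projection `P` at `z₀` is `m s ⊗ ν`, and the spectrum of `T - z₀ P` lies in a disc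
`|z| ≤ ξ - ε`. -/
def IsPoleOfMultiplicityOne (T : LInf w →L[ℂ] LInf w) (ξ : ℝ) (z₀ : ℂ) : Prop :=
  ∃ r, IsolatedWithin T z₀ r ∧
    (∃ (m : ℂ) (s : LInf w) (ν : M1 w), spectralProj T z₀ r = m • rankOne s ν) ∧
    ∃ ε > 0, ∀ z ∈ opSpectrum (T - z₀ • spectralProj T z₀ r), ‖z‖ ≤ ξ - ε

/-- `T` has a spectral gap, where `ξ` is the spectral radius of `T`. -/
def HasSpectralGap (T : LInf w →L[ℂ] LInf w) (ξ : ℝ) : Prop :=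
  ∃ ε > 0, (opSpectrum T ∩ {z | ξ - ε ≤ ‖z‖}).Finite ∧
    ∀ z ∈ opSpectrum T ∩ {z | ξ - ε ≤ ‖z‖}, IsPoleOfFiniteMultiplicity T z

/-- `T` is `w`-uniform with generalized principal eigenvalue `lam`: `T` has a spectral gap, and
`lam` is the unique pole of multiplicity one whose modulus is the spectral radius. -/
def IsUniformOpWith (T : LInf w →L[ℂ] LInf w) (lam : ℂ) : Prop :=
  ∃ ξ : ℝ, IsSpectralRadius T ξ ∧ HasSpectralGap T ξ ∧
    (IsPoleOfMultiplicityOne T ξ lam ∧ ‖lam‖ = ξ) ∧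
    ∀ lam' : ℂ, IsPoleOfMultiplicityOne T ξ lam' ∧ ‖lam'‖ = ξ → lam' = lam

/-- The potential operator `[z I - (T - s ⊗ ν)]⁻¹`. -/
def potential (T : LInf w →L[ℂ] LInf w) (s : LInf w) (ν : M1 w) (z : ℂ) :
    LInf w →L[ℂ] LInf w := resolvent (T - rankOne s ν) z

/-- `z I - (T - s ⊗ ν)` has a bounded inverse. -/
def HasPotential (T : LInf w →L[ℂ] LInf w) (s : LInf w) (ν : M1 w) (z : ℂ) : Prop :=
  IsUnit (algebraMap ℂ (LInf w →L[ℂ] LInf w) z - (T - rankOne s ν))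

end Spectrum

/-- The kernel `Q` is `w`-uniform with generalized principal eigenvalue `lam`. -/
def IsGPE (Q : Kernel X X) [IsSFiniteKernel Q] (w : X → ℝ≥0) (lam : ℂ) : Prop :=
  HasFiniteNorm Q w ∧ IsUniformOpWith (kernelOp Q w) lam

/-- The kernel `Q` is `w`-uniform. -/
def IsUniform (Q : Kernel X X) [IsSFiniteKernel Q] (w : X → ℝ≥0) : Prop :=
  ∃ lam : ℂ, IsGPE Q w lam

/-- `h ∈ L_∞^w` and `ν ∈ M_1^w` are an eigenfunction and an eigenmeasure of `Q` with eigenvalue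
`lam`, normalized by `ν(h) = ν(X) = 1`. -/
structure IsNormalizedEigenpair (Q : Kernel X X) [IsSFiniteKernel Q] {w : X → ℝ≥0} (lam : ℂ)
    (h : LInf w) (ν : M1 w) : Prop where
  eigenfunction : kernelOp Q w h = lam • h
  eigenmeasure : ν.toDual.comp (kernelOp Q w) = lam • ν.toDual
  pairing : ν.toDual h = 1
  mass : ν.toComplexMeasure Set.univ = 1

/-! ### Geometric ergodicity -/

/-- `(R_θ s)(x)`, where `R_θ = ∑_n (1 - e^{-θ}) e^{-θ n} P^n` is the resolvent kernel. -/
def resolventKernel (P : Kernel X X) (θ : ℝ) (s : X → ℝ≥0∞) (x : X) : ℝ≥0∞ :=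
  ∑' n : ℕ, ENNReal.ofReal ((1 - Real.exp (-θ)) * Real.exp (-θ * n)) *
    ∫⁻ y, s y ∂((P ^ n) x)

/-- `ψ` is an irreducibility measure for `P`. -/
def IsIrreducibilityMeasure (P : Kernel X X) (ψ : Measure X) : Prop :=
  SigmaFinite ψ ∧ ψ ≠ 0 ∧ ∃ θ : ℝ, 0 < θ ∧ ∀ s : X → ℝ≥0, Measurable s →
    0 < ∫⁻ y, s y ∂ψ → ∀ x, 0 < resolventKernel P θ (fun y => s y) x

/-- `ψ` is a maximal irreducibility measure for `P`. -/
def IsMaximalIrreducibilityMeasure (P : Kernel X X) (ψ : Measure X) : Prop :=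
  IsIrreducibilityMeasure P ψ ∧ ∀ ψ', IsIrreducibilityMeasure P ψ' → ψ' ≪ ψ

/-- `P` is aperiodic: `(P^t s)(x) > 0` for all large `t`, for all `ψ`-positive `s` and all `x`. -/
def IsAperiodic (P : Kernel X X) (ψ : Measure X) : Prop :=
  ∀ s : X → ℝ≥0, Measurable s → 0 < ∫⁻ y, s y ∂ψ →
    ∀ x, ∀ᶠ t : ℕ in atTop, 0 < ∫⁻ y, s y ∂((P ^ t) x)

/-- The geometric drift condition: `P V - V ≤ -δ V + b s` and `R ≥ s ⊗ ν`, where `R = R_1`. -/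
def DriftV4 (P : Kernel X X) (V : X → ℝ≥0) : Prop :=
  ∃ (ν : Measure X) (b δ : ℝ≥0) (s : X → ℝ≥0), IsProbabilityMeasure ν ∧ 0 < δ ∧
    Measurable s ∧ (∀ x, 0 < s x ∧ s x ≤ 1) ∧
    (∀ x, ∫⁻ y, V y ∂(P x) + δ * V x ≤ V x + b * s x) ∧
    ∀ x A, MeasurableSet A → s x * ν A ≤ resolventKernel P 1 (A.indicator 1) x

/-- The chain with transition kernel `P` is geometrically ergodic with Lyapunov function `V`. -/
def IsGeometricallyErgodic (P : Kernel X X) (V : X → ℝ≥0) : Prop :=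
  (∃ ψ, IsMaximalIrreducibilityMeasure P ψ ∧ IsAperiodic P ψ) ∧ DriftV4 P V

/-! ### The tilted and the twisted kernels -/

/-- The kernel `e^{a F(x)} P(x, dy)`. -/
def tilted (P : Kernel X X) [IsSFiniteKernel P] (F : X → ℝ) (a : ℝ) : Kernel X X :=
  P.withDensity fun x _ => ((Real.exp (a * F x)).toNNReal : ℝ≥0∞)

instance (P : Kernel X X) [IsSFiniteKernel P] (F : X → ℝ) (a : ℝ) :
    IsSFiniteKernel (tilted P F a) :=
  inferInstanceAs (IsSFiniteKernel (P.withDensity fun x (_ : X) =>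
    ((Real.exp (a * F x)).toNNReal : ℝ≥0∞)))

/-- The twisted kernel `lam⁻¹ f(x)⁻¹ e^{a F(x)} P(x, dy) f(y)`, for `lam > 0` and a positive
function `f`. -/
def twisted (P : Kernel X X) [IsSFiniteKernel P] (F : X → ℝ) (a lam : ℝ) (f : X → ℝ) :
    Kernel X X :=
  (tilted P F a).withDensity fun x y => ((lam⁻¹ * (f x)⁻¹ * f y).toNNReal : ℝ≥0∞)

instance (P : Kernel X X) [IsSFiniteKernel P] (F : X → ℝ) (a lam : ℝ) (f : X → ℝ) :
    IsSFiniteKernel (twisted P F a lam f) :=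
  inferInstanceAs (IsSFiniteKernel ((tilted P F a).withDensity fun x y =>
    ((lam⁻¹ * (f x)⁻¹ * f y).toNNReal : ℝ≥0∞)))

/-- The weight `V / f`, for a positive function `f`. -/
def twistedWeight (V : X → ℝ≥0) (f : X → ℝ) : X → ℝ≥0 := fun x => V x / (f x).toNNReal

end VGeo

end

/-! On L_∞^V the tilted kernels act as T_a = exp(a M_F) P, where M_F is multiplication by F. Hence a
↦ T_a is strictly differentiable in operator norm, with derivative M_F T_a, and the theorem becomes
perturbation theory of a simple dominant eigenvalue, combined with positivity.

Uniformity is traded for the Banach space notion `IsDominant`: eigenvectors f and φ with φ(f) = 1,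
such that T - λ φ⊗f has spectrum in a disc of radius less than |λ|. The two notions are matched by
computing the Riesz projection (`IsUniformOpWith.exists_isDominant`, `IsDominant.isUniformOpWith`).
Dominance gives λ⁻ⁿ Tⁿ → φ⊗f geometrically fast, and this limit yields uniqueness, positivity and
the fact that φ is a measure: φ is a norm limit of functionals that respect dominated pointwise
convergence, and such functionals are exactly the elements of M_1^w (`IsSigmaCont.exists_M1`).

Since the kernel is positive, |f| is again a dominant eigenfunction and λ = |λ|
(`IsDominant.exists_abs`). The zero set of a nonnegative eigenfunction is absorbing. The
minorization R ≥ s⊗ν with s > 0 makes the complement of a nonempty absorbing set π-null, so an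
eigenfunction that is not π-a.e. zero has no zero at all. This gives the normalized positive triple
`IsPrincipal`. `IsDominant.exists_perturbation` continues the triple differentiably in a by the
implicit function theorem; π(f_a) ≠ 0 persists by continuity, hence so does strict positivity. The
open set O is the set of all parameters that carry such a triple.

The twisted kernel is λ⁻¹ T_a conjugated by multiplication by f, so it inherits dominance with
eigenvalue 1 and eigenfunction 1, and its invariant law is f dμ. Differentiating T_a f_a = λ_a f_a
and dividing by λ_a f_a gives the Poisson equation; pairing with φ gives Λ' = π̌(F). Finally G =
f'/f changes by a bounded amount in one step of the twisted chain and converges geometrically to a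
constant under its powers. Running about log⁺ V̌(x) steps from x bounds G by a multiple of 1 + log⁺
V̌ (`IsDominant.exists_log_bound`). -/

noncomputable section

namespace VGeo

/-! ### Simple dominant eigenvalues of bounded operators and their uniqueness. -/

section Banach

variable {E : Type*} [NormedAddCommGroup E] [NormedSpace ℂ E]

/-- `lam` is a simple dominant eigenvalue of `T` with eigenvector `f` and left eigenvector `φ`,
normalized by `φ f = 1`, and the rest of the spectrum has smaller modulus. -/
structure IsDominant (T : E →L[ℂ] E) (lam : ℂ) (f : E) (φ : E →L[ℂ] ℂ) : Prop where
  eig : T f = lam • f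
  adj : ∀ h, φ (T h) = lam * φ h
  pair : φ f = 1
  gap : ∃ r, 0 ≤ r ∧ r < ‖lam‖ ∧ ∀ z ∈ spectrum ℂ (T - lam • φ.smulRight f), ‖z‖ ≤ r

/-- Gelfand's formula gives ‖Nⁿ‖ ≤ r'ⁿ for large n; the finitely many remaining powers are absorbed
into the constant. -/
theorem exists_norm_pow_le_of_spectrum {A : Type*} [NormedRing A] [NormedAlgebra ℂ A]
    [CompleteSpace A] (N : A) {r r' : ℝ} (hr : 0 ≤ r) (hrr : r < r')
    (h : ∀ z ∈ spectrum ℂ N, ‖z‖ ≤ r) : ∃ C : ℝ, 0 ≤ C ∧ ∀ n, ‖N ^ n‖ ≤ C * r' ^ n := by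
  have hr' : 0 < r' := hr.trans_lt hrr
  have h1 : spectralRadius ℂ N < ENNReal.ofReal r' := by
    refine lt_of_le_of_lt (iSup₂_le fun z hz => ?_) ((ENNReal.ofReal_lt_ofReal_iff hr').2 hrr)
    rw [← ENNReal.ofReal_coe_nnreal]
    exact ENNReal.ofReal_le_ofReal (h z hz)
  have h2 := (spectrum.pow_norm_pow_one_div_tendsto_nhds_spectralRadius N).eventually_lt_const h1
  obtain ⟨n₀, hn₀⟩ := eventually_atTop.1 h2
  have h3 : ∀ n, n₀ + 1 ≤ n → ‖N ^ n‖ ≤ r' ^ n := by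
    intro n hn
    have h4 := hn₀ n (by omega)
    rw [ENNReal.ofReal_lt_ofReal_iff hr'] at h4
    have h5 := pow_le_pow_left₀ (by positivity) h4.le n
    rwa [one_div, Real.rpow_inv_natCast_pow (norm_nonneg _) (by omega)] at h5
  refine ⟨1 + ∑ k ∈ Finset.range (n₀ + 1), ‖N ^ k‖ / r' ^ k, by positivity, fun n => ?_⟩
  rcases le_or_gt (n₀ + 1) n with hn | hn
  · refine (h3 n hn).trans (le_mul_of_one_le_left (by positivity) ?_)
    have : 0 ≤ ∑ k ∈ Finset.range (n₀ + 1), ‖N ^ k‖ / r' ^ k := by positivity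
    linarith
  · have h6 : ‖N ^ n‖ / r' ^ n ≤ ∑ k ∈ Finset.range (n₀ + 1), ‖N ^ k‖ / r' ^ k :=
      Finset.single_le_sum (f := fun k => ‖N ^ k‖ / r' ^ k) (fun k _ => by positivity)
        (Finset.mem_range.2 hn)
    rw [← div_le_iff₀ (by positivity)]
    linarith

namespace IsDominant

variable {T : E →L[ℂ] E} {lam : ℂ} {f : E} {φ : E →L[ℂ] ℂ}

theorem norm_pos (h : IsDominant T lam f φ) : 0 < ‖lam‖ := by
  obtain ⟨r, h0, h1, -⟩ := h.gap
  exact h0.trans_lt h1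

theorem ne_zero (h : IsDominant T lam f φ) : lam ≠ 0 := norm_pos_iff.1 h.norm_pos

theorem vec_ne_zero (h : IsDominant T lam f φ) : f ≠ 0 := by
  rintro rfl
  simpa using h.pair

theorem eig_pow (h : IsDominant T lam f φ) (n : ℕ) : (T ^ n) f = lam ^ n • f := by
  induction n with
  | zero => simp
  | succ n ih => rw [pow_succ, mul_apply_eq_comp, h.eig, map_smul, ih, smul_smul]; ring_nf

/-- The subtracted rank one term vanishes on the kernel of φ, and this kernel is invariant under T
because φ is a left eigenvector. -/
theorem pow_remainder (h : IsDominant T lam f φ) (n : ℕ) (g : E) (hg : φ g = 0) :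
    ((T - lam • φ.smulRight f) ^ n) g = (T ^ n) g := by
  induction n generalizing g with
  | zero => simp
  | succ n ih =>
    rw [pow_succ, pow_succ, mul_apply_eq_comp, mul_apply_eq_comp]
    have : (T - lam • φ.smulRight f) g = T g := by simp [hg]
    rw [this, ih _ (by rw [h.adj, hg, mul_zero])]

theorem decay [CompleteSpace E] (h : IsDominant T lam f φ) :
    ∃ C ρ : ℝ, 0 ≤ C ∧ 0 < ρ ∧ ρ < 1 ∧
      ∀ n g, ‖(T ^ n) g - (lam ^ n * φ g) • f‖ ≤ C * (ρ * ‖lam‖) ^ n * ‖g‖ := by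
  obtain ⟨r, h0, h1, h2⟩ := h.gap
  have hl := h.norm_pos
  obtain ⟨C, hC, hN⟩ := exists_norm_pow_le_of_spectrum _ h0
    (show r < (r + ‖lam‖) / 2 by linarith) h2
  refine ⟨C * (1 + ‖φ‖ * ‖f‖), (r + ‖lam‖) / 2 / ‖lam‖, by positivity, by positivity, ?_,
    fun n g => ?_⟩
  · rw [div_lt_one hl]; linarith
  rw [div_mul_cancel₀ _ hl.ne']
  -- Subtracting φ(g) f moves g into the kernel of φ, where powers of T may be replaced by powers of
  -- the remainder.
  have e : (T ^ n) g - (lam ^ n * φ g) • f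
      = ((T - lam • φ.smulRight f) ^ n) (g - φ g • f) := by
    rw [h.pow_remainder n _ (by simp [h.pair]), map_sub, map_smul, h.eig_pow, smul_smul, mul_comm]
  rw [e]
  have h3 : ‖g - φ g • f‖ ≤ (1 + ‖φ‖ * ‖f‖) * ‖g‖ := by
    refine (norm_sub_le _ _).trans ?_
    rw [norm_smul]
    have := mul_le_mul_of_nonneg_right (φ.le_opNorm g) (norm_nonneg f)
    nlinarith
  calc _ ≤ ‖(T - lam • φ.smulRight f) ^ n‖ * ‖g - φ g • f‖ := ContinuousLinearMap.le_opNorm _ _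
    _ ≤ (C * ((r + ‖lam‖) / 2) ^ n) * ((1 + ‖φ‖ * ‖f‖) * ‖g‖) := by
        gcongr
        exact hN n
    _ = _ := by ring

theorem norm_inv_pow_sub_le [CompleteSpace E] (h : IsDominant T lam f φ) :
    ∃ C ρ : ℝ, 0 ≤ C ∧ 0 < ρ ∧ ρ < 1 ∧
      ∀ n g, ‖(lam ^ n)⁻¹ • (T ^ n) g - φ g • f‖ ≤ C * ρ ^ n * ‖g‖ := by
  obtain ⟨C, ρ, hC, h0, h1, hd⟩ := h.decay
  refine ⟨C, ρ, hC, h0, h1, fun n g => ?_⟩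
  have hl : lam ^ n ≠ 0 := pow_ne_zero _ h.ne_zero
  have hln : 0 < ‖lam ^ n‖ := norm_pos_iff.2 hl
  have e : (lam ^ n)⁻¹ • (T ^ n) g - φ g • f = (lam ^ n)⁻¹ • ((T ^ n) g - (lam ^ n * φ g) • f) := by
    rw [smul_sub, smul_smul, ← mul_assoc, inv_mul_cancel₀ hl, one_mul]
  rw [e, norm_smul, norm_inv, inv_mul_le_iff₀ hln]
  refine (hd n g).trans (le_of_eq ?_)
  rw [norm_pow, mul_pow]; ring

theorem tendsto_inv_pow [CompleteSpace E] (h : IsDominant T lam f φ) (g : E) :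
    Tendsto (fun n : ℕ => (lam ^ n)⁻¹ • (T ^ n) g) atTop (𝓝 (φ g • f)) := by
  obtain ⟨C, ρ, hC, h0, h1, hd⟩ := h.norm_inv_pow_sub_le
  rw [tendsto_iff_norm_sub_tendsto_zero]
  refine squeeze_zero (fun _ => norm_nonneg _) (fun n => hd n g) ?_
  have := ((tendsto_pow_atTop_nhds_zero_of_lt_one h0.le h1).const_mul C).mul_const ‖g‖
  simpa using this

/-- For such g the sequence λ⁻ⁿ Tⁿ g is constant, yet it converges to φ(g) f. The dual statement
below has the same proof. -/
theorem eq_smul_of_eig [CompleteSpace E] (h : IsDominant T lam f φ) {g : E}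
    (hg : T g = lam • g) : g = φ g • f := by
  have h1 : ∀ n : ℕ, (T ^ n) g = lam ^ n • g := by
    intro n
    induction n with
    | zero => simp
    | succ n ih =>
      rw [pow_succ, mul_apply_eq_comp, hg, map_smul, ih, smul_smul]; ring_nf
  refine tendsto_nhds_unique ?_ (h.tendsto_inv_pow g)
  refine tendsto_const_nhds.congr fun n => ?_
  rw [h1, smul_smul, inv_mul_cancel₀ (pow_ne_zero _ h.ne_zero), one_smul]

theorem eq_smul_of_adj [CompleteSpace E] (h : IsDominant T lam f φ) {ψ : E →L[ℂ] ℂ}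
    (hψ : ∀ g, ψ (T g) = lam * ψ g) : ψ = ψ f • φ := by
  ext g
  have h1 : ∀ n : ℕ, ψ ((T ^ n) g) = lam ^ n * ψ g := by
    intro n
    induction n with
    | zero => simp
    | succ n ih =>
      rw [pow_succ', mul_apply_eq_comp, hψ, ih]; ring
  have h2 := (ψ.continuous.tendsto _).comp (h.tendsto_inv_pow g)
  have h3 : Tendsto (fun n : ℕ => ψ ((lam ^ n)⁻¹ • (T ^ n) g)) atTop (𝓝 (ψ g)) := by
    refine tendsto_const_nhds.congr fun n => ?_
    rw [map_smul, h1, smul_eq_mul, ← mul_assoc, inv_mul_cancel₀ (pow_ne_zero _ h.ne_zero), one_mul]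
  have h4 := tendsto_nhds_unique h3 h2
  rw [h4]
  simp [mul_comm]

theorem eigenvalue_eq (h : IsDominant T lam f φ) {κ : ℂ} {g : E} (hg : T g = κ • g)
    (hφ : φ g ≠ 0) : κ = lam := by
  have := h.adj g
  rw [hg, map_smul, smul_eq_mul] at this
  exact mul_right_cancel₀ hφ this

/-- On the kernel of φ the sequence λ⁻ⁿ Tⁿ g tends to 0, whereas |κ| ≥ |λ| would keep its norm above
‖g‖. -/
theorem norm_eigenvalue_lt [CompleteSpace E] (h : IsDominant T lam f φ) {κ : ℂ} {g : E}
    (hg : T g = κ • g) (hφ : φ g = 0) (hg0 : g ≠ 0) : ‖κ‖ < ‖lam‖ := by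
  by_contra! hle
  have h1 : ∀ n : ℕ, (T ^ n) g = κ ^ n • g := by
    intro n
    induction n with
    | zero => simp
    | succ n ih =>
      rw [pow_succ, mul_apply_eq_comp, hg, map_smul, ih, smul_smul]; ring_nf
  have h2 := (h.tendsto_inv_pow g).norm
  rw [hφ, zero_smul, norm_zero] at h2
  have h3 : ‖g‖ ≤ 0 := by
    refine ge_of_tendsto h2 (Eventually.of_forall fun n => ?_)
    rw [h1, smul_smul, norm_smul, norm_mul, norm_inv, norm_pow, norm_pow, ← inv_pow, ← mul_pow]
    refine le_mul_of_one_le_left (norm_nonneg _) (one_le_pow₀ ?_)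
    rw [inv_mul_eq_div, one_le_div h.norm_pos]
    exact hle
  exact hg0 (norm_le_zero_iff.1 h3)

/-- If one eigenvector is not annihilated by the other functional, the eigenvalues agree. If both
are annihilated, each eigenvalue would be strictly smaller in modulus than the other. -/
theorem eigenvalue_unique [CompleteSpace E] (h : IsDominant T lam f φ) {lam' : ℂ} {f' : E}
    {φ' : E →L[ℂ] ℂ} (h' : IsDominant T lam' f' φ') : lam' = lam := by
  by_cases h1 : φ f' = 0
  · have h2 := h.norm_eigenvalue_lt h'.eig h1 h'.vec_ne_zero
    by_cases h3 : φ' f = 0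
    · exact absurd (h'.norm_eigenvalue_lt h.eig h3 h.vec_ne_zero) h2.le.not_gt
    · exact (h'.eigenvalue_eq h.eig h3).symm
  · exact h.eigenvalue_eq h'.eig h1

theorem rescale (h : IsDominant T lam f φ) {c : ℂ} (hc : c ≠ 0) :
    IsDominant T lam (c⁻¹ • f) (c • φ) where
  eig := by rw [map_smul, h.eig, smul_comm]
  adj g := by simp only [smul_apply, h.adj, smul_eq_mul]; ring
  pair := by simp [h.pair, hc]
  gap := by
    have : (c • φ).smulRight (c⁻¹ • f) = φ.smulRight f := by
      ext g
      simp only [ContinuousLinearMap.smulRight_apply, smul_apply, smul_smul,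
        smul_eq_mul]
      congr 1
      field_simp
    rw [this]
    exact h.gap

/-- The only freedom in a dominant triple is the scaling f ↦ c⁻¹ f, φ ↦ c φ, and fixing φ(e) removes
it. With e the constant function 1, this identifies triples obtained by different constructions. -/
theorem unique_of_normalized [CompleteSpace E] (h : IsDominant T lam f φ) {lam' : ℂ} {f' : E}
    {φ' : E →L[ℂ] ℂ} (h' : IsDominant T lam' f' φ') {e : E} (he : φ e = 1) (he' : φ' e = 1) :
    lam' = lam ∧ f' = f ∧ φ' = φ := by
  obtain rfl := h.eigenvalue_unique h'
  have h1 := h.eq_smul_of_adj h'.adj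
  have h2 : φ' f = 1 := by
    have := congrArg (fun ψ : E →L[ℂ] ℂ => ψ e) h1
    simpa [he, he'] using this.symm
  rw [h2, one_smul] at h1
  have h3 := h.eq_smul_of_eig h'.eig
  rw [← h1, h'.pair, one_smul] at h3
  exact ⟨rfl, h3, h1⟩

end IsDominant

end Banach

/-! ### Differentiable dependence of a dominant eigentriple on a parameter. -/

section Perturbation

variable {E : Type*} [NormedAddCommGroup E] [NormedSpace ℂ E] [CompleteSpace E]

theorem eventually_spectrum_norm_le {A ι : Type*} [NormedRing A] [NormedAlgebra ℂ A]
    [CompleteSpace A] {l : Filter ι} {N : ι → A} {N₀ : A} (hN : Tendsto N l (𝓝 N₀)) {r r' : ℝ}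
    (hr : r < r') (h : ∀ z ∈ spectrum ℂ N₀, ‖z‖ ≤ r) :
    ∀ᶠ i in l, ∀ z ∈ spectrum ℂ (N i), ‖z‖ ≤ r' := by
  have h1 := (upperHemicontinuous_iff_forall_isOpen.1 (upperHemicontinuous_spectrum ℂ A)) N₀
    (Metric.ball 0 r') Metric.isOpen_ball
    (fun z hz => by simpa using (h z hz).trans_lt hr)
  filter_upwards [hN.eventually h1] with i hi z hz
  simpa using (Metric.mem_ball.1 (hi hz)).le

-- The rank one term moves the simple eigenvalue λ to 0, and the rest of the spectrum already lies
-- in a smaller disc.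
omit [CompleteSpace E] in
theorem IsDominant.isUnit_resolvent {T : E →L[ℂ] E} {lam : ℂ} {f : E} {φ : E →L[ℂ] ℂ}
    (h : IsDominant T lam f φ) :
    IsUnit (algebraMap ℂ (E →L[ℂ] E) lam - (T - φ.smulRight (lam • f))) := by
  obtain ⟨r, h0, h1, h2⟩ := h.gap
  have h3 : lam ∉ spectrum ℂ (T - lam • φ.smulRight f) := fun hl => (h2 lam hl).not_gt h1
  have e : φ.smulRight (lam • f) = lam • φ.smulRight f := by
    ext g; simp [smul_smul, mul_comm]
  rw [e]
  simpa [spectrum, resolventSet] using h3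

omit [CompleteSpace E] in
theorem inverse_apply_eq {A : E →L[ℂ] E} (hA : IsUnit A) {u v : E} (h : A u = v) :
    Ring.inverse A v = u := by
  rw [← h, ← mul_apply_eq_comp, Ring.inverse_mul_cancel _ hA]
  rfl

omit [CompleteSpace E] in
theorem apply_inverse {A : E →L[ℂ] E} (hA : IsUnit A) (v : E) : A (Ring.inverse A v) = v := by
  rw [← mul_apply_eq_comp, Ring.mul_inverse_cancel _ hA]
  rfl

omit [CompleteSpace E] in
theorem inverse_apply {A : E →L[ℂ] E} (hA : IsUnit A) (v : E) : Ring.inverse A (A v) = v :=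
  inverse_apply_eq hA rfl

omit [CompleteSpace E] in
theorem hasDerivAt_apply {G : Type*} [NormedAddCommGroup G] [NormedSpace ℂ G]
    {A : ℝ → E →L[ℂ] G} {A' : E →L[ℂ] G} {u : ℝ → E} {u' : E} {a : ℝ} (hA : HasDerivAt A A' a)
    (hu : HasDerivAt u u' a) : HasDerivAt (fun t => A t (u t)) (A' (u a) + A a u') a := by
  have h1 := (ContinuousLinearMap.restrictScalarsL ℂ E G ℝ ℝ).hasFDerivAt.comp_hasDerivAt a hA
  exact h1.clm_apply hu

/-- Put B(a, z) = z - T_a + φ⊗s₀. Where B is invertible, a vector h with T_a h = z h and φ(h) = 1 is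
the same as h = B⁻¹ s₀ together with the scalar equation φ(B⁻¹ s₀) = 1. The implicit function
theorem solves this equation for z; then B⁻¹ s₀ is the eigenvector and φ B⁻¹ a left eigenvector. -/
theorem IsDominant.exists_perturbation {T : ℝ → E →L[ℂ] E} {T' : E →L[ℂ] E} {a₀ : ℝ}
    (hT : HasStrictDerivAt T T' a₀) {lam : ℂ} {f : E} {φ : E →L[ℂ] ℂ}
    (h : IsDominant (T a₀) lam f φ) :
    ∃ (l : ℝ → ℂ) (F : ℝ → E) (Φ : ℝ → E →L[ℂ] ℂ), l a₀ = lam ∧ F a₀ = f ∧ Φ a₀ = φ ∧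
      DifferentiableAt ℝ l a₀ ∧ DifferentiableAt ℝ F a₀ ∧ DifferentiableAt ℝ Φ a₀ ∧
      ∀ᶠ a in 𝓝 a₀, IsDominant (T a) (l a) (F a) (Φ a) := by
  have hl0 := h.ne_zero
  set s₀ : E := lam • f with hs₀
  set B : ℝ × ℂ → E →L[ℂ] E := fun p => p.2 • (1 : E →L[ℂ] E) - (T p.1 - φ.smulRight s₀) with hB
  have hBapp : ∀ p h, B p h = p.2 • h - (T p.1 h - φ h • s₀) := fun p h => by simp [hB]
  have hBu : IsUnit (B (a₀, lam)) := by
    have := h.isUnit_resolvent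
    rwa [Algebra.algebraMap_eq_smul_one] at this
  have hBd : ∃ B' : ℝ × ℂ →L[ℝ] E →L[ℂ] E, HasStrictFDerivAt B B' (a₀, lam) := by
    have h1 : HasStrictFDerivAt (fun p : ℝ × ℂ => p.2) (ContinuousLinearMap.snd ℝ ℝ ℂ) (a₀, lam) :=
      hasStrictFDerivAt_snd
    have h2 := HasStrictFDerivAt.smul_const h1 (1 : E →L[ℂ] E)
    have h3 : HasStrictFDerivAt (fun p : ℝ × ℂ => T p.1) _ (a₀, lam) :=
      HasStrictFDerivAt.comp (g := T) (a₀, lam) hT.hasStrictFDerivAt hasStrictFDerivAt_fst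
    exact ⟨_, h2.sub (h3.sub_const _)⟩
  obtain ⟨B', hB'⟩ := hBd
  set R : ℝ × ℂ → E →L[ℂ] E := fun p => Ring.inverse (B p) with hR
  have hRd : ∃ R' : ℝ × ℂ →L[ℝ] E →L[ℂ] E, HasStrictFDerivAt R R' (a₀, lam) := by
    obtain ⟨u, hu⟩ := hBu
    have h1 := hasStrictFDerivAt_ringInverse (𝕜 := ℝ) u
    rw [hu] at h1
    exact ⟨_, h1.comp (a₀, lam) hB'⟩
  obtain ⟨R', hR'⟩ := hRd
  set g : ℝ × ℂ → ℂ := fun p => φ (R p s₀) with hg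
  set ev : (E →L[ℂ] E) →L[ℝ] ℂ :=
    (φ.comp (ContinuousLinearMap.apply ℂ E s₀)).restrictScalars ℝ with hev
  have hgd : HasStrictFDerivAt g (ev.comp R') (a₀, lam) :=
    ev.hasStrictFDerivAt.comp (a₀, lam) hR'
  have hRz : ∀ z : ℂ, z ≠ 0 → IsUnit (B (a₀, z)) → R (a₀, z) s₀ = (lam * z⁻¹) • f := by
    intro z hz0 hz
    refine inverse_apply_eq hz ?_
    rw [hBapp]
    simp only [map_smul, h.eig, h.pair, hs₀, smul_smul, smul_eq_mul, mul_one]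
    rw [show z * (lam * z⁻¹) = lam by field_simp, show lam * z⁻¹ * lam = lam * z⁻¹ * lam from rfl,
      sub_self, sub_zero]
  -- At a₀ the vector f solves the equation explicitly. The z-derivative at λ is therefore -λ⁻¹,
  -- which is the invertibility that the implicit function theorem needs.
  have hgz : ∀ᶠ z in 𝓝 lam, g (a₀, z) = lam * z⁻¹ := by
    have hc : ContinuousAt (fun z : ℂ => B (a₀, z)) lam :=
      ContinuousAt.comp (f := fun z : ℂ => (a₀, z)) (g := B) hB'.continuousAt (by fun_prop)
    filter_upwards [hc.eventually (Units.isOpen.mem_nhds hBu), eventually_ne_nhds hl0]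
      with z hz hz0
    simp [hg, hRz z hz0 hz, h.pair]
  have hpart : (ev.comp R').comp (ContinuousLinearMap.inr ℝ ℝ ℂ)
      = (-lam⁻¹) • ContinuousLinearMap.id ℝ ℂ := by
    have h1 : HasFDerivAt (fun z : ℂ => g (a₀, z))
        ((ev.comp R').comp (ContinuousLinearMap.inr ℝ ℝ ℂ)) lam :=
      HasFDerivAt.comp (g := g) lam hgd.hasFDerivAt (hasFDerivAt_prodMk_right a₀ lam)
    have h2 : HasDerivAt (fun z : ℂ => lam * z⁻¹) (-lam⁻¹) lam := by
      have := (hasDerivAt_inv hl0).const_mul lam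
      rwa [mul_neg, pow_two, mul_inv, ← mul_assoc, mul_inv_cancel₀ hl0, one_mul] at this
    have h3 := (h2.congr_of_eventuallyEq hgz).hasFDerivAt.restrictScalars ℝ
    rw [h1.unique h3]
    ext <;> simp [mul_comm]
  have hinv : ((ev.comp R').comp (ContinuousLinearMap.inr ℝ ℝ ℂ)).IsInvertible := by
    rw [hpart]
    refine ContinuousLinearMap.IsInvertible.of_inverse
      (g := (-lam) • ContinuousLinearMap.id ℝ ℂ) ?_ ?_ <;>
    · ext <;> simp [hl0]
  set l := hgd.implicitFunctionOfProdDomain hinv with hl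
  have hla : l a₀ = lam :=
    (hgd.eventually_apply_eq_iff_implicitFunctionOfProdDomain hinv).self_of_nhds.mp rfl
  have hld : DifferentiableAt ℝ l a₀ :=
    (hgd.hasStrictFDerivAt_implicitFunctionOfProdDomain hinv).hasFDerivAt.differentiableAt
  have hga : g (a₀, lam) = 1 := by
    rw [hgz.self_of_nhds, mul_inv_cancel₀ hl0]
  have hgl : ∀ᶠ a in 𝓝 a₀, g (a, l a) = 1 := by
    have := hgd.eventually_apply_implicitFunctionOfProdDomain hinv
    rwa [hga] at this
  have hRl : DifferentiableAt ℝ (fun a => R (a, l a)) a₀ := by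
    have h1 : DifferentiableAt ℝ R (a₀, l a₀) := by
      rw [hla]; exact hR'.hasFDerivAt.differentiableAt
    exact DifferentiableAt.comp (g := R) a₀ h1 (differentiableAt_id.prodMk hld)
  have hBl : ∀ᶠ a in 𝓝 a₀, IsUnit (B (a, l a)) := by
    have h1 : ContinuousAt B (a₀, l a₀) := by rw [hla]; exact hB'.continuousAt
    have h2 : ContinuousAt (fun a => B (a, l a)) a₀ :=
      ContinuousAt.comp (g := B) h1 (continuousAt_id.prodMk hld.continuousAt)
    refine h2.eventually (Units.isOpen.mem_nhds ?_)
    change IsUnit (B (a₀, l a₀))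
    rw [hla]; exact hBu
  set f₁ : ℝ → E := fun a => R (a, l a) s₀ with hf₁
  set φ₁ : ℝ → E →L[ℂ] ℂ := fun a => φ.comp (R (a, l a)) with hφ₁
  have hf₁d : DifferentiableAt ℝ f₁ a₀ :=
    ((ContinuousLinearMap.apply ℂ E s₀).restrictScalars ℝ).differentiableAt.comp a₀ hRl
  have hφ₁d : DifferentiableAt ℝ φ₁ a₀ :=
    ((ContinuousLinearMap.compL ℂ E E ℂ φ).restrictScalars ℝ).differentiableAt.comp a₀ hRl
  have hf₁a : f₁ a₀ = f := by
    simp only [hf₁]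
    rw [hla, hRz lam hl0 hBu, mul_inv_cancel₀ hl0, one_smul]
  have hφ₁a : φ₁ a₀ = lam⁻¹ • φ := by
    ext v
    simp only [hφ₁, hla, ContinuousLinearMap.comp_apply, smul_apply, smul_eq_mul]
    have h1 : φ (B (a₀, lam) (R (a₀, lam) v)) = φ v := by rw [apply_inverse hBu]
    rw [hBapp] at h1
    simp only [map_sub, map_smul, smul_eq_mul, h.adj, hs₀, h.pair] at h1
    rw [← h1]
    field_simp
    ring
  -- At a₀ this pairing is λ⁻¹, so it stays nonzero nearby; dividing φ₁ by it makes the pairing 1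
  -- and restores φ at a₀.
  set c : ℝ → ℂ := fun a => φ₁ a (f₁ a) with hc
  have hcd : DifferentiableAt ℝ c a₀ := 
    (hasDerivAt_apply hφ₁d.hasDerivAt hf₁d.hasDerivAt).differentiableAt
  have hca : c a₀ = lam⁻¹ := by simp [hc, hφ₁a, hf₁a, h.pair]
  have hc0 : ∀ᶠ a in 𝓝 a₀, c a ≠ 0 :=
    hcd.continuousAt.eventually_ne (by rw [hca]; exact inv_ne_zero hl0)
  have hΦd : DifferentiableAt ℝ (fun a => (c a)⁻¹ • φ₁ a) a₀ :=
    (hcd.inv hc0.self_of_nhds).smul hφ₁d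
  have hΦa : (c a₀)⁻¹ • φ₁ a₀ = φ := by
    rw [hca, hφ₁a, smul_smul, inv_inv, mul_inv_cancel₀ hl0, one_smul]
  refine ⟨l, f₁, fun a => (c a)⁻¹ • φ₁ a, hla, hf₁a, hΦa, hld, hf₁d, hΦd, ?_⟩
  obtain ⟨r, hr0, hr1, hr⟩ := h.gap
  have hNt : Tendsto (fun a => T a - l a • ((c a)⁻¹ • φ₁ a).smulRight (f₁ a)) (𝓝 a₀)
      (𝓝 (T a₀ - lam • φ.smulRight f)) := by
    have hb : Continuous fun p : (E →L[ℂ] ℂ) × E => p.1.smulRight p.2 := by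
      have := (ContinuousLinearMap.smulRightL ℂ E E).continuous₂
      simpa [Function.uncurry_def] using this
    have h1 : Tendsto (fun a => ((c a)⁻¹ • φ₁ a).smulRight (f₁ a)) (𝓝 a₀) (𝓝 (φ.smulRight f)) := by
      have := (hb.tendsto (φ, f)).comp
        ((hΦa ▸ hΦd.continuousAt.tendsto).prodMk_nhds (hf₁a ▸ hf₁d.continuousAt.tendsto))
      exact this
    exact hT.hasDerivAt.continuousAt.tendsto.sub
      ((hla ▸ hld.continuousAt.tendsto).smul h1)
  -- The midpoint (r + |λ|)/2 serves twice: it bounds the spectra of nearby remainders from above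
  -- and |l a| from below.
  have hgap := eventually_spectrum_norm_le hNt (show r < (r + ‖lam‖) / 2 by linarith) hr
  have hnl : ∀ᶠ a in 𝓝 a₀, (r + ‖lam‖) / 2 < ‖l a‖ := by
    refine hld.continuousAt.norm.eventually (lt_mem_nhds ?_)
    change _ < ‖l a₀‖
    rw [hla]; linarith
  filter_upwards [hgl, hBl, hc0, hgap, hnl] with a h1 h2 h3 h4 h5
  have hTf : T a (f₁ a) = l a • f₁ a := by
    have e := apply_inverse h2 s₀
    rw [hBapp] at e
    change _ - (_ - φ (R (a, l a) s₀) • s₀) = s₀ at e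
    rw [show φ (R (a, l a) s₀) = 1 from h1, one_smul, sub_sub_eq_add_sub, add_sub_right_comm,
      add_eq_right, sub_eq_zero] at e
    exact e.symm
  have hTφ : ∀ v, φ₁ a (T a v) = l a * φ₁ a v := by
    intro v
    have e : φ (R (a, l a) (B (a, l a) v)) = φ v := by rw [inverse_apply h2]
    rw [hBapp] at e
    simp only [map_sub, map_smul, smul_eq_mul] at e
    rw [show φ (R (a, l a) s₀) = 1 from h1] at e
    change φ (R (a, l a) (T a v)) = l a * φ (R (a, l a) v)
    linear_combination -e
  exact ⟨hTf, fun v => by simp only [smul_apply, smul_eq_mul, hTφ]; ring,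
    by simpa [hc] using inv_mul_cancel₀ h3, _, by linarith, h5, h4⟩

end Perturbation

/-! ### Riesz projections over circles and dominant eigenvalues. -/

section Contour

variable {E : Type*} [NormedAddCommGroup E] [NormedSpace ℂ E] [CompleteSpace E]

theorem clm_circleIntegral {F G : Type*} [NormedAddCommGroup F] [NormedSpace ℂ F]
    [CompleteSpace F] [NormedAddCommGroup G] [NormedSpace ℂ G] [CompleteSpace G] (L : F →L[ℂ] G)
    {u : ℂ → F} {c : ℂ} {r : ℝ} (hu : CircleIntegrable u c r) :
    L (∮ z in C(c, r), u z) = ∮ z in C(c, r), L (u z) := by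
  simp only [circleIntegral]
  rw [← L.intervalIntegral_comp_comm hu.out]
  simp

theorem continuousOn_resolvent {A : Type*} [NormedRing A] [NormedAlgebra ℂ A] [CompleteSpace A]
    (T : A) : ContinuousOn (resolvent T) (resolventSet ℂ T) := fun _ hz =>
  (spectrum.hasDerivAt_resolvent_const_left hz).continuousAt.continuousWithinAt

omit [CompleteSpace E] in
theorem resolvent_apply_of_eig {T : E →L[ℂ] E} {κ z : ℂ} {f : E} (hf : T f = κ • f)
    (hz : z ∈ resolventSet ℂ T) (hzκ : z ≠ κ) : resolvent T z f = (z - κ)⁻¹ • f := by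
  refine inverse_apply_eq hz ?_
  simp only [Algebra.algebraMap_eq_smul_one, sub_apply, smul_apply,
    one_apply_eq_self, map_smul, hf]
  rw [← sub_smul, smul_smul, inv_mul_cancel₀ (sub_ne_zero.2 hzκ), one_smul]

theorem two_pi_I_ne_zero' : (2 * Real.pi * Complex.I : ℂ) ≠ 0 := Complex.two_pi_I_ne_zero

theorem circleIntegral_sub_inv_of_notMem {c w : ℂ} {r : ℝ} (hr : 0 ≤ r)
    (hw : w ∉ Metric.closedBall c r) : (∮ z in C(c, r), (z - w)⁻¹) = 0 := by
  refine DiffContOnCl.circleIntegral_eq_zero hr (DifferentiableOn.diffContOnCl ?_)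
  intro z hz
  have : z - w ≠ 0 := by
    rintro h
    rw [sub_eq_zero] at h
    exact hw (h ▸ Metric.closure_ball_subset_closedBall hz)
  exact ((differentiableAt_id.sub_const w).inv this).differentiableWithinAt

/-- The Riesz projection of `T` over a circle. -/
def rieszProj (T : E →L[ℂ] E) (z₀ : ℂ) (r : ℝ) : E →L[ℂ] E :=
  (2 * Real.pi * Complex.I : ℂ)⁻¹ • ∮ z in C(z₀, r), resolvent T z

theorem rieszProj_commute {T : E →L[ℂ] E} {z₀ : ℂ} {r : ℝ} (hr : 0 ≤ r)
    (hs : Metric.sphere z₀ r ⊆ resolventSet ℂ T) : Commute T (rieszProj T z₀ r) := by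
  have hi : CircleIntegrable (resolvent T) z₀ r :=
    ((continuousOn_resolvent T).mono hs).circleIntegrable hr
  refine Commute.smul_right ?_ _
  change T * _ = _ * T
  have h1 := clm_circleIntegral (ContinuousLinearMap.mul ℂ (E →L[ℂ] E) T) hi
  have h2 := clm_circleIntegral ((ContinuousLinearMap.mul ℂ (E →L[ℂ] E)).flip T) hi
  simp only [ContinuousLinearMap.mul_apply', ContinuousLinearMap.flip_apply] at h1 h2
  rw [h1, h2]
  refine circleIntegral.integral_congr hr fun z hz => ?_
  have hc : Commute T (algebraMap ℂ (E →L[ℂ] E) z - T) :=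
    Commute.sub_right (Algebra.commutes z T).symm (Commute.refl T)
  obtain ⟨u, hu⟩ := hs hz
  change Commute T (Ring.inverse _)
  rw [← hu] at hc ⊢
  rw [Ring.inverse_unit]
  exact hc.units_inv_right

/-- The resolvent acts on the eigenvector as the scalar (z - κ)⁻¹, and κ is not on the circle
because the circle avoids the spectrum. Cauchy's formula then gives 1 or 0. -/
theorem rieszProj_apply_of_eig {T : E →L[ℂ] E} {z₀ κ : ℂ} {r : ℝ} (hr : 0 ≤ r)
    (hs : Metric.sphere z₀ r ⊆ resolventSet ℂ T) {f : E} (hf : T f = κ • f) (hf0 : f ≠ 0) :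
    (κ ∈ Metric.closedBall z₀ r → rieszProj T z₀ r f = f) ∧
      (κ ∉ Metric.closedBall z₀ r → rieszProj T z₀ r f = 0) := by
  have hi : CircleIntegrable (resolvent T) z₀ r :=
    ((continuousOn_resolvent T).mono hs).circleIntegrable hr
  have hκ : κ ∉ resolventSet ℂ T := by
    intro h
    apply hf0
    have : (algebraMap ℂ (E →L[ℂ] E) κ - T) f = 0 := by
      simp [Algebra.algebraMap_eq_smul_one, hf]
    rw [← inverse_apply h f, this, map_zero]
  have h1 := clm_circleIntegral (ContinuousLinearMap.apply ℂ E f) hi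
  have h2 : (∮ z in C(z₀, r), resolvent T z) f = (∮ z in C(z₀, r), (z - κ)⁻¹) • f := by
    rw [← circleIntegral.integral_smul_const]
    refine h1.trans (circleIntegral.integral_congr hr fun z hz => ?_)
    exact resolvent_apply_of_eig hf (hs hz) fun h => hκ (h ▸ hs hz)
  rw [rieszProj, smul_apply, h2, smul_smul]
  constructor
  · intro hk
    have hk' : κ ∈ Metric.ball z₀ r := by
      rcases (Metric.mem_closedBall.1 hk).lt_or_eq with h | h
      · exact h
      · exact absurd (hs h) hκ
    rw [circleIntegral.integral_sub_inv_of_mem_ball hk', inv_mul_cancel₀ two_pi_I_ne_zero',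
      one_smul]
  · intro hk
    rw [circleIntegral_sub_inv_of_notMem hr hk, mul_zero, zero_smul]

namespace IsDominant

variable {T : E →L[ℂ] E} {lam : ℂ} {f : E} {φ : E →L[ℂ] ℂ}

-- The idempotent Q = φ⊗f commutes with A = z - (T - λQ), and AQ = zQ. So the inverse of z - T = A -
-- λQ can be sought as A⁻¹ + κQ, which leaves one scalar equation for κ.
omit [CompleteSpace E] in
theorem resolvent_eq (h : IsDominant T lam f φ) {z : ℂ} (hz0 : z ≠ 0) (hzl : z ≠ lam)
    (hz : z ∈ resolventSet ℂ (T - lam • φ.smulRight f)) :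
    z ∈ resolventSet ℂ T ∧ resolvent T z = resolvent (T - lam • φ.smulRight f) z
      + ((z - lam)⁻¹ - z⁻¹) • φ.smulRight f := by
  set Q : E →L[ℂ] E := φ.smulRight f with hQ
  set A : E →L[ℂ] E := algebraMap ℂ (E →L[ℂ] E) z - (T - lam • Q) with hA
  have hz' : IsUnit A := hz
  have hQQ : Q * Q = Q := by ext v; simp [hQ, h.pair]
  have hAQ : A * Q = z • Q := by
    ext v; simp [hA, hQ, h.pair, h.eig, Algebra.algebraMap_eq_smul_one, smul_smul, mul_comm]
  have hQA : Q * A = z • Q := by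
    ext v
    simp [hA, hQ, h.pair, h.adj, Algebra.algebraMap_eq_smul_one, smul_smul]
  have hT : algebraMap ℂ (E →L[ℂ] E) z - T = A - lam • Q := by simp only [hA]; abel
  set κ : ℂ := (z - lam)⁻¹ - z⁻¹ with hκ
  have hzl' : z - lam ≠ 0 := sub_ne_zero.2 hzl
  have hAiQ : Ring.inverse A * Q = z⁻¹ • Q := by
    have : Ring.inverse A * (A * Q) = Q := by rw [← mul_assoc, Ring.inverse_mul_cancel _ hz', one_mul]
    rw [hAQ, mul_smul_comm] at this
    rw [← this, smul_smul, inv_mul_cancel₀ hz0, one_smul, this]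
  have hQAi : Q * Ring.inverse A = z⁻¹ • Q := by
    have : (Q * A) * Ring.inverse A = Q := by rw [mul_assoc, Ring.mul_inverse_cancel _ hz', mul_one]
    rw [hQA, smul_mul_assoc] at this
    rw [← this, smul_smul, inv_mul_cancel₀ hz0, one_smul, this]
  have hcoef : κ * z - lam * z⁻¹ - lam * κ = 0 := by
    simp only [hκ]; field_simp; ring
  have h1 : (A - lam • Q) * (Ring.inverse A + κ • Q) = 1 := by
    rw [sub_mul, mul_add, mul_add, Ring.mul_inverse_cancel _ hz', smul_mul_assoc, smul_mul_assoc,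
      mul_smul_comm, mul_smul_comm, hAQ, hQAi, hQQ, smul_smul, smul_smul, smul_smul]
    have : 1 + (κ * z) • Q - ((lam * z⁻¹) • Q + (lam * κ) • Q)
        = 1 + (κ * z - lam * z⁻¹ - lam * κ) • Q := by module
    rw [this, hcoef, zero_smul, add_zero]
  have h2 : (Ring.inverse A + κ • Q) * (A - lam • Q) = 1 := by
    rw [mul_sub, add_mul, add_mul, Ring.inverse_mul_cancel _ hz', smul_mul_assoc, smul_mul_assoc,
      mul_smul_comm, mul_smul_comm, hQA, hAiQ, hQQ, smul_smul, smul_smul, smul_smul, mul_comm κ lam]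
    have : 1 + (κ * z) • Q - ((lam * z⁻¹) • Q + (lam * κ) • Q)
        = 1 + (κ * z - lam * z⁻¹ - lam * κ) • Q := by module
    rw [this, hcoef, zero_smul, add_zero]
  let u : (E →L[ℂ] E)ˣ := ⟨A - lam • Q, Ring.inverse A + κ • Q, h1, h2⟩
  have hu : algebraMap ℂ (E →L[ℂ] E) z - T = u := hT
  refine ⟨?_, ?_⟩
  · change IsUnit _
    rw [hu]; exact u.isUnit
  · rw [resolvent, hu, Ring.inverse_unit]
    rfl

omit [CompleteSpace E] in
theorem mem_spectrum (h : IsDominant T lam f φ) : lam ∈ spectrum ℂ T := by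
  intro hu
  apply h.vec_ne_zero
  have : (algebraMap ℂ (E →L[ℂ] E) lam - T) f = 0 := by
    simp [Algebra.algebraMap_eq_smul_one, h.eig]
  rw [← inverse_apply hu f, this, map_zero]

omit [CompleteSpace E] in
theorem spectrum_subset (h : IsDominant T lam f φ) :
    ∃ r, 0 ≤ r ∧ r < ‖lam‖ ∧ (∀ z ∈ spectrum ℂ (T - lam • φ.smulRight f), ‖z‖ ≤ r) ∧
      ∀ z ∈ spectrum ℂ T, z ≠ lam → ‖z‖ ≤ r := by
  obtain ⟨r, h0, h1, h2⟩ := h.gap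
  refine ⟨r, h0, h1, h2, fun z hz hzl => ?_⟩
  by_contra! hr
  refine hz (h.resolvent_eq (norm_pos_iff.1 (h0.trans_lt hr)) hzl ?_).1
  by_contra h3
  exact (h2 z h3).not_gt hr

omit [CompleteSpace E] in
theorem spectralRadius_eq (h : IsDominant T lam f φ) :
    spectralRadius ℂ T = ENNReal.ofReal ‖lam‖ := by
  obtain ⟨r, h0, h1, -, h2⟩ := h.spectrum_subset
  refine le_antisymm (iSup₂_le fun z hz => ?_) ?_
  · rw [← ENNReal.ofReal_coe_nnreal]
    refine ENNReal.ofReal_le_ofReal ?_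
    by_cases hzl : z = lam
    · rw [hzl]; rfl
    · exact (h2 z hz hzl).trans h1.le
  · rw [ofReal_norm]
    exact le_iSup₂ (f := fun (k : ℂ) (_ : k ∈ spectrum ℂ T) => (‖k‖₊ : ℝ≥0∞)) lam h.mem_spectrum

theorem tendsto_norm_pow (h : IsDominant T lam f φ) :
    Tendsto (fun n : ℕ => ‖T ^ n‖ ^ (1 / (n : ℝ))) atTop (𝓝 ‖lam‖) := by
  have h1 := spectrum.pow_norm_pow_one_div_tendsto_nhds_spectralRadius T
  rw [h.spectralRadius_eq] at h1
  have h2 := (ENNReal.tendsto_toReal ENNReal.ofReal_ne_top).comp h1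
  rw [ENNReal.toReal_ofReal (norm_nonneg _)] at h2
  refine h2.congr fun n => ?_
  exact ENNReal.toReal_ofReal (by positivity)

/-- On a circle of radius half the spectral gap, `resolvent_eq` splits the resolvent. The
remainder's resolvent and z⁻¹ are holomorphic on the closed disc, so only (z - λ)⁻¹ φ⊗f contributes.
-/
theorem rieszProj_eq (h : IsDominant T lam f φ) :
    ∃ r, 0 < r ∧ r < ‖lam‖ ∧ spectrum ℂ T ∩ Metric.closedBall lam r = {lam} ∧
      rieszProj T lam r = φ.smulRight f := by
  obtain ⟨r, h0, h1, h2, h3⟩ := h.spectrum_subset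
  set ρ := (‖lam‖ - r) / 2 with hρ
  have hρ0 : 0 < ρ := by simp only [hρ]; linarith
  have hb : ∀ z ∈ Metric.closedBall lam ρ, r < ‖z‖ := by
    intro z hz
    rw [Metric.mem_closedBall, dist_eq_norm] at hz
    have := norm_sub_norm_le lam z
    rw [norm_sub_rev] at this
    simp only [hρ] at hz; linarith
  have hres : ∀ z ∈ Metric.closedBall lam ρ, z ∈ resolventSet ℂ (T - lam • φ.smulRight f) := by
    intro z hz
    by_contra h4
    exact (h2 z h4).not_gt (hb z hz)
  refine ⟨ρ, hρ0, by simp only [hρ]; linarith, ?_, ?_⟩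
  · ext z
    constructor
    · rintro ⟨hz, hz'⟩
      by_contra hzl
      exact (h3 z hz hzl).not_gt (hb z hz')
    · rintro rfl
      exact ⟨h.mem_spectrum, Metric.mem_closedBall_self hρ0.le⟩
  · have hsb : Metric.sphere lam ρ ⊆ Metric.closedBall lam ρ := Metric.sphere_subset_closedBall
    have e : (∮ z in C(lam, ρ), resolvent T z) = ∮ z in C(lam, ρ),
        (resolvent (T - lam • φ.smulRight f) z + ((z - lam)⁻¹ - (z - 0)⁻¹) • φ.smulRight f) := by
      refine circleIntegral.integral_congr hρ0.le fun z hz => ?_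
      simp only [sub_zero]
      refine (h.resolvent_eq (norm_pos_iff.1 (h0.trans_lt (hb z (hsb hz)))) ?_ (hres z (hsb hz))).2
      rintro rfl
      rw [mem_sphere_iff_norm, sub_self, norm_zero] at hz
      exact hρ0.ne hz
    have hlam : lam ∉ Metric.sphere lam |ρ| := by
      rw [abs_of_pos hρ0, mem_sphere_iff_norm, sub_self, norm_zero]; exact hρ0.ne
    have h0b : (0 : ℂ) ∉ Metric.closedBall lam ρ := fun hm => by
      have := hb 0 hm
      rw [norm_zero] at this; linarith
    have h0s : (0 : ℂ) ∉ Metric.sphere lam |ρ| := by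
      rw [abs_of_pos hρ0]; exact fun hm => h0b (hsb hm)
    have hi1 : CircleIntegrable (fun z : ℂ => (z - lam)⁻¹) lam ρ :=
      circleIntegrable_sub_inv_iff.2 (Or.inr hlam)
    have hi2 : CircleIntegrable (fun z : ℂ => (z - 0)⁻¹) lam ρ :=
      circleIntegrable_sub_inv_iff.2 (Or.inr h0s)
    have hi3 : CircleIntegrable (fun z : ℂ => resolvent (T - lam • φ.smulRight f) z) lam ρ :=
      ((continuousOn_resolvent _).mono fun z hz => hres z (hsb hz)).circleIntegrable hρ0.le
    have hi4 : CircleIntegrable (fun z : ℂ => ((z - lam)⁻¹ - (z - 0)⁻¹) • φ.smulRight f) lam ρ :=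
      (hi1.sub hi2).smul_continuousOn continuousOn_const
    have hz : (∮ z in C(lam, ρ), resolvent (T - lam • φ.smulRight f) z) = 0 := by
      refine DiffContOnCl.circleIntegral_eq_zero hρ0.le (DifferentiableOn.diffContOnCl ?_)
      intro z hz
      exact (spectrum.hasDerivAt_resolvent_const_left
        (hres z (Metric.closure_ball_subset_closedBall hz))).differentiableAt.differentiableWithinAt
    rw [rieszProj, e, circleIntegral.integral_add hi3 hi4, hz, zero_add,
      circleIntegral.integral_smul_const, circleIntegral.integral_sub hi1 hi2,
      circleIntegral.integral_sub_inv_of_mem_ball (Metric.mem_ball_self hρ0),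
      circleIntegral_sub_inv_of_notMem hρ0.le h0b, sub_zero, smul_smul,
      inv_mul_cancel₀ two_pi_I_ne_zero', one_smul]

end IsDominant

/-- A rank one Riesz projection whose complementary part has spectrum in a smaller disc comes from
a simple dominant eigenvalue. -/
theorem isDominant_of_rieszProj {T : E →L[ℂ] E} {z₀ : ℂ} {r ρ : ℝ} (hr : 0 < r) (hrz : r < ‖z₀‖)
    (hiso : {z | z ≠ 0 ∧ z ∈ spectrum ℂ T} ∩ Metric.closedBall z₀ r = {z₀}) {f : E}
    {φ : E →L[ℂ] ℂ} (hQ : rieszProj T z₀ r = φ.smulRight f) (hρ : ρ < ‖z₀‖)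
    (hgap : ∀ z, z ≠ 0 ∧ z ∈ spectrum ℂ (T - z₀ • rieszProj T z₀ r) → ‖z‖ ≤ ρ) :
    IsDominant T z₀ f φ := by
  have hz₀ : z₀ ≠ 0 := norm_pos_iff.1 (hr.trans hrz)
  have hz₀s : z₀ ∈ spectrum ℂ T := by
    have : z₀ ∈ ({z₀} : Set ℂ) := rfl
    rw [← hiso] at this
    exact this.1.2
  have h0b : (0 : ℂ) ∉ Metric.closedBall z₀ r := by
    rw [Metric.mem_closedBall, dist_eq_norm, zero_sub, norm_neg]; exact hrz.not_ge
  have hs : Metric.sphere z₀ r ⊆ resolventSet ℂ T := by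
    intro z hz
    by_contra hzs
    have hzb := Metric.sphere_subset_closedBall hz
    have : z ∈ ({z₀} : Set ℂ) := by
      rw [← hiso]
      exact ⟨⟨fun h => h0b (h ▸ hzb), hzs⟩, hzb⟩
    rw [Set.mem_singleton_iff.1 this, mem_sphere_iff_norm, sub_self, norm_zero] at hz
    exact hr.ne hz
  have hNu : z₀ ∉ spectrum ℂ (T - z₀ • rieszProj T z₀ r) := fun h =>
    (hgap z₀ ⟨hz₀, h⟩).not_gt hρ
  have hcomm := rieszProj_commute hr.le hs
  have hQ0 : rieszProj T z₀ r ≠ 0 := by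
    intro h
    rw [h, smul_zero, sub_zero] at hNu
    exact hNu hz₀s
  rw [hQ] at hcomm hQ0 hNu
  have hf0 : f ≠ 0 := by
    rintro rfl
    exact hQ0 (by ext; simp)
  obtain ⟨g, hg⟩ : ∃ g, φ g = 1 := by
    have : ∃ g, φ g ≠ 0 := by
      by_contra! h
      exact hQ0 (by ext v; simp [h v])
    obtain ⟨g, hg⟩ := this
    exact ⟨(φ g)⁻¹ • g, by simp [hg]⟩
  -- Commutation of T with a rank one operator makes f an eigenvector and φ a left eigenvector, with
  -- a common eigenvalue κ. It remains to show κ = z₀.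
  have hc : ∀ v, φ v • T f = φ (T v) • f := fun v => by
    have := congrArg (fun A : E →L[ℂ] E => A v) hcomm.eq
    simpa using this
  set κ := φ (T g) with hκ
  have hTf : T f = κ • f := by simpa [hg] using hc g
  have hTφ : ∀ v, φ (T v) = κ * φ v := by
    intro v
    have := hc v
    rw [hTf, smul_smul] at this
    rw [mul_comm]
    exact (smul_left_injective ℂ hf0 this).symm
  obtain ⟨hin, hout⟩ := rieszProj_apply_of_eig hr.le hs hTf hf0
  rw [hQ] at hin hout
  by_cases hκb : κ ∈ Metric.closedBall z₀ r
  · have h1 : φ f = 1 := by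
      have : φ f • f = (1 : ℂ) • f := by simpa using hin hκb
      exact smul_left_injective ℂ hf0 this
    have hκs : κ ∈ spectrum ℂ T := by
      intro hu
      apply hf0
      have : (algebraMap ℂ (E →L[ℂ] E) κ - T) f = 0 := by
        simp [Algebra.algebraMap_eq_smul_one, hTf]
      rw [← inverse_apply hu f, this, map_zero]
    have hκz : κ = z₀ := by
      have : κ ∈ ({z₀} : Set ℂ) := by
        rw [← hiso]
        exact ⟨⟨fun h => h0b (h ▸ hκb), hκs⟩, hκb⟩
      exact this
    rw [hκz] at hTf hTφ
    -- The hypothesis ignores the spectral point 0, and ρ may be negative; hence the maximum with 0.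
    refine ⟨hTf, hTφ, h1, max 0 ρ, le_max_left _ _, max_lt (norm_pos_iff.2 hz₀) hρ, fun z hz => ?_⟩
    by_cases hz0 : z = 0
    · simp [hz0]
    · exact (hgap z ⟨hz0, by rw [hQ]; exact hz⟩).trans (le_max_right _ _)
  -- If κ were outside the disc, then φ(f) = 0 and z₀ φ⊗f would be nilpotent and commute with T.
  -- Removing it cannot affect the invertibility of z₀ - T, so z₀ would not be in the spectrum.
  · exfalso
    have h1 : φ f = 0 := by
      have := hout hκb
      simpa [hf0] using this
    have hu : IsUnit (algebraMap ℂ (E →L[ℂ] E) z₀ - (T - z₀ • φ.smulRight f)) := by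
      simpa [spectrum, resolventSet] using hNu
    have hnil : IsNilpotent (-(z₀ • φ.smulRight f) : E →L[ℂ] E) := by
      refine ⟨2, ?_⟩
      ext v
      simp [pow_two, h1]
    have hcm : Commute (-(z₀ • φ.smulRight f) : E →L[ℂ] E)
        (algebraMap ℂ (E →L[ℂ] E) z₀ - (T - z₀ • φ.smulRight f)) := by
      refine Commute.neg_left (Commute.sub_right (Algebra.commutes z₀ _).symm
        (Commute.sub_right ?_ (Commute.refl _)))
      exact (hcomm.smul_right z₀).symm
    have := hnil.isUnit_add_left_of_commute hu hcm
    refine hz₀s ?_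
    change IsUnit _
    convert this using 1
    abel

end Contour

/-! ### Equivalence of w-uniformity and dominance. -/

section Uniform

variable {X : Type*} [MeasurableSpace X] {w : X → ℝ≥0}

/-- Only the pole of multiplicity one at `lam` enters; its coefficient m is absorbed into the
eigenfunction. -/
theorem IsUniformOpWith.exists_isDominant {T : LInf w →L[ℂ] LInf w} {lam : ℂ}
    (h : IsUniformOpWith T lam) : ∃ (f : LInf w) (ν : M1 w), IsDominant T lam f ν.toDual := by
  obtain ⟨ξ, -, -, ⟨⟨r, ⟨hr, hrz, hiso⟩, ⟨m, s, ν, hQ⟩, ε, hε, hgap⟩, hξ⟩, -⟩ := h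
  refine ⟨m • s, ν, isDominant_of_rieszProj hr hrz hiso (ρ := ξ - ε) ?_ (by linarith) hgap⟩
  refine Eq.trans hQ ?_
  ext1 v
  exact smul_comm m (ν.toDual v) s

/-- With ε half the gap, λ is the only spectral point of modulus at least |λ| - ε, so all the
conditions reduce to statements about λ itself. -/
theorem IsDominant.isUniformOpWith {T : LInf w →L[ℂ] LInf w} {lam : ℂ} {f : LInf w} {ν : M1 w}
    (h : IsDominant T lam f ν.toDual) : IsUniformOpWith T lam := by
  obtain ⟨ρ, hρ0, hρ1, hiso, hQ⟩ := h.rieszProj_eq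
  obtain ⟨r, hr0, hr1, hr2, hr3⟩ := h.spectrum_subset
  have hiso' : IsolatedWithin T lam ρ := by
    refine ⟨hρ0, hρ1, ?_⟩
    rw [← hiso]
    ext z
    constructor
    · rintro ⟨hz, hz'⟩
      exact ⟨hz.2, hz'⟩
    · rintro hz
      have : z = lam := by rw [hiso] at hz; exact hz
      exact ⟨⟨this ▸ h.ne_zero, hz.1⟩, hz.2⟩
  have hQ' : spectralProj T lam ρ = rankOne f ν := hQ
  have hone : IsPoleOfMultiplicityOne T ‖lam‖ lam := by
    refine ⟨ρ, hiso', ⟨1, f, ν, by rw [hQ', one_smul]⟩, ‖lam‖ - r, by linarith, fun z hz => ?_⟩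
    rw [hQ'] at hz
    rw [sub_sub_cancel]
    exact hr2 z hz.2
  have hmem : ∀ z ∈ opSpectrum T, (r + ‖lam‖) / 2 ≤ ‖z‖ → z = lam := by
    intro z hz hz'
    by_contra hzl
    have := hr3 z hz.2 hzl
    linarith
  have e : ‖lam‖ - (‖lam‖ - r) / 2 = (r + ‖lam‖) / 2 := by ring
  refine ⟨‖lam‖, h.tendsto_norm_pow, ⟨(‖lam‖ - r) / 2, by linarith, ?_, ?_⟩, ⟨hone, rfl⟩, ?_⟩
  · refine (Set.finite_singleton lam).subset fun z hz => ?_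
    exact hmem z hz.1 (by rw [← e]; exact hz.2)
  · intro z hz
    obtain rfl := hmem z hz.1 (by rw [← e]; exact hz.2)
    exact ⟨ρ, hiso', 1, fun _ _ => 1, fun _ => f, fun _ => ν, by simp [hQ']⟩
  · rintro z ⟨⟨ρ', ⟨-, -, h1⟩, -⟩, hz⟩
    have : z ∈ ({z} : Set ℂ) := rfl
    rw [← h1] at this
    exact hmem z this.1 (by linarith)

end Uniform

/-! ### The elements of M_1^w as σ-continuous functionals on L_∞^w. -/

section SigmaContinuous

variable {X : Type*} [MeasurableSpace X] {w : X → ℝ≥0}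

/-- Evaluation at a point, as a bounded functional on `L_∞^w`. -/
def LInf.eval (w : X → ℝ≥0) (x : X) : LInf w →L[ℂ] ℂ :=
  LinearMap.mkContinuous
    { toFun := fun h => h x
      map_add' := fun _ _ => rfl
      map_smul' := fun _ _ => rfl } (w x) fun h => by
        rw [mul_comm]; exact h.le_norm x

theorem LInf.sum_apply {ι : Type*} (s : Finset ι) (h : ι → LInf w) (x : X) :
    (∑ i ∈ s, h i : LInf w) x = ∑ i ∈ s, h i x :=
  map_sum (LInf.eval w x) h s

open scoped Classical in
/-- The indicator function of a measurable set, as an element of `L_∞^w`, for a weight `w` that is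
bounded away from `0`. -/
def LInf.ind (hw : ∃ C : ℝ≥0, ∀ x, 1 ≤ C * w x) (A : Set X) : LInf w :=
  if hA : MeasurableSet A then
    LInf.mk (A.indicator fun _ => 1) (measurable_const.indicator hA) (by
      obtain ⟨C, hC⟩ := hw
      refine ⟨C, fun x => ?_⟩
      refine (norm_indicator_le_norm_self _ _).trans ?_
      rw [norm_one]
      exact_mod_cast hC x)
  else 0

theorem LInf.ind_apply {hw : ∃ C : ℝ≥0, ∀ x, 1 ≤ C * w x} {A : Set X} (hA : MeasurableSet A)
    (x : X) : LInf.ind hw A x = A.indicator (fun _ => 1) x := by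
  rw [LInf.ind, dif_pos hA]; rfl

theorem LInf.norm_ind_le {hw : ∃ C : ℝ≥0, ∀ x, 1 ≤ C * w x} {C : ℝ≥0} (hC : ∀ x, 1 ≤ C * w x)
    (A : Set X) : ‖LInf.ind hw A‖ ≤ C := by
  by_cases hA : MeasurableSet A
  · refine LInf.norm_le C.2 fun x => ?_
    rw [LInf.ind_apply hA]
    refine (norm_indicator_le_norm_self _ _).trans ?_
    rw [norm_one]
    exact_mod_cast hC x
  · rw [LInf.ind, dif_neg hA, norm_zero]; exact C.2

/-- A functional on `L_∞^w` is `σ`-continuous if it preserves limits of dominated pointwise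
convergent sequences. -/
def IsSigmaCont (φ : LInf w →L[ℂ] ℂ) : Prop :=
  ∀ (h : ℕ → LInf w) (g : LInf w) (C : ℝ), (∀ n, ‖h n‖ ≤ C) →
    (∀ x, Tendsto (fun n => h n x) atTop (𝓝 (g x))) →
    Tendsto (fun n => φ (h n)) atTop (𝓝 (φ g))

namespace IsSigmaCont

theorem eval (x : X) : IsSigmaCont (LInf.eval w x) := fun _ _ _ _ h => h x

theorem smul {φ : LInf w →L[ℂ] ℂ} (hφ : IsSigmaCont φ) (c : ℂ) : IsSigmaCont (c • φ) :=
  fun h g C hC hl => (hφ h g C hC hl).const_mul c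

theorem sub {φ ψ : LInf w →L[ℂ] ℂ} (hφ : IsSigmaCont φ) (hψ : IsSigmaCont ψ) :
    IsSigmaCont (φ - ψ) :=
  fun h g C hC hl => (hφ h g C hC hl).sub (hψ h g C hC hl)

/-- A three-ε argument: the sequence is norm bounded, so operator norm convergence is uniform along
it. Left eigenvectors and derivatives of measures both arise as such limits. -/
theorem of_tendsto {ι : Type*} {l : Filter ι} [l.NeBot] {Φ : ι → LInf w →L[ℂ] ℂ}
    {φ : LInf w →L[ℂ] ℂ} (hΦ : ∀ᶠ i in l, IsSigmaCont (Φ i)) (hl : Tendsto Φ l (𝓝 φ)) :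
    IsSigmaCont φ := by
  intro h g C hC hlim
  rw [Metric.tendsto_atTop]
  intro ε hε
  have hC0 : 0 ≤ C := (norm_nonneg _).trans (hC 0)
  set D := C + ‖g‖ + 1 with hD
  have hD0 : 0 < D := by positivity
  obtain ⟨i, hi1, hi2⟩ := (hΦ.and (hl.eventually (Metric.ball_mem_nhds φ
    (show 0 < ε / (3 * D) by positivity)))).exists
  rw [dist_eq_norm] at hi2
  obtain ⟨N, hN⟩ := Metric.tendsto_atTop.1 (hi1 h g C hC hlim) (ε / 3) (by positivity)
  refine ⟨N, fun n hn => ?_⟩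
  have hb : ∀ u : LInf w, ‖u‖ ≤ D → ‖Φ i u - φ u‖ ≤ ε / 3 := by
    intro u hu
    calc ‖Φ i u - φ u‖ = ‖(Φ i - φ) u‖ := rfl
      _ ≤ ‖Φ i - φ‖ * ‖u‖ := ContinuousLinearMap.le_opNorm _ _
      _ ≤ ε / (3 * D) * D := by gcongr
      _ = ε / 3 := by field_simp
  have h1 := hb (h n) ((hC n).trans (by rw [hD]; linarith [norm_nonneg g]))
  have h2 := hb g (by rw [hD]; linarith)
  have h3 := hN n hn
  rw [dist_eq_norm] at h3 ⊢
  have e : φ (h n) - φ g = -(Φ i (h n) - φ (h n)) + (Φ i (h n) - Φ i g) + (Φ i g - φ g) := by ring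
  rw [e]
  refine (norm_add₃_le).trans_lt ?_
  rw [norm_neg]
  linarith

theorem apply_simpleFunc {φ : LInf w →L[ℂ] ℂ} (hw : ∃ C : ℝ≥0, ∀ x, 1 ≤ C * w x)
    (s : SimpleFunc X ℂ) (h : LInf w) (hs : ∀ x, h x = s x) :
    φ h = ∑ y ∈ s.range, y * φ (LInf.ind hw (s ⁻¹' {y})) := by
  have e : h = ∑ y ∈ s.range, y • LInf.ind hw (s ⁻¹' {y}) := by
    refine LInf.ext' fun x => ?_
    rw [LInf.sum_apply, hs]
    have : ∀ y ∈ s.range, (y • LInf.ind hw (s ⁻¹' {y})) x = if s x = y then y else 0 := by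
      intro y _
      rw [LInf.smul_apply, LInf.ind_apply (s.measurableSet_fiber y)]
      by_cases hy : s x = y
      · rw [Set.indicator_of_mem (by exact hy), if_pos hy, mul_one]
      · rw [Set.indicator_of_notMem (by exact hy), if_neg hy, mul_zero]
    rw [Finset.sum_congr rfl this, Finset.sum_ite_eq, if_pos (s.mem_range_self x)]
  rw [e, map_sum]
  exact Finset.sum_congr rfl fun y _ => by rw [map_smul, smul_eq_mul]

/-- Every element of L_∞^w is a pointwise limit of simple functions dominated by a multiple of w. -/
theorem ext_ind {φ ψ : LInf w →L[ℂ] ℂ} (hφ : IsSigmaCont φ) (hψ : IsSigmaCont ψ)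
    (hw : ∃ C : ℝ≥0, ∀ x, 1 ≤ C * w x)
    (h : ∀ A, MeasurableSet A → φ (LInf.ind hw A) = ψ (LInf.ind hw A)) : φ = ψ := by
  ext g
  let s : ℕ → SimpleFunc X ℂ := SimpleFunc.approxOn g g.measurable Set.univ 0 (Set.mem_univ _)
  have hb : ∀ n x, ‖s n x‖ ≤ 2 * ‖g‖ * w x := by
    intro n x
    have h1 := SimpleFunc.norm_approxOn_zero_le g.measurable (Set.mem_univ (0 : ℂ)) x n
    have h2 := g.le_norm x
    calc ‖s n x‖ ≤ ‖g x‖ + ‖g x‖ := h1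
      _ ≤ _ := by linarith
  have hlim : ∀ x, Tendsto (fun n => s n x) atTop (𝓝 (g x)) := fun x =>
    SimpleFunc.tendsto_approxOn g.measurable (Set.mem_univ (0 : ℂ)) (by simp)
  let S : ℕ → LInf w := fun n => LInf.mk (s n) (s n).measurable
    ⟨⟨2 * ‖g‖, by positivity⟩, hb n⟩
  have h1 := hφ S g (2 * ‖g‖) (fun n => LInf.norm_le (by positivity) (hb n)) hlim
  have h2 := hψ S g (2 * ‖g‖) (fun n => LInf.norm_le (by positivity) (hb n)) hlim
  refine tendsto_nhds_unique h1 (h2.congr fun n => ?_)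
  rw [apply_simpleFunc hw (s n) (S n) (fun _ => rfl), apply_simpleFunc hw (s n) (S n) (fun _ => rfl)]
  exact Finset.sum_congr rfl fun y _ => by rw [h _ ((s n).measurableSet_fiber y)]

/-- The complex measure `A ↦ φ(1_A)` of a `σ`-continuous functional. -/
def toComplexMeasure {φ : LInf w →L[ℂ] ℂ} (hφ : IsSigmaCont φ)
    (hw : ∃ C : ℝ≥0, ∀ x, 1 ≤ C * w x) : ComplexMeasure X where
  measureOf' A := φ (LInf.ind hw A)
  empty' := by
    have : LInf.ind hw (∅ : Set X) = 0 := LInf.ext' fun x => by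
      rw [LInf.ind_apply MeasurableSet.empty]; simp [LInf.zero_apply]
    rw [this, map_zero]
  not_measurable' A hA := by rw [LInf.ind, dif_neg hA, map_zero]
  m_iUnion' f hf hd := by
    obtain ⟨C, hC⟩ := id hw
    have hfin : ∀ s : Finset ℕ, ∑ i ∈ s, φ (LInf.ind hw (f i)) = φ (LInf.ind hw (⋃ i ∈ s, f i)) := by
      intro s
      rw [← map_sum]
      congr 1
      refine LInf.ext' fun x => ?_
      rw [LInf.sum_apply, LInf.ind_apply (Finset.measurableSet_biUnion s fun i _ => hf i),
        Finset.indicator_biUnion s f (fun i _ j _ hij => hd hij)]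
      exact Finset.sum_congr rfl fun i _ => LInf.ind_apply (hf i) x
    rw [HasSum, SummationFilter.unconditional_filter]
    simp only [hfin]
    -- The limit runs over finite subsets of ℕ, a countably generated filter, so sequences suffice
    -- and σ-continuity applies.
    rw [tendsto_iff_seq_tendsto]
    intro S hS
    refine hφ (fun n => LInf.ind hw (⋃ i ∈ S n, f i)) _ C (fun n => LInf.norm_ind_le hC _)
      fun x => ?_
    have hm : ∀ n, MeasurableSet (⋃ i ∈ S n, f i) :=
      fun n => Finset.measurableSet_biUnion _ fun i _ => hf i
    simp only [LInf.ind_apply (hm _), LInf.ind_apply (MeasurableSet.iUnion hf)]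
    by_cases hx : x ∈ ⋃ i, f i
    · obtain ⟨i, hi⟩ := Set.mem_iUnion.1 hx
      refine tendsto_const_nhds.congr' ?_
      filter_upwards [hS.eventually (eventually_ge_atTop {i})] with n hn
      rw [Set.indicator_of_mem hx, Set.indicator_of_mem]
      exact Set.mem_biUnion (hn (Finset.mem_singleton_self i)) hi
    · refine tendsto_const_nhds.congr fun n => ?_
      rw [Set.indicator_of_notMem hx, Set.indicator_of_notMem]
      intro h
      obtain ⟨i, -, hi⟩ := Set.mem_iUnion₂.1 h
      exact hx (Set.mem_iUnion.2 ⟨i, hi⟩)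

theorem toComplexMeasure_apply {φ : LInf w →L[ℂ] ℂ} (hφ : IsSigmaCont φ)
    (hw : ∃ C : ℝ≥0, ∀ x, 1 ≤ C * w x) (A : Set X) :
    hφ.toComplexMeasure hw A = φ (LInf.ind hw A) := rfl

/-- The `w`-weighted total variation over a finite family of disjoint partitions. -/
theorem sum_mul_norm_le {φ : LInf w →L[ℂ] ℂ} (hw : ∃ C : ℝ≥0, ∀ x, 1 ≤ C * w x)
    (g : SimpleFunc X ℝ≥0) (hg : ∀ x, g x ≤ w x) (P : ℝ≥0 → Finset (Set X))
    (hP1 : ∀ y, ∀ t ∈ P y, t ⊆ g ⁻¹' {y}) (hP2 : ∀ y, ((P y : Set (Set X)).PairwiseDisjoint id))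
    (hP3 : ∀ y, ∀ t ∈ P y, MeasurableSet t) :
    ∑ y ∈ g.range, (y : ℝ) * ∑ t ∈ P y, ‖φ (LInf.ind hw t)‖ ≤ ‖φ‖ := by
  have hph : ∀ z : ℂ, ∃ c : ℂ, ‖c‖ ≤ 1 ∧ c * z = ‖z‖ := by
    intro z
    by_cases hz : z = 0
    · exact ⟨0, by simp, by simp [hz]⟩
    · refine ⟨(‖z‖ : ℂ) / z, ?_, div_mul_cancel₀ _ hz⟩
      rw [norm_div, Complex.norm_real, norm_norm, div_self (norm_ne_zero_iff.2 hz)]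
  choose c hc1 hc2 using hph
  -- The phases c make φ(u) equal to the weighted sum to be bounded. At each point at most one piece
  -- is active, so |u| ≤ g ≤ w.
  set u : LInf w := ∑ y ∈ g.range, ((y : ℝ) : ℂ) • ∑ t ∈ P y, c (φ (LInf.ind hw t)) • LInf.ind hw t
    with hu
  have hφu : φ u = ((∑ y ∈ g.range, (y : ℝ) * ∑ t ∈ P y, ‖φ (LInf.ind hw t)‖ : ℝ) : ℂ) := by
    simp only [hu, map_sum, map_smul, smul_eq_mul, hc2]
    push_cast
    rfl
  have hun : ‖u‖ ≤ 1 := by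
    refine LInf.norm_le zero_le_one fun x => ?_
    have hin : ∀ y ∈ g.range, ‖(∑ t ∈ P y, c (φ (LInf.ind hw t)) • LInf.ind hw t : LInf w) x‖
        ≤ if g x = y then 1 else 0 := by
      intro y _
      rw [LInf.sum_apply]
      have h1 : ∀ t ∈ P y, ‖(c (φ (LInf.ind hw t)) • LInf.ind hw t : LInf w) x‖
          ≤ t.indicator (fun _ => (1 : ℝ)) x := by
        intro t ht
        rw [LInf.smul_apply, LInf.ind_apply (hP3 y t ht), norm_mul]
        by_cases hx : x ∈ t
        · simpa [hx] using hc1 _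
        · simp [hx]
      refine (norm_sum_le_of_le _ h1).trans ?_
      have h2 := Finset.indicator_biUnion_apply (P y) id (f := fun _ : X => (1 : ℝ)) (hP2 y) x
      simp only [id] at h2
      rw [← h2]
      by_cases hgy : g x = y
      · rw [if_pos hgy]
        exact Set.indicator_le_self' (fun _ _ => zero_le_one) x
      · rw [if_neg hgy, Set.indicator_of_notMem]
        intro hx
        obtain ⟨t, ht, hxt⟩ := Set.mem_iUnion₂.1 hx
        exact hgy (hP1 y t ht hxt)
    rw [hu, LInf.sum_apply, one_mul]
    have h3 : ∀ y ∈ g.range, ‖(((y : ℝ) : ℂ) • ∑ t ∈ P y, c (φ (LInf.ind hw t)) • LInf.ind hw t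
        : LInf w) x‖ ≤ if g x = y then (y : ℝ) else 0 := by
      intro y hy
      rw [LInf.smul_apply, norm_mul, Complex.norm_real, Real.norm_of_nonneg (NNReal.coe_nonneg y)]
      refine (mul_le_mul_of_nonneg_left (hin y hy) y.2).trans (le_of_eq ?_)
      split_ifs <;> simp
    refine (norm_sum_le_of_le _ h3).trans ?_
    rw [Finset.sum_ite_eq, if_pos (g.mem_range_self x)]
    exact_mod_cast hg x
  have h4 := φ.le_opNorm u
  rw [hφu, Complex.norm_real] at h4
  exact (le_abs_self _).trans (h4.trans (mul_le_of_le_one_right (norm_nonneg _) hun))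

/-- For a simple g ≤ w, finite families of disjoint sets approximate the variation on each level set
of g; `sum_mul_norm_le` bounds the resulting sums by ‖φ‖. -/
theorem lintegral_variation_le {φ : LInf w →L[ℂ] ℂ} (hφ : IsSigmaCont φ)
    (hw : ∃ C : ℝ≥0, ∀ x, 1 ≤ C * w x) :
    ∫⁻ y, w y ∂(hφ.toComplexMeasure hw).variation ≤ ENNReal.ofReal ‖φ‖ := by
  set m := hφ.toComplexMeasure hw with hm
  rw [lintegral_eq_nnreal]
  refine iSup₂_le fun g hg => ?_
  have hg' : ∀ x, g x ≤ w x := fun x => by exact_mod_cast hg x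
  have hseq : ∀ y : ℝ≥0, ∃ u : ℕ → ℝ≥0∞, Tendsto u atTop (𝓝 (m.variation (g ⁻¹' {y}))) ∧
      ∀ n, ∃ P : Finset (Set X), (∀ t ∈ P, t ⊆ g ⁻¹' {y}) ∧
        ((P : Set (Set X)).PairwiseDisjoint id) ∧ (∀ t ∈ P, MeasurableSet t) ∧
        u n ≤ ∑ p ∈ P, ‖m p‖ₑ := by
    intro y
    -- Approximation strictly from below is possible only for a positive value; a null level set
    -- takes the empty family.
    rcases eq_or_ne (m.variation (g ⁻¹' {y})) 0 with h0 | h0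
    · exact ⟨fun _ => 0, by rw [h0]; exact tendsto_const_nhds, fun n => ⟨∅, by simp⟩⟩
    · obtain ⟨u, -, hu, hlim⟩ := exists_seq_strictMono_tendsto' (pos_iff_ne_zero.2 h0)
      refine ⟨u, hlim, fun n => ?_⟩
      obtain ⟨P, h1, h2, h3, h4⟩ :=
        m.exists_lt_sum_of_lt_variation (g.measurableSet_fiber y) (hu n).2
      exact ⟨P, h1, h2, h3, h4.le⟩
  choose u hu P hP1 hP2 hP3 hP4 using hseq
  rw [SimpleFunc.map_lintegral]
  have hlim : Tendsto (fun n => ∑ y ∈ g.range, (y : ℝ≥0∞) * u y n) atTop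
      (𝓝 (∑ y ∈ g.range, (y : ℝ≥0∞) * m.variation (g ⁻¹' {y}))) :=
    tendsto_finsetSum _ fun y _ => ENNReal.Tendsto.const_mul (hu y) (Or.inr ENNReal.coe_ne_top)
  refine le_of_tendsto' hlim fun n => ?_
  have h1 := sum_mul_norm_le (φ := φ) hw g hg' (fun y => P y n) (fun y => hP1 y n)
    (fun y => hP2 y n) (fun y => hP3 y n)
  refine le_trans ?_ (ENNReal.ofReal_le_ofReal h1)
  rw [ENNReal.ofReal_sum_of_nonneg fun y _ => by positivity]
  refine Finset.sum_le_sum fun y _ => ?_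
  rw [ENNReal.ofReal_mul (NNReal.coe_nonneg y), ENNReal.ofReal_coe_nnreal,
    ENNReal.ofReal_sum_of_nonneg fun y _ => norm_nonneg _]
  refine mul_le_mul_right ((hP4 y n).trans (le_of_eq ?_)) _
  exact Finset.sum_congr rfl fun t _ => (ofReal_norm _).symm

end IsSigmaCont

theorem M1.variation_univ_ne_top (hw : ∃ C : ℝ≥0, ∀ x, 1 ≤ C * w x) (μ : M1 w) :
    μ.toComplexMeasure.variation Set.univ ≠ ∞ := by
  obtain ⟨C, hC⟩ := hw
  have h1 : μ.toComplexMeasure.variation Set.univ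
      ≤ C * ∫⁻ y, w y ∂μ.toComplexMeasure.variation := by
    rw [← lintegral_const_mul' _ _ ENNReal.coe_ne_top, ← lintegral_one]
    exact lintegral_mono fun x => by
      rw [← ENNReal.coe_mul, ← ENNReal.coe_one]; exact ENNReal.coe_le_coe.2 (hC x)
  exact (h1.trans_lt (ENNReal.mul_lt_top ENNReal.coe_lt_top μ.finite'.lt_top)).ne

theorem M1.toDual_ind (hw : ∃ C : ℝ≥0, ∀ x, 1 ≤ C * w x) (μ : M1 w) {A : Set X}
    (hA : MeasurableSet A) : μ.toDual (LInf.ind hw A) = μ.toComplexMeasure A := by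
  have : IsFiniteMeasure μ.toComplexMeasure.variation :=
    ⟨(μ.variation_univ_ne_top hw).lt_top⟩
  have h1 : μ.toDual (LInf.ind hw A) = M1.integral μ.toComplexMeasure (LInf.ind hw A) := rfl
  have h2 : (LInf.ind hw A : X → ℂ) = fun x => A.indicator (fun _ => (1 : ℂ)) x :=
    funext fun x => LInf.ind_apply hA x
  rw [h1, M1.integral, h2, VectorMeasure.integral_indicator_const _ hA]
  simp

theorem M1.isSigmaCont (hwm : Measurable w) (μ : M1 w) : IsSigmaCont μ.toDual := by
  intro h g C hC hl
  have hwi : Integrable (fun x => (w x : ℝ)) μ.toComplexMeasure.variation := by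
    refine ⟨hwm.coe_nnreal_real.aestronglyMeasurable, ?_⟩
    have : ∀ x, ‖(w x : ℝ)‖ₑ = w x := fun x => by simp
    simp only [HasFiniteIntegral, this]
    exact μ.finite'.lt_top
  refine VectorMeasure.tendsto_integral_of_dominated_convergence (fun x => C * w x)
    (fun n => (h n).measurable.aestronglyMeasurable) (hwi.const_mul C)
    (fun n => Eventually.of_forall fun x => ?_) (Eventually.of_forall hl)
  exact ((h n).le_norm x).trans (mul_le_mul_of_nonneg_right (hC n) (w x).2)

/-- This lets eigenmeasures and their derivatives be constructed in the Banach dual first and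
recognized as measures afterwards. -/
theorem IsSigmaCont.exists_M1 {φ : LInf w →L[ℂ] ℂ} (hφ : IsSigmaCont φ) (hwm : Measurable w)
    (hw : ∃ C : ℝ≥0, ∀ x, 1 ≤ C * w x) : ∃ μ : M1 w, μ.toDual = φ := by
  let μ : M1 w := ⟨hφ.toComplexMeasure hw,
    ((hφ.lintegral_variation_le hw).trans_lt ENNReal.ofReal_lt_top).ne⟩
  refine ⟨μ, (μ.isSigmaCont hwm).ext_ind hφ hw fun A hA => ?_⟩
  rw [μ.toDual_ind hw hA]
  rfl

theorem M1.toDual_injective (hw : ∃ C : ℝ≥0, ∀ x, 1 ≤ C * w x) {μ ν : M1 w}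
    (h : μ.toDual = ν.toDual) : μ = ν := by
  have : μ.toComplexMeasure = ν.toComplexMeasure := by
    refine VectorMeasure.ext fun A hA => ?_
    rw [← μ.toDual_ind hw hA, ← ν.toDual_ind hw hA, h]
  cases μ; cases ν; congr

/-- The functional `h ↦ ∫ h dm` on `L_∞^w`. -/
def integralCLM (m : Measure X) (hm : ∫⁻ y, w y ∂m ≠ ∞) : LInf w →L[ℂ] ℂ :=
  LinearMap.mkContinuous
    { toFun := fun h => ∫ y, h y ∂m
      map_add' := fun g h => integral_add (g.integrable_of_lintegral_ne_top hm)
        (h.integrable_of_lintegral_ne_top hm)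
      map_smul' := fun c h => integral_const_mul c (h : X → ℂ) }
    (∫⁻ y, w y ∂m).toReal (fun h => by
      have h1 := ENNReal.toReal_mono (ENNReal.mul_ne_top ENNReal.ofReal_ne_top hm)
        ((enorm_integral_le_lintegral_enorm (h : X → ℂ)).trans (h.lintegral_enorm_le m))
      rwa [toReal_enorm, ENNReal.toReal_mul, ENNReal.toReal_ofReal h.norm_nonneg', mul_comm] at h1)

theorem integralCLM_apply (m : Measure X) (hm : ∫⁻ y, w y ∂m ≠ ∞) (h : LInf w) :
    integralCLM m hm h = ∫ y, h y ∂m := rfl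

theorem tendsto_integral_of_dominated {m : Measure X} (hwm : Measurable w)
    (hm : ∫⁻ y, w y ∂m ≠ ∞) {h : ℕ → LInf w} {g : LInf w} {C : ℝ} (hC : ∀ n, ‖h n‖ ≤ C)
    (hl : ∀ x, Tendsto (fun n => h n x) atTop (𝓝 (g x))) :
    Tendsto (fun n => ∫ y, h n y ∂m) atTop (𝓝 (∫ y, g y ∂m)) := by
  have hwi : Integrable (fun x => (w x : ℝ)) m := by
    refine ⟨hwm.coe_nnreal_real.aestronglyMeasurable, ?_⟩
    have : ∀ x, ‖(w x : ℝ)‖ₑ = w x := fun x => by simp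
    simp only [HasFiniteIntegral, this]
    exact hm.lt_top
  refine tendsto_integral_of_dominated_convergence (fun x => C * w x)
    (fun n => (h n).measurable.aestronglyMeasurable) (hwi.const_mul C)
    (fun n => Eventually.of_forall fun x => ?_) (Eventually.of_forall hl)
  exact ((h n).le_norm x).trans (mul_le_mul_of_nonneg_right (hC n) (w x).2)

theorem isSigmaCont_integralCLM {m : Measure X} (hwm : Measurable w) (hm : ∫⁻ y, w y ∂m ≠ ∞) :
    IsSigmaCont (integralCLM m hm) := fun _ _ _ hC hl =>
  tendsto_integral_of_dominated hwm hm hC hl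

theorem IsSigmaCont.comp_kernelOp {φ : LInf w →L[ℂ] ℂ} (hφ : IsSigmaCont φ) (hwm : Measurable w)
    {Q : Kernel X X} [IsSFiniteKernel Q] (hQ : HasFiniteNorm Q w) :
    IsSigmaCont (φ.comp (kernelOp Q w)) := by
  intro h g C hC hl
  refine hφ (fun n => kernelOp Q w (h n)) (kernelOp Q w g) (‖kernelOp Q w‖ * C) (fun n => ?_)
    fun x => ?_
  · exact ((kernelOp Q w).le_opNorm _).trans
      (mul_le_mul_of_nonneg_left (hC n) (norm_nonneg _))
  · simp only [kernelOp_apply hQ]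
    refine tendsto_integral_of_dominated hwm ?_ hC hl
    obtain ⟨D, hD⟩ := hQ
    exact ((hD x).trans_lt (ENNReal.mul_lt_top ENNReal.coe_lt_top ENNReal.coe_lt_top)).ne

/-- A positive `σ`-continuous functional is the integral against a measure. -/
theorem IsSigmaCont.exists_measure {φ : LInf w →L[ℂ] ℂ} (hφ : IsSigmaCont φ)
    (hwm : Measurable w) (hw : ∃ C : ℝ≥0, ∀ x, 1 ≤ C * w x)
    (hpos : ∀ A, MeasurableSet A → φ (LInf.ind hw A) = (‖φ (LInf.ind hw A)‖ : ℂ)) :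
    ∃ (m : Measure X) (hm : ∫⁻ y, w y ∂m ≠ ∞), φ = integralCLM m hm := by
  set μ := hφ.toComplexMeasure hw with hμ
  have hfin : ∫⁻ y, w y ∂μ.variation ≠ ∞ :=
    ((hφ.lintegral_variation_le hw).trans_lt ENNReal.ofReal_lt_top).ne
  have hre : ∀ A, 0 ≤ (μ A).re := by
    intro A
    by_cases hA : MeasurableSet A
    · rw [hμ, toComplexMeasure_apply, hpos A hA, Complex.ofReal_re]; exact norm_nonneg _
    · rw [μ.not_measurable hA]; simp
  have hnorm : ∀ A, MeasurableSet A → ‖μ A‖ = (μ A).re := by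
    intro A hA
    rw [hμ, toComplexMeasure_apply, hpos A hA]; simp
  -- For a nonnegative set function the sum over disjoint subsets of A is the value on their union,
  -- hence at most μ(A).
  have hvar : ∀ A, MeasurableSet A → μ.variation A = ‖μ A‖ₑ := by
    intro A hA
    refine le_antisymm (le_of_forall_lt fun a ha => ?_) (μ.enorm_measure_le_variation A)
    obtain ⟨P, h1, h2, h3, h4⟩ := μ.exists_lt_sum_of_lt_variation hA ha
    refine h4.trans_le ?_
    have h5 : ∑ p ∈ P, ‖μ p‖ₑ = ENNReal.ofReal (∑ p ∈ P, (μ p).re) := by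
      rw [ENNReal.ofReal_sum_of_nonneg fun p _ => hre p]
      exact Finset.sum_congr rfl fun p hp => by rw [← hnorm p (h3 p hp), ofReal_norm]
    have h6 : (∑ p ∈ P, (μ p).re) = (μ (⋃ p ∈ P, p)).re := by
      rw [VectorMeasure.of_biUnion_finset (v := μ) (f := fun p => p) h2 h3, Complex.re_sum]
    have h7 : μ A = μ (⋃ p ∈ P, p) + μ (A \ ⋃ p ∈ P, p) :=
      (VectorMeasure.of_add_of_sdiff (Finset.measurableSet_biUnion P h3) hA
        (Set.iUnion₂_subset h1)).symm
    rw [h5, ← ofReal_norm, hnorm A hA]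
    refine ENNReal.ofReal_le_ofReal ?_
    rw [h6, h7, Complex.add_re]
    linarith [hre (A \ ⋃ p ∈ P, p)]
  refine ⟨μ.variation, hfin, hφ.ext_ind (isSigmaCont_integralCLM hwm hfin) hw fun A hA => ?_⟩
  rw [integralCLM_apply]
  have h2 : (LInf.ind hw A : X → ℂ) = A.indicator (fun _ => (1 : ℂ)) :=
    funext fun x => LInf.ind_apply hA x
  rw [h2, integral_indicator_const _ hA, measureReal_def, hvar A hA, toReal_enorm, hpos A hA]
  rw [hμ, toComplexMeasure_apply]
  simp

end SigmaContinuous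

/-! ### Positivity of dominant eigentriples of kernels. -/

section Perron

variable {X : Type*} [MeasurableSpace X] {w : X → ℝ≥0}

/-- `h` takes values in `[0, ∞)`. -/
def IsNonneg (h : LInf w) : Prop := ∀ x, h x = (‖h x‖ : ℂ)

theorem eq_norm_of_tendsto {ι : Type*} {l : Filter ι} [l.NeBot] {u : ι → ℂ} {z : ℂ}
    (hu : ∀ i, u i = (‖u i‖ : ℂ)) (h : Tendsto u l (𝓝 z)) : z = (‖z‖ : ℂ) := by
  have h1 : Tendsto (fun i => (‖u i‖ : ℂ)) l (𝓝 (‖z‖ : ℂ)) :=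
    (Complex.continuous_ofReal.tendsto _).comp h.norm
  exact tendsto_nhds_unique h (h1.congr fun i => (hu i).symm)

/-- The pointwise modulus. -/
def LInf.abs (h : LInf w) : LInf w :=
  LInf.mk (fun x => (‖h x‖ : ℂ)) (Complex.measurable_ofReal.comp h.measurable.norm) (by
    obtain ⟨C, hC⟩ := h.bound
    exact ⟨C, fun x => by simpa using hC x⟩)

theorem LInf.abs_apply (h : LInf w) (x : X) : h.abs x = (‖h x‖ : ℂ) := rfl

theorem LInf.isNonneg_abs (h : LInf w) : IsNonneg h.abs := fun x => by
  rw [LInf.abs_apply]; simp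

theorem LInf.tendsto_apply {ι : Type*} {l : Filter ι} {u : ι → LInf w} {g : LInf w}
    (h : Tendsto u l (𝓝 g)) (x : X) : Tendsto (fun i => u i x) l (𝓝 (g x)) :=
  ((LInf.eval w x).continuous.tendsto g).comp h

variable {K : Kernel X X} [IsSFiniteKernel K]

theorem kernelOp_apply_of_isNonneg (hK : HasFiniteNorm K w) {h : LInf w} (hh : IsNonneg h)
    (x : X) : kernelOp K w h x = ((∫ y, ‖h y‖ ∂(K x) : ℝ) : ℂ) := by
  rw [kernelOp_apply hK, ← integral_complex_ofReal]
  exact integral_congr_ae (Eventually.of_forall hh)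

theorem IsNonneg.kernelOp (hK : HasFiniteNorm K w) {h : LInf w} (hh : IsNonneg h) :
    IsNonneg (kernelOp K w h) := fun x => by
  rw [kernelOp_apply_of_isNonneg hK hh, Complex.norm_real,
    Real.norm_of_nonneg (integral_nonneg fun _ => norm_nonneg _)]

theorem IsNonneg.kernelOp_pow (hK : HasFiniteNorm K w) {h : LInf w} (hh : IsNonneg h) (n : ℕ) :
    IsNonneg ((VGeo.kernelOp K w ^ n) h) := by
  induction n with
  | zero => simpa using hh
  | succ n ih => rw [pow_succ', mul_apply_eq_comp]; exact ih.kernelOp hK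

theorem norm_kernelOp_mono (hK : HasFiniteNorm K w) {g h : LInf w} (hh : IsNonneg h) {c : ℝ}
    (hgh : ∀ x, c * ‖g x‖ ≤ ‖h x‖) (hc : 0 ≤ c) (x : X) :
    c * ‖kernelOp K w g x‖ ≤ ‖kernelOp K w h x‖ := by
  rw [kernelOp_apply_of_isNonneg hK hh, kernelOp_apply hK, Complex.norm_real,
    Real.norm_of_nonneg (integral_nonneg fun _ => norm_nonneg _)]
  calc c * ‖∫ y, g y ∂(K x)‖ ≤ c * ∫ y, ‖g y‖ ∂(K x) :=
        mul_le_mul_of_nonneg_left (norm_integral_le_integral_norm _) hc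
    _ = ∫ y, c * ‖g y‖ ∂(K x) := (integral_const_mul _ _).symm
    _ ≤ ∫ y, ‖h y‖ ∂(K x) := integral_mono ((integrable_of_hasFiniteNorm hK g x).norm.const_mul c)
        (integrable_of_hasFiniteNorm hK h x).norm hgh

/-- The dominant eigenvalue of a positive kernel is positive, and the modulus of its eigenfunction
is an eigenfunction. -/
theorem IsDominant.exists_abs (hK : HasFiniteNorm K w) {lam : ℂ} {f : LInf w}
    {φ : LInf w →L[ℂ] ℂ} (h : IsDominant (kernelOp K w) lam f φ) :
    lam = (‖lam‖ : ℂ) ∧ ∃ ψ, IsDominant (kernelOp K w) lam f.abs ψ := by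
  set T := kernelOp K w with hT
  set g := f.abs with hg
  set ξ := ‖lam‖ with hξ
  have hξ0 : 0 < ξ := h.norm_pos
  have hu : ∀ n, IsNonneg ((T ^ n) g) := f.isNonneg_abs.kernelOp_pow hK
  -- Iteration of ξ|f| = |T f| ≤ T|f|.
  have hge : ∀ n x, ξ ^ n * ‖f x‖ ≤ ‖(T ^ n) g x‖ := by
    intro n
    induction n with
    | zero => intro x; simp [hg, LInf.abs_apply]
    | succ n ih =>
      intro x
      have h1 := norm_kernelOp_mono hK (hu n) ih (by positivity) x
      rw [← hT, h.eig, LInf.smul_apply, norm_mul, ← mul_assoc, ← pow_succ] at h1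
      rwa [pow_succ' T, mul_apply_eq_comp]
  set c := ‖φ g‖ with hc
  set v : ℕ → LInf w := fun n => ((ξ ^ n : ℝ) : ℂ)⁻¹ • (T ^ n) g with hv
  have hvn : ∀ n x, v n x = (‖((lam ^ n)⁻¹ • (T ^ n) g) x‖ : ℂ) := by
    intro n x
    simp only [hv]
    rw [LInf.smul_apply, LInf.smul_apply, norm_mul, norm_inv, norm_pow, ← hξ, hu n x]
    simp
  -- Pointwise, v n is the modulus of λ⁻ⁿ Tⁿ|f|, which converges to φ(|f|) f. Taking moduli does not
  -- increase distances in the weighted norm.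
  have hvlim : Tendsto v atTop (𝓝 ((c : ℂ) • g)) := by
    have h1 := h.tendsto_inv_pow g
    rw [tendsto_iff_norm_sub_tendsto_zero] at h1 ⊢
    refine squeeze_zero (fun _ => norm_nonneg _) (fun n => ?_) h1
    refine LInf.norm_le (norm_nonneg _) fun x => ?_
    refine le_trans ?_ (LInf.le_norm _ x)
    have e : ((c : ℂ) • g) x = (‖(φ g • f) x‖ : ℂ) := by
      rw [LInf.smul_apply, LInf.smul_apply, norm_mul, Complex.ofReal_mul]
      rfl
    rw [LInf.sub_apply, LInf.sub_apply, hvn, e, ← Complex.ofReal_sub, Complex.norm_real,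
      Real.norm_eq_abs]
    exact abs_norm_sub_norm_le _ _
  have hTv : ∀ n, T (v n) = (ξ : ℂ) • v (n + 1) := by
    intro n
    simp only [hv]
    rw [map_smul, pow_succ' T, mul_apply_eq_comp, smul_smul]
    congr 1
    have : (ξ : ℂ) ≠ 0 := by exact_mod_cast hξ0.ne'
    push_cast
    field_simp
    ring
  have hTg : T ((c : ℂ) • g) = (ξ : ℂ) • ((c : ℂ) • g) := by
    refine tendsto_nhds_unique ((T.continuous.tendsto _).comp hvlim) ?_
    refine Tendsto.congr (fun n => (hTv n).symm) ?_
    exact ((tendsto_add_atTop_iff_nat 1).2 hvlim).const_smul _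
  obtain ⟨x, hx⟩ : ∃ x, f x ≠ 0 := by
    by_contra! h0
    exact h.vec_ne_zero (LInf.ext' h0)
  -- Since v n ≥ |f| for every n, the limit c|f| dominates |f|; in particular it does not vanish.
  have hc1 : 1 ≤ c := by
    have h1 : Tendsto (fun n => ‖v n x‖) atTop (𝓝 ‖((c : ℂ) • g) x‖) :=
      (LInf.tendsto_apply hvlim x).norm
    have h2 : ‖f x‖ ≤ c * ‖f x‖ := by
      have h3 : ‖((c : ℂ) • g) x‖ = c * ‖f x‖ := by
        rw [LInf.smul_apply, hg, LInf.abs_apply, norm_mul, Complex.norm_real, Complex.norm_real,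
          norm_norm, hc, norm_norm]
      rw [← h3]
      refine ge_of_tendsto' h1 fun n => ?_
      have h4 := hge n x
      rw [hvn, Complex.norm_real, norm_norm, LInf.smul_apply, norm_mul, norm_inv, norm_pow, ← hξ,
        inv_mul_eq_div, le_div_iff₀ (by positivity), mul_comm]
      exact h4
    have h5 : 0 < ‖f x‖ := norm_pos_iff.2 hx
    by_contra! h6
    nlinarith
  have hc0 : (c : ℂ) ≠ 0 := by
    have : c ≠ 0 := by linarith
    exact_mod_cast this
  have hTg' : T g = (ξ : ℂ) • g := by
    rw [map_smul, smul_comm] at hTg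
    have h1 := congrArg (fun u => (c : ℂ)⁻¹ • u) hTg
    simpa only [inv_smul_smul₀ hc0] using h1
  have hφg : φ g ≠ 0 := by
    rw [← norm_pos_iff, ← hc]; linarith
  have hlam := h.eigenvalue_eq hTg' hφg
  refine ⟨hlam.symm, (φ g)⁻¹ • φ, ?_⟩
  have h1 := h.rescale (inv_ne_zero hφg)
  rw [hlam] at hTg'
  rwa [inv_inv, ← h.eq_smul_of_eig hTg'] at h1

/-- A normalized positive principal eigentriple of a kernel. -/
structure IsPrincipal (K : Kernel X X) [IsSFiniteKernel K] (hw : ∀ x, 1 ≤ w x) (lam : ℝ)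
    (f : LInf w) (φ : LInf w →L[ℂ] ℂ) : Prop where
  dom : IsDominant (kernelOp K w) (lam : ℂ) f φ
  lam_pos : 0 < lam
  isNonneg : IsNonneg f
  apply_ne : ∀ x, f x ≠ 0
  mass : φ (LInf.one hw) = 1
  sigma : IsSigmaCont φ
  map_nonneg : ∀ h, IsNonneg h → φ h = (‖φ h‖ : ℂ)

theorem one_eq_ind (hw : ∀ x, 1 ≤ w x) (hw' : ∃ C : ℝ≥0, ∀ x, 1 ≤ C * w x) :
    LInf.one hw = LInf.ind hw' Set.univ :=
  LInf.ext' fun x => by rw [LInf.ind_apply MeasurableSet.univ, Set.indicator_univ]; rfl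

theorem LInf.isNonneg_ind (hw' : ∃ C : ℝ≥0, ∀ x, 1 ≤ C * w x) {A : Set X}
    (hA : MeasurableSet A) : IsNonneg (LInf.ind hw' A) := fun x => by
  rw [LInf.ind_apply hA]
  by_cases hx : x ∈ A <;> simp [hx]

/-- At a point x with f(x) ≠ 0, the functional f(x) φ is the limit of h ↦ λ⁻ⁿ (Tⁿ h)(x), each of
which is σ-continuous by dominated convergence. The geometric rate makes the limit hold in operator
norm. -/
theorem IsDominant.isSigmaCont (hwm : Measurable w) (hK : HasFiniteNorm K w) {lam : ℂ}
    {f : LInf w} {φ : LInf w →L[ℂ] ℂ} (h : IsDominant (VGeo.kernelOp K w) lam f φ) :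
    IsSigmaCont φ := by
  obtain ⟨x, hx⟩ : ∃ x, f x ≠ 0 := by
    by_contra! h0
    exact h.vec_ne_zero (LInf.ext' h0)
  have hpow : ∀ n : ℕ, IsSigmaCont ((LInf.eval w x).comp (VGeo.kernelOp K w ^ n)) := by
    intro n
    induction n with
    | zero => exact IsSigmaCont.eval x
    | succ n ih =>
      rw [pow_succ]
      exact ih.comp_kernelOp hwm hK
  have h1 : IsSigmaCont (f x • φ) := by
    obtain ⟨C, ρ, hC, h0, h1, hd⟩ := h.norm_inv_pow_sub_le
    refine IsSigmaCont.of_tendsto (l := atTop)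
      (Φ := fun n : ℕ => (lam ^ n)⁻¹ • (LInf.eval w x).comp (VGeo.kernelOp K w ^ n))
      (Eventually.of_forall fun n => (hpow n).smul _) ?_
    rw [tendsto_iff_norm_sub_tendsto_zero]
    have h2 : Tendsto (fun n : ℕ => C * ρ ^ n * w x) atTop (𝓝 0) := by
      have := ((tendsto_pow_atTop_nhds_zero_of_lt_one h0.le h1).const_mul C).mul_const (w x : ℝ)
      simpa using this
    refine squeeze_zero (fun _ => norm_nonneg _) (fun n => ?_) h2
    refine ContinuousLinearMap.opNorm_le_bound _ (by positivity) fun g => ?_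
    have h3 := LInf.le_norm ((lam ^ n)⁻¹ • (VGeo.kernelOp K w ^ n) g - φ g • f) x
    rw [LInf.sub_apply, LInf.smul_apply, LInf.smul_apply, mul_comm (φ g)] at h3
    refine le_trans (h3.trans (mul_le_mul_of_nonneg_right (hd n g) (w x).2)) (le_of_eq ?_)
    ring
  have h2 := h1.smul (f x)⁻¹
  rwa [smul_smul, inv_mul_cancel₀ hx, one_smul] at h2

/-- The left eigenvector is nonnegative as a limit of λ⁻ⁿ (Tⁿ u)(x), so it is a measure; it is
nonzero because it pairs to 1 with |f|, so its mass can be normalized. The hypothesis `hf` isolates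
what irreducibility must supply, the absence of zeros. -/
theorem exists_isPrincipal (hw : ∀ x, 1 ≤ w x) (hwm : Measurable w) (hK : HasFiniteNorm K w)
    {lam : ℂ} {f : LInf w} {φ : LInf w →L[ℂ] ℂ} (h : IsDominant (kernelOp K w) lam f φ)
    (hf : ∀ g : LInf w, IsNonneg g → g ≠ 0 → (∀ x, ‖g x‖ = ‖f x‖) →
      (∃ c : ℂ, c ≠ 0 ∧ kernelOp K w g = c • g) → ∀ x, g x ≠ 0) :
    ∃ (g : LInf w) (ψ : LInf w →L[ℂ] ℂ), IsPrincipal K hw ‖lam‖ g ψ := by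
  obtain ⟨hlam, ψ, hψ⟩ := h.exists_abs hK
  have hg0 : ∀ x, f.abs x ≠ 0 := hf f.abs f.isNonneg_abs hψ.vec_ne_zero
    (fun x => by rw [LInf.abs_apply, Complex.norm_real, norm_norm]) ⟨lam, h.ne_zero, hψ.eig⟩
  obtain ⟨x, -⟩ : ∃ x, f x ≠ 0 := by
    by_contra! h0
    exact h.vec_ne_zero (LInf.ext' h0)
  have hsc : IsSigmaCont ψ := hψ.isSigmaCont hwm hK
  have hpos : ∀ u, IsNonneg u → ψ u = (‖ψ u‖ : ℂ) := by
    intro u hu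
    have h1 := LInf.tendsto_apply (hψ.tendsto_inv_pow u) x
    have h2 := eq_norm_of_tendsto (fun n => ?_) h1
    · rw [LInf.smul_apply, f.isNonneg_abs x, norm_mul, Complex.ofReal_mul, Complex.norm_real,
        norm_norm] at h2
      refine mul_right_cancel₀ (b := (‖f.abs x‖ : ℂ)) ?_ h2
      exact_mod_cast norm_ne_zero_iff.2 (hg0 x)
    · rw [LInf.smul_apply, hu.kernelOp_pow hK n x, hlam]
      simp
  have hw' : ∃ C : ℝ≥0, ∀ x, 1 ≤ C * w x := ⟨1, fun x => by rw [one_mul]; exact hw x⟩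
  obtain ⟨m, hm, hψm⟩ := hsc.exists_measure hwm hw' fun A hA =>
    hpos _ (LInf.isNonneg_ind hw' hA)
  have hone : ψ (LInf.one hw) = ((m.real Set.univ : ℝ) : ℂ) := by
    rw [hψm, integralCLM_apply]
    have : ∀ y, (LInf.one hw : LInf w) y = 1 := fun _ => rfl
    simp [this]
  have hmne : ψ (LInf.one hw) ≠ 0 := by
    intro h0
    rw [hone, Complex.ofReal_eq_zero, measureReal_def, ENNReal.toReal_eq_zero_iff] at h0
    have hm1 : m Set.univ ≠ ∞ := by
      refine (lt_of_le_of_lt ?_ hm.lt_top).ne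
      rw [← lintegral_one]
      exact lintegral_mono fun y => by
        rw [← ENNReal.coe_one]; exact ENNReal.coe_le_coe.2 (hw y)
    have hm0 : m = 0 := Measure.measure_univ_eq_zero.1 (h0.resolve_right hm1)
    have := hψ.pair
    rw [hψm, integralCLM_apply, hm0] at this
    simp at this
  have hone' := hpos _ (fun y => by
    have : (LInf.one hw : LInf w) y = 1 := rfl
    simp [this] : IsNonneg (LInf.one hw))
  set c := ψ (LInf.one hw) with hc
  have hd := hψ.rescale (inv_ne_zero hmne)
  refine ⟨c⁻¹⁻¹ • f.abs, c⁻¹ • ψ, ⟨?_, h.norm_pos, ?_, ?_, ?_, hsc.smul c⁻¹, ?_⟩⟩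
  · rw [← hlam]; exact hd
  · intro y
    rw [inv_inv, LInf.smul_apply, hone', f.isNonneg_abs y]
    simp
  · intro y
    rw [inv_inv, LInf.smul_apply]
    exact mul_ne_zero hmne (hg0 y)
  · simp [← hc, hmne]
  · intro u hu
    simp only [smul_apply, smul_eq_mul]
    rw [hone', hpos u hu]
    simp

end Perron

/-! ### Absorbing sets and the minorization condition. -/

section Irreducible

variable {X : Type*} [MeasurableSpace X]

/-- From a point of Z the resolvent never charges Zᶜ, and s > 0 there, so ν(Z) = 1. By invariance,
no π-mass flows from Zᶜ into Z, so R(y, Z) = 0 for π-a.e. y in Zᶜ. But R(y, Z) ≥ s(y) > 0, so Zᶜ is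
π-null. -/
theorem measure_compl_eq_zero_of_absorbing {P : Kernel X X} [IsMarkovKernel P] {V : X → ℝ≥0}
    (hd : DriftV4 P V) {π : Measure X} [IsProbabilityMeasure π] (hπ : Kernel.Invariant P π)
    {Z : Set X} (hZ : MeasurableSet Z) (hne : Z.Nonempty) (habs : ∀ x ∈ Z, P x Zᶜ = 0) :
    π Zᶜ = 0 := by
  obtain ⟨ν, b, δ, s, hν, -, hs, hs1, -, hR⟩ := hd
  have hpm : ∀ n : ℕ, IsMarkovKernel (P ^ n) := by
    intro n
    induction n with
    | zero => rw [pow_zero]; exact inferInstanceAs (IsMarkovKernel (Kernel.id : Kernel X X))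
    | succ n ih => rw [pow_succ]; exact inferInstanceAs (IsMarkovKernel ((P ^ n) ∘ₖ P))
  have hpow : ∀ n : ℕ, ∀ x ∈ Z, (P ^ n) x Zᶜ = 0 := by
    intro n
    induction n with
    | zero =>
      intro x hx
      change (Kernel.id : Kernel X X) x Zᶜ = 0
      rw [Kernel.id_apply, Measure.dirac_apply' _ hZ.compl]
      simp [hx]
    | succ n ih =>
      intro x hx
      rw [pow_succ]
      change ((P ^ n) ∘ₖ P) x Zᶜ = 0
      rw [Kernel.comp_apply' _ _ _ hZ.compl]
      rw [lintegral_eq_zero_iff ((P ^ n).measurable_coe hZ.compl)]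
      have : ∀ᵐ y ∂(P x), y ∈ Z := by
        rw [ae_iff]; exact habs x hx
      filter_upwards [this] with y hy using ih y hy
  have hinv : ∀ n : ℕ, Kernel.Invariant (P ^ n) π := by
    intro n
    induction n with
    | zero =>
      change π.bind (Kernel.id : Kernel X X) = π
      exact Measure.id_comp
    | succ n ih => rw [pow_succ]; exact ih.comp hπ
  obtain ⟨x₀, hx₀⟩ := hne
  have hνZ : ν Zᶜ = 0 := by
    have h1 := hR x₀ Zᶜ hZ.compl
    have h2 : resolventKernel P 1 (Zᶜ.indicator 1) x₀ = 0 := by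
      simp only [resolventKernel, ENNReal.tsum_eq_zero]
      intro n
      rw [lintegral_indicator_one hZ.compl, hpow n x₀ hx₀, mul_zero]
    rw [h2, nonpos_iff_eq_zero, mul_eq_zero] at h1
    refine h1.resolve_left ?_
    exact_mod_cast (hs1 x₀).1.ne'
  have hνZ1 : ν Z = 1 := (prob_compl_eq_zero_iff hZ).1 hνZ
  have hpnZ : ∀ n : ℕ, ∫⁻ y in Zᶜ, (P ^ n) y Z ∂π = 0 := by
    intro n
    have h1 : ∫⁻ y, (P ^ n) y Z ∂π = π Z := by
      conv_rhs => rw [← (hinv n).def]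
      rw [Measure.bind_apply hZ (P ^ n).aemeasurable]
    rw [← lintegral_add_compl _ hZ] at h1
    have h2 : ∫⁻ y in Z, (P ^ n) y Z ∂π = π Z := by
      rw [← setLIntegral_one Z]
      refine setLIntegral_congr_fun hZ fun y hy => ?_
      exact (prob_compl_eq_zero_iff hZ).1 (hpow n y hy)
    rw [h2] at h1
    exact (ENNReal.add_right_inj (measure_ne_top π Z)).1 (h1.trans (add_zero _).symm)
  have hint : ∫⁻ y in Zᶜ, resolventKernel P 1 (Z.indicator 1) y ∂π = 0 := by
    simp only [resolventKernel, lintegral_indicator_one hZ]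
    rw [lintegral_tsum fun n => (((P ^ n).measurable_coe hZ).const_mul _).aemeasurable]
    simp only [ENNReal.tsum_eq_zero]
    intro n
    rw [lintegral_const_mul _ ((P ^ n).measurable_coe hZ), hpnZ n, mul_zero]
  have hs0 : ∫⁻ y in Zᶜ, (s y : ℝ≥0∞) ∂π = 0 := by
    refine le_antisymm (le_trans (lintegral_mono fun y => ?_) hint.le) zero_le
    have := hR y Z hZ
    rwa [hνZ1, mul_one] at this
  rw [lintegral_eq_zero_iff hs.coe_nnreal_ennreal] at hs0
  have h3 : ∀ᵐ y ∂(π.restrict Zᶜ), False := by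
    filter_upwards [hs0] with y hy
    have : s y = 0 := ENNReal.coe_eq_zero.1 hy
    exact (hs1 y).1.ne' this
  rw [ae_iff] at h3
  simpa using h3

end Irreducible

/-! ### Tilted kernels: differentiability in the parameter and strict positivity. -/

section Tilted

variable {X : Type*} [MeasurableSpace X] {w : X → ℝ≥0}

/-- Multiplication by a bounded measurable function, as an operator on `L_∞^w`. -/
def mulOp (w : X → ℝ≥0) (F : X → ℝ) (hFm : Measurable F) (hF : ∀ x, |F x| ≤ 1) :
    LInf w →L[ℂ] LInf w :=
  LinearMap.mkContinuous
    { toFun := fun h => LInf.mk (fun x => F x * h x)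
        ((Complex.measurable_ofReal.comp hFm).mul h.measurable) (by
          obtain ⟨C, hC⟩ := h.bound
          refine ⟨C, fun x => ?_⟩
          rw [norm_mul, Complex.norm_real]
          exact (mul_le_of_le_one_left (norm_nonneg _) (hF x)).trans (hC x))
      map_add' := fun g h => LInf.ext' fun x => mul_add _ (g x) (h x)
      map_smul' := fun c h => LInf.ext' fun x => mul_left_comm (F x : ℂ) c (h x) } 1 fun h => by
    rw [one_mul]
    refine LInf.norm_le (norm_nonneg _) fun x => ?_
    change ‖(F x : ℂ) * h x‖ ≤ _
    rw [norm_mul, Complex.norm_real]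
    exact (mul_le_of_le_one_left (norm_nonneg _) (hF x)).trans (h.le_norm x)

variable {F : X → ℝ} (hFm : Measurable F) (hF : ∀ x, |F x| ≤ 1)

theorem mulOp_apply (h : LInf w) (x : X) : mulOp w F hFm hF h x = F x * h x := rfl

/-- Seeing multiplication by e^{aF} as the exponential of a bounded operator makes its norm
differentiability in a automatic. The proof evaluates the exponential series at a point. -/
theorem exp_smul_mulOp_apply (a : ℝ) (h : LInf w) (x : X) :
    NormedSpace.exp (a • mulOp w F hFm hF) h x = (Real.exp (a * F x) : ℂ) * h x := by
  have hpow : ∀ n : ℕ, ((a • mulOp w F hFm hF) ^ n) h x = ((a * F x : ℝ) : ℂ) ^ n * h x := by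
    intro n
    induction n with
    | zero => simp
    | succ n ih =>
      rw [pow_succ', mul_apply_eq_comp]
      have : ∀ g : LInf w, (a • mulOp w F hFm hF) g x = ((a * F x : ℝ) : ℂ) * g x := by
        intro g
        have e : a • mulOp w F hFm hF = (a : ℂ) • mulOp w F hFm hF := (Complex.coe_smul _ _).symm
        rw [e, smul_apply, LInf.smul_apply, mulOp_apply]
        push_cast; ring
      rw [this, ih]; ring
  have h1 := NormedSpace.exp_series_hasSum_exp' (𝕂 := ℂ) (a • mulOp w F hFm hF)
  have h2 := ((LInf.eval w x).comp (ContinuousLinearMap.apply ℂ (LInf w) h)).hasSum h1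
  have h3 := (NormedSpace.exp_series_hasSum_exp' (𝕂 := ℂ) ((a * F x : ℝ) : ℂ)).mul_right (h x)
  have e : (Real.exp (a * F x) : ℂ) = NormedSpace.exp ((a * F x : ℝ) : ℂ) := by
    rw [Complex.ofReal_exp, Complex.exp_eq_exp_ℂ]
  rw [e]
  refine h2.unique ?_
  refine (congrArg (HasSum · _) (funext fun n => ?_)).mp h3
  symm
  change ((((n.factorial : ℂ)⁻¹ • (a • mulOp w F hFm hF) ^ n) h : LInf w) x) = _
  rw [smul_apply, LInf.smul_apply, hpow, smul_eq_mul, mul_assoc]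

include hFm in
theorem tilted_apply (P : Kernel X X) [IsSFiniteKernel P] (a : ℝ) (x : X) :
    tilted P F a x = ENNReal.ofReal (Real.exp (a * F x)) • P x := by
  rw [tilted, Kernel.withDensity_apply _ (by fun_prop)]
  exact withDensity_const _

include hFm hF in
theorem hasFiniteNorm_tilted {P : Kernel X X} [IsSFiniteKernel P] (hP : HasFiniteNorm P w) (a : ℝ) :
    HasFiniteNorm (tilted P F a) w := by
  obtain ⟨C, hC⟩ := hP
  refine ⟨(Real.exp |a|).toNNReal * C, fun x => ?_⟩
  rw [tilted_apply hFm, lintegral_smul_measure, ENNReal.coe_mul, mul_assoc, smul_eq_mul]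
  refine mul_le_mul' (ENNReal.ofReal_le_ofReal (Real.exp_le_exp.2 ?_)) (hC x)
  calc a * F x ≤ |a * F x| := le_abs_self _
    _ = |a| * |F x| := abs_mul _ _
    _ ≤ |a| := mul_le_of_le_one_right (abs_nonneg _) (hF x)

include hFm hF in
theorem kernelOp_tilted_apply {P : Kernel X X} [IsSFiniteKernel P] (hP : HasFiniteNorm P w) (a : ℝ)
    (h : LInf w) (x : X) :
    kernelOp (tilted P F a) w h x = (Real.exp (a * F x) : ℂ) * kernelOp P w h x := by
  rw [kernelOp_apply (hasFiniteNorm_tilted hFm hF hP a), kernelOp_apply hP, tilted_apply hFm,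
    integral_smul_measure, ENNReal.toReal_ofReal (Real.exp_nonneg _)]
  exact Complex.real_smul

theorem hasStrictDerivAt_kernelOp_tilted {P : Kernel X X} [IsSFiniteKernel P]
    (hP : HasFiniteNorm P w) (a : ℝ) :
    HasStrictDerivAt (fun t => kernelOp (tilted P F t) w)
      (mulOp w F hFm hF * kernelOp (tilted P F a) w) a := by
  have e : ∀ t, kernelOp (tilted P F t) w
      = NormedSpace.exp (t • mulOp w F hFm hF) * kernelOp P w := fun t => by
    ext1 h
    refine LInf.ext' fun x => ?_
    rw [kernelOp_tilted_apply hFm hF hP, mul_apply_eq_comp, exp_smul_mulOp_apply]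
  have h1 := (hasStrictDerivAt_exp_smul_const' (𝕂 := ℝ) (mulOp w F hFm hF) a).mul_const
    (kernelOp P w)
  rw [mul_assoc, ← e] at h1
  exact h1.congr_of_eventuallyEq (Eventually.of_forall fun t => (e t).symm)

theorem hasFiniteNorm_of_drift {P : Kernel X X} {V : X → ℝ≥0} (hV : ∀ x, 1 ≤ V x)
    (hd : DriftV4 P V) : HasFiniteNorm P V := by
  obtain ⟨ν, b, δ, s, -, -, -, hs1, hd, -⟩ := hd
  refine ⟨1 + b, fun x => le_trans (le_trans le_self_add (hd x)) ?_⟩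
  rw [← ENNReal.coe_mul, ← ENNReal.coe_mul, ← ENNReal.coe_add]
  refine ENNReal.coe_le_coe.2 ?_
  rw [add_mul, one_mul]
  gcongr
  exact (hs1 x).2.trans (hV x)

theorem lintegral_ne_top_of_sq {V : X → ℝ≥0} (hV : ∀ x, 1 ≤ V x) {π : Measure X}
    (hπV : ∫⁻ x, (V x : ℝ≥0∞) ^ 2 ∂π < ∞) : ∫⁻ x, V x ∂π ≠ ∞ := by
  refine (lt_of_le_of_lt (lintegral_mono fun x => ?_) hπV).ne
  rw [pow_two]
  exact le_mul_of_one_le_left' (by rw [← ENNReal.coe_one]; exact ENNReal.coe_le_coe.2 (hV x))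

variable {P : Kernel X X} [IsMarkovKernel P] {V : X → ℝ≥0} (hVm : Measurable V)
  (hV : ∀ x, 1 ≤ V x) (hd : DriftV4 P V) {π : Measure X} [IsProbabilityMeasure π]
  (hπ : Kernel.Invariant P π)

-- At a zero y of g the eigenvalue equation forces g = 0 almost everywhere for P(y, ·). The zero set
-- is thus absorbing, and if nonempty it would carry all of π.
include hFm hF hV hd hπ in
theorem apply_ne_zero_of_eig {a : ℝ} {g : LInf V} (hg : IsNonneg g) (hgπ : ¬ ∀ᵐ x ∂π, g x = 0)
    {c : ℂ} (hge : kernelOp (tilted P F a) V g = c • g) (x : X) : g x ≠ 0 := by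
  have hP := hasFiniteNorm_of_drift hV hd
  intro hx
  refine hgπ ?_
  have hZ : MeasurableSet {x | g x = 0} := g.measurable (measurableSet_singleton 0)
  rw [ae_iff]
  refine measure_compl_eq_zero_of_absorbing hd hπ hZ ⟨x, hx⟩ fun y hy => ?_
  have h1 : kernelOp P V g y = 0 := by
    have h2 : kernelOp (tilted P F a) V g y = c * g y := by rw [hge]; rfl
    rw [kernelOp_tilted_apply hFm hF hP, show g y = 0 from hy, mul_zero, mul_eq_zero] at h2
    refine h2.resolve_left ?_
    exact_mod_cast (Real.exp_pos _).ne'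
  rw [kernelOp_apply_of_isNonneg hP hg, Complex.ofReal_eq_zero,
    integral_eq_zero_iff_of_nonneg (fun _ => norm_nonneg _)
      (integrable_of_hasFiniteNorm hP g y).norm] at h1
  have h3 : ∀ᵐ z ∂(P y), g z = 0 := by
    filter_upwards [h1] with z hz using norm_eq_zero.1 hz
  exact ae_iff.1 h3

include hFm hF hVm hd hπ in
theorem exists_isPrincipal_tilted {a : ℝ} {lam : ℂ} {f : LInf V} {φ : LInf V →L[ℂ] ℂ}
    (h : IsDominant (kernelOp (tilted P F a) V) lam f φ) (hfπ : ¬ ∀ᵐ x ∂π, f x = 0) :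
    ∃ (g : LInf V) (ψ : LInf V →L[ℂ] ℂ), IsPrincipal (tilted P F a) hV ‖lam‖ g ψ := by
  refine exists_isPrincipal hV hVm
    (hasFiniteNorm_tilted hFm hF (hasFiniteNorm_of_drift hV hd) a) h fun g hg _ hgf hgc => ?_
  obtain ⟨c, -, hgc⟩ := hgc
  refine apply_ne_zero_of_eig hFm hF hV hd hπ hg (fun h0 => hfπ ?_) hgc
  filter_upwards [h0] with x hx
  rw [← norm_eq_zero, ← hgf x, hx, norm_zero]

theorem IsPrincipal.unique {K : Kernel X X} [IsSFiniteKernel K] {hw : ∀ x, 1 ≤ w x} {lam lam' : ℝ}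
    {f f' : LInf w} {φ φ' : LInf w →L[ℂ] ℂ} (h : IsPrincipal K hw lam f φ)
    (h' : IsPrincipal K hw lam' f' φ') : lam' = lam ∧ f' = f ∧ φ' = φ := by
  obtain ⟨h1, h2, h3⟩ := h.dom.unique_of_normalized h'.dom h.mass h'.mass
  exact ⟨by exact_mod_cast h1, h2, h3⟩

theorem IsPrincipal.integral_ne_zero {K : Kernel X X} [IsSFiniteKernel K] {hw : ∀ x, 1 ≤ w x}
    {lam : ℝ} {f : LInf w} {φ : LInf w →L[ℂ] ℂ} (h : IsPrincipal K hw lam f φ)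
    {m : Measure X} [NeZero m] (hm : ∫⁻ y, w y ∂m ≠ ∞) : integralCLM m hm f ≠ 0 := by
  rw [integralCLM_apply]
  have e : ∫ y, f y ∂m = ((∫ y, ‖f y‖ ∂m : ℝ) : ℂ) := by
    rw [← integral_complex_ofReal]
    exact integral_congr_ae (Eventually.of_forall h.isNonneg)
  rw [e, Complex.ofReal_ne_zero]
  refine ne_of_gt ((integral_pos_iff_support_of_nonneg (fun _ => norm_nonneg _)
    (f.integrable_of_lintegral_ne_top hm).norm).2 ?_)
  have : (Function.support fun y => ‖f y‖) = Set.univ :=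
    Set.eq_univ_of_forall fun y => norm_ne_zero_iff.2 (h.apply_ne y)
  rw [this]
  exact Measure.measure_univ_pos.2 (NeZero.ne m)

include hFm hF hVm hd hπ in
/-- Local differentiable dependence of the principal eigentriple on the tilting parameter. -/
theorem IsPrincipal.exists_local {a₀ : ℝ} {lam : ℝ} {f : LInf V} {φ : LInf V →L[ℂ] ℂ}
    (hπV : ∫⁻ x, V x ∂π ≠ ∞) (h : IsPrincipal (tilted P F a₀) hV lam f φ) :
    ∃ (l : ℝ → ℝ) (f₁ : ℝ → LInf V) (φ₁ : ℝ → LInf V →L[ℂ] ℂ), DifferentiableAt ℝ l a₀ ∧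
      DifferentiableAt ℝ f₁ a₀ ∧ DifferentiableAt ℝ φ₁ a₀ ∧
      ∀ᶠ a in 𝓝 a₀, IsPrincipal (tilted P F a) hV (l a) (f₁ a) (φ₁ a) := by
  have hP := hasFiniteNorm_of_drift hV hd
  obtain ⟨l, f₁, φ₁, hl, hf, hφ, hld, hfd, hφd, hdom⟩ :=
    IsDominant.exists_perturbation (hasStrictDerivAt_kernelOp_tilted hFm hF hP a₀) h.dom
  set c : ℝ → ℂ := fun a => (φ₁ a (LInf.one hV))⁻¹ with hc
  have hc1d : DifferentiableAt ℝ (fun a => φ₁ a (LInf.one hV)) a₀ :=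
    (hasDerivAt_apply hφd.hasDerivAt (hasDerivAt_const a₀ (LInf.one hV))).differentiableAt
  have hc1 : φ₁ a₀ (LInf.one hV) = 1 := by rw [hφ, h.mass]
  have hc0 : ∀ᶠ a in 𝓝 a₀, φ₁ a (LInf.one hV) ≠ 0 :=
    hc1d.continuousAt.eventually_ne (by rw [hc1]; exact one_ne_zero)
  have hcd : DifferentiableAt ℝ c a₀ := hc1d.inv hc0.self_of_nhds
  -- A nonzero π-mean is an open condition that excludes vanishing π-almost everywhere, so
  -- positivity propagates to nearby parameters.
  have hfne : ∀ᶠ a in 𝓝 a₀, integralCLM π hπV (f₁ a) ≠ 0 := by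
    refine ContinuousAt.eventually_ne
      ((integralCLM π hπV).continuous.continuousAt.comp hfd.continuousAt) ?_
    rw [hf]
    exact h.integral_ne_zero hπV
  refine ⟨fun a => (l a).re, fun a => (c a)⁻¹ • f₁ a, fun a => c a • φ₁ a,
    Complex.reCLM.differentiableAt.comp a₀ hld,
    (hcd.inv (inv_ne_zero hc0.self_of_nhds)).smul hfd, hcd.smul hφd, ?_⟩
  filter_upwards [hdom, hc0, hfne] with a h1 h2 h3
  have hfπ : ¬ ∀ᵐ x ∂π, f₁ a x = 0 := fun h0 => h3 (by
    rw [integralCLM_apply]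
    exact integral_eq_zero_of_ae h0)
  -- Positivity yields some principal triple at a; the common normalization of mass 1 forces it to
  -- be the perturbed one.
  obtain ⟨g, ψ, hp⟩ := exists_isPrincipal_tilted hFm hF hVm hV hd hπ h1 hfπ
  have h4 := h1.rescale (inv_ne_zero h2)
  obtain ⟨h5, h6, h7⟩ := hp.dom.unique_of_normalized h4 hp.mass
    (by simp [h2] : ((φ₁ a (LInf.one hV))⁻¹ • φ₁ a) (LInf.one hV) = 1)
  have h8 : (l a).re = ‖l a‖ := by
    rw [h5]; simp
  simp only [hc]
  rw [h8, h6, h7]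
  exact hp

end Tilted

/-! ### Invariant measures of Markov kernels with dominant eigenvalue 1. -/

section Invariant

variable {X : Type*} [MeasurableSpace X] {w : X → ℝ≥0}

theorem integral_integral_of_invariant {K : Kernel X X} {m : Measure X}
    (hm : Kernel.Invariant K m) {h : X → ℂ} (hh : Integrable h m) :
    ∫ x, ∫ y, h y ∂(K x) ∂m = ∫ y, h y ∂m := by
  have e : (K ∘ₖ Kernel.const Unit m) () = m := hm
  have h1 := Kernel.integral_comp (η := K) (κ := Kernel.const Unit m) (a := ()) (f := h)
    (by rw [e]; exact hh)
  rw [e, Kernel.const_apply] at h1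
  exact h1.symm

theorem kernelOp_ind_apply {K : Kernel X X} [IsSFiniteKernel K] (hK : HasFiniteNorm K w)
    (hw : ∃ C : ℝ≥0, ∀ x, 1 ≤ C * w x) {A : Set X} (hA : MeasurableSet A) (x : X) :
    kernelOp K w (LInf.ind hw A) x = ((K x).real A : ℂ) := by
  rw [kernelOp_apply hK]
  have h2 : (LInf.ind hw A : X → ℂ) = A.indicator (fun _ => (1 : ℂ)) :=
    funext fun x => LInf.ind_apply hA x
  rw [h2, integral_indicator_const _ hA]
  simp

theorem integralCLM_ind {m : Measure X} (hm : ∫⁻ y, w y ∂m ≠ ∞)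
    (hw : ∃ C : ℝ≥0, ∀ x, 1 ≤ C * w x) {A : Set X} (hA : MeasurableSet A) :
    integralCLM m hm (LInf.ind hw A) = (m.real A : ℂ) := by
  rw [integralCLM_apply]
  have h2 : (LInf.ind hw A : X → ℂ) = A.indicator (fun _ => (1 : ℂ)) :=
    funext fun x => LInf.ind_apply hA x
  rw [h2, integral_indicator_const _ hA]
  simp

/-- A Markov kernel with dominant eigenvalue `1` has a unique invariant probability measure, which
represents the left eigenvector. -/
theorem IsDominant.existsUnique_invariant {K : Kernel X X} [IsMarkovKernel K]
    (hK : HasFiniteNorm K w) (hwm : Measurable w) (hw : ∃ C : ℝ≥0, ∀ x, 1 ≤ C * w x)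
    {e : LInf w} {φ : LInf w →L[ℂ] ℂ} (h : IsDominant (kernelOp K w) 1 e φ) (he : ∀ x, e x = 1)
    (hpos : ∀ A, MeasurableSet A → φ (LInf.ind hw A) = (‖φ (LInf.ind hw A)‖ : ℂ)) :
    ∃ (m : Measure X) (hm : ∫⁻ y, w y ∂m ≠ ∞), φ = integralCLM m hm ∧ IsProbabilityMeasure m ∧
      Kernel.Invariant K m ∧
      ∀ ρ : Measure X, IsProbabilityMeasure ρ → Kernel.Invariant K ρ → ρ = m := by
  obtain ⟨m, hm, hφ⟩ := (h.isSigmaCont hwm hK).exists_measure hwm hw hpos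
  have hp : IsProbabilityMeasure m := by
    have h1 := h.pair
    rw [hφ, integralCLM_apply] at h1
    simp only [he] at h1
    rw [integral_const, Complex.real_smul, mul_one, Complex.ofReal_eq_one, measureReal_def,
      ENNReal.toReal_eq_one_iff] at h1
    exact ⟨h1⟩
  refine ⟨m, hm, hφ, hp, ?_, fun ρ hρ hρK => ?_⟩
  · refine Measure.ext fun A hA => ?_
    rw [Measure.bind_apply hA K.aemeasurable]
    have h1 := h.adj (LInf.ind hw A)
    rw [one_mul, hφ, integralCLM_ind hm hw hA, integralCLM_apply] at h1
    simp only [kernelOp_ind_apply hK hw hA] at h1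
    rw [integral_complex_ofReal, Complex.ofReal_inj] at h1
    have h2 : ∫⁻ x, K x A ∂m = ENNReal.ofReal (∫ x, (K x).real A ∂m) := by
      rw [ofReal_integral_eq_lintegral_ofReal]
      · simp
      · refine Integrable.of_bound (K.measurable_coe hA).ennreal_toReal.aestronglyMeasurable 1
          (Eventually.of_forall fun x => ?_)
        rw [Real.norm_of_nonneg measureReal_nonneg]
        exact measureReal_le_one
      · exact Eventually.of_forall fun x => measureReal_nonneg
    rw [h2, h1, ofReal_measureReal]
  -- A competitor ρ need not integrate w, so it need not define a functional on L_∞^w. Instead Kⁿ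
  -- 1_A is bounded by 1, tends pointwise to m(A), and has constant ρ-integral ρ(A).
  · refine Measure.ext fun A hA => ?_
    set u : ℕ → LInf w := fun n => (kernelOp K w ^ n) (LInf.ind hw A) with hu
    have hus : ∀ n x, u (n + 1) x = ∫ y, u n y ∂(K x) := fun n x => by
      simp only [hu]
      rw [pow_succ', mul_apply_eq_comp, kernelOp_apply hK]
    have hu1 : ∀ n x, ‖u n x‖ ≤ 1 := by
      intro n
      induction n with
      | zero =>
        intro x
        have : u 0 x = A.indicator (fun _ => (1 : ℂ)) x :=
          LInf.ind_apply (hw := hw) hA x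
        rw [this]
        refine (norm_indicator_le_norm_self _ _).trans (by simp)
      | succ n ih =>
        intro x
        rw [hus]
        exact (norm_integral_le_of_norm_le_const (Eventually.of_forall ih)).trans (by simp)
    have hui : ∀ n, Integrable (u n) ρ := fun n =>
      Integrable.of_bound (u n).measurable.aestronglyMeasurable 1 (Eventually.of_forall (hu1 n))
    have huρ : ∀ n, ∫ x, u n x ∂ρ = (ρ.real A : ℂ) := by
      intro n
      induction n with
      | zero =>
        have : (u 0 : X → ℂ) = A.indicator (fun _ => (1 : ℂ)) :=
          funext fun x => LInf.ind_apply (hw := hw) hA x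
        rw [this, integral_indicator_const _ hA]
        simp
      | succ n ih =>
        simp only [hus]
        rw [integral_integral_of_invariant hρK (hui n), ih]
    have hlim : ∀ x, Tendsto (fun n => u n x) atTop (𝓝 (m.real A : ℂ)) := by
      intro x
      have h1 := LInf.tendsto_apply (h.tendsto_inv_pow (LInf.ind hw A)) x
      rw [LInf.smul_apply, he, mul_one, hφ, integralCLM_ind hm hw hA] at h1
      simpa only [one_pow, inv_one, one_smul] using h1
    have h3 := MeasureTheory.tendsto_integral_of_dominated_convergence (fun _ => (1 : ℝ))
      (fun n => (u n).measurable.aestronglyMeasurable) (integrable_const (μ := ρ) 1)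
      (fun n => Eventually.of_forall (hu1 n)) (Eventually.of_forall hlim)
    simp only [huρ, integral_const, probReal_univ, one_smul] at h3
    have h4 := tendsto_nhds_unique tendsto_const_nhds h3
    rw [Complex.ofReal_inj, measureReal_def, measureReal_def,
      ENNReal.toReal_eq_toReal_iff' (measure_ne_top _ _) (measure_ne_top _ _)] at h4
    exact h4

end Invariant

/-! ### Dominance under similarity and scaling. -/

section Conj

variable {E G : Type*} [NormedAddCommGroup E] [NormedSpace ℂ E] [NormedAddCommGroup G]
  [NormedSpace ℂ G]

/-- The remainder of S is the conjugate by J of c times the remainder of T, so its spectrum is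
scaled by c. -/
theorem IsDominant.conj {T : E →L[ℂ] E} {lam : ℂ} {f : E} {φ : E →L[ℂ] ℂ}
    (h : IsDominant T lam f φ) (J : G ≃L[ℂ] E) {S : G →L[ℂ] G} {c : ℂ} (hc : c ≠ 0)
    (hS : ∀ g, J (S g) = c • T (J g)) :
    IsDominant S (c * lam) (J.symm f) (φ.comp (J : G →L[ℂ] E)) where
  eig := by
    apply J.injective
    rw [hS, map_smul, J.apply_symm_apply, h.eig, smul_smul]
  adj g := by
    change φ (J (S g)) = c * lam * φ (J g)
    rw [hS, map_smul, h.adj, smul_eq_mul, mul_assoc]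
  pair := by
    change φ (J (J.symm f)) = 1
    rw [J.apply_symm_apply, h.pair]
  gap := by
    obtain ⟨r, hr0, hr1, hr⟩ := h.gap
    have hcn : 0 < ‖c‖ := norm_pos_iff.2 hc
    refine ⟨‖c‖ * r, by positivity, by rw [norm_mul]; gcongr, fun z hz => ?_⟩
    have e : S - (c * lam) • (φ.comp (J : G →L[ℂ] E)).smulRight (J.symm f)
        = (J.symm.conjContinuousAlgEquiv) ((Units.mk0 c hc) • (T - lam • φ.smulRight f)) := by
      ext1 g
      apply J.injective
      simp [hS, Units.smul_def, mul_smul, smul_sub, smul_comm lam]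
    rw [e, AlgEquiv.spectrum_eq, spectrum.unit_smul_eq_smul] at hz
    obtain ⟨y, hy, rfl⟩ := hz
    change ‖c * y‖ ≤ _
    rw [norm_mul]
    exact mul_le_mul_of_nonneg_left (hr y hy) hcn.le

end Conj

/-! ### The twisted kernel as a conjugate of the tilted one. -/

section Twisted

variable {X : Type*} [MeasurableSpace X] {V : X → ℝ≥0}

omit [MeasurableSpace X] in
theorem coe_twistedWeight {f : X → ℝ} (hf : ∀ x, 0 < f x) (x : X) :
    (twistedWeight V f x : ℝ) = V x / f x := by
  rw [twistedWeight, NNReal.coe_div, Real.coe_toNNReal _ (hf x).le]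

theorem measurable_twistedWeight (hVm : Measurable V) {f : X → ℝ} (hfm : Measurable f) :
    Measurable (twistedWeight V f) := hVm.div hfm.real_toNNReal

omit [MeasurableSpace X] in
theorem exists_one_le_twistedWeight {f : X → ℝ} (hf : ∀ x, 0 < f x)
    (hb : ∃ C : ℝ≥0, ∀ x, f x ≤ C * V x) : ∃ C : ℝ≥0, ∀ x, 1 ≤ C * twistedWeight V f x := by
  obtain ⟨C, hC⟩ := hb
  refine ⟨C, fun x => ?_⟩
  rw [← NNReal.coe_le_coe, NNReal.coe_mul, coe_twistedWeight hf, ← mul_div_assoc, NNReal.coe_one,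
    one_le_div (hf x)]
  exact hC x

/-- Multiplication by a positive function `f`, as an isometry from `L_∞^{V/f}` to `L_∞^V`. -/
def mulEquiv (V : X → ℝ≥0) {f : X → ℝ} (hfm : Measurable f) (hf : ∀ x, 0 < f x) :
    LInf (twistedWeight V f) ≃ₗᵢ[ℂ] LInf V where
  toFun h := LInf.mk (fun x => f x * h x)
    ((Complex.measurable_ofReal.comp hfm).mul h.measurable) (by
      obtain ⟨C, hC⟩ := h.bound
      refine ⟨C, fun x => ?_⟩
      have h1 := hC x
      rw [coe_twistedWeight hf, ← mul_div_assoc, le_div_iff₀ (hf x)] at h1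
      rwa [norm_mul, Complex.norm_real, Real.norm_of_nonneg (hf x).le, mul_comm])
  invFun h := LInf.mk (fun x => (f x : ℂ)⁻¹ * h x)
    ((Complex.measurable_ofReal.comp hfm).inv.mul h.measurable) (by
      obtain ⟨C, hC⟩ := h.bound
      refine ⟨C, fun x => ?_⟩
      rw [coe_twistedWeight hf, ← mul_div_assoc, le_div_iff₀ (hf x), norm_mul, norm_inv,
        Complex.norm_real, Real.norm_of_nonneg (hf x).le, mul_comm, ← mul_assoc,
        mul_inv_cancel₀ (hf x).ne', one_mul]
      exact hC x)
  map_add' g h := LInf.ext' fun x => mul_add _ (g x) (h x)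
  map_smul' c h := LInf.ext' fun x => mul_left_comm (f x : ℂ) c (h x)
  left_inv h := LInf.ext' fun x =>
    inv_mul_cancel_left₀ (by exact_mod_cast (hf x).ne' : (f x : ℂ) ≠ 0) (h x)
  right_inv h := LInf.ext' fun x =>
    mul_inv_cancel_left₀ (by exact_mod_cast (hf x).ne' : (f x : ℂ) ≠ 0) (h x)
  norm_map' h := by
    change (⨆ x, ‖(f x : ℂ) * h x‖ / (V x : ℝ)) = ⨆ x, ‖h x‖ / (twistedWeight V f x : ℝ)
    refine congrArg _ (funext fun x => ?_)
    rw [norm_mul, Complex.norm_real, Real.norm_of_nonneg (hf x).le,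
      coe_twistedWeight hf, div_div_eq_mul_div, mul_comm]

theorem mulEquiv_apply {f : X → ℝ} (hfm : Measurable f) (hf : ∀ x, 0 < f x)
    (h : LInf (twistedWeight V f)) (x : X) : mulEquiv V hfm hf h x = f x * h x := rfl

variable {P : Kernel X X} [IsSFiniteKernel P] {F : X → ℝ} {a lam : ℝ} {f : X → ℝ}

theorem measurable_twisted_density (hfm : Measurable f) :
    Measurable (Function.uncurry fun x y => (lam⁻¹ * (f x)⁻¹ * f y).toNNReal) :=
  (((measurable_const.mul (hfm.comp measurable_fst).inv).mul
    (hfm.comp measurable_snd))).real_toNNReal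

theorem lintegral_twisted (hfm : Measurable f) (x : X) {g : X → ℝ≥0∞} (hg : Measurable g) :
    ∫⁻ y, g y ∂(twisted P F a lam f x)
      = ∫⁻ y, ((lam⁻¹ * (f x)⁻¹ * f y).toNNReal : ℝ≥0∞) * g y ∂(tilted P F a x) :=
  Kernel.lintegral_withDensity _ (measurable_twisted_density hfm).coe_nnreal_ennreal x hg

theorem integral_twisted (hfm : Measurable f) (hf : ∀ x, 0 < f x) (hlam : 0 < lam) (x : X)
    (h : X → ℂ) : ∫ y, h y ∂(twisted P F a lam f x)
      = (lam : ℂ)⁻¹ * (f x : ℂ)⁻¹ * ∫ y, f y * h y ∂(tilted P F a x) := by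
  rw [← integral_const_mul]
  refine (Kernel.integral_withDensity (measurable_twisted_density hfm)).trans ?_
  refine integral_congr_ae (Eventually.of_forall fun y => ?_)
  have h0 : 0 ≤ lam⁻¹ * (f x)⁻¹ * f y := by
    have := hf x; have := hf y; positivity
  change (lam⁻¹ * (f x)⁻¹ * f y).toNNReal • h y = _
  rw [NNReal.smul_def, Real.coe_toNNReal _ h0, Complex.real_smul]
  push_cast
  ring

theorem hasFiniteNorm_twisted (hVm : Measurable V) (hfm : Measurable f) (hf : ∀ x, 0 < f x)
    (hlam : 0 < lam) (hT : HasFiniteNorm (tilted P F a) V) :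
    HasFiniteNorm (twisted P F a lam f) (twistedWeight V f) := by
  obtain ⟨C, hC⟩ := hT
  refine ⟨lam⁻¹.toNNReal * C, fun x => ?_⟩
  rw [lintegral_twisted hfm x (measurable_twistedWeight hVm hfm).coe_nnreal_ennreal]
  have e : ∀ y, ((lam⁻¹ * (f x)⁻¹ * f y).toNNReal : ℝ≥0∞) * twistedWeight V f y
      = (lam⁻¹.toNNReal * (f x).toNNReal⁻¹ : ℝ≥0) * (V y : ℝ≥0∞) := by
    intro y
    have hy : (f y).toNNReal ≠ 0 := (Real.toNNReal_pos.2 (hf y)).ne'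
    rw [← ENNReal.coe_mul, ← ENNReal.coe_mul, twistedWeight,
      Real.toNNReal_mul (mul_nonneg (inv_nonneg.2 hlam.le) (inv_nonneg.2 (hf x).le)),
      Real.toNNReal_mul (inv_nonneg.2 hlam.le), Real.toNNReal_inv (x := f x)]
    congr 1
    field_simp
  simp only [e]
  rw [lintegral_const_mul' _ _ ENNReal.coe_ne_top]
  refine (mul_le_mul_right (hC x) _).trans (le_of_eq ?_)
  rw [twistedWeight]
  simp only [← ENNReal.coe_mul]
  congr 1
  rw [div_eq_mul_inv]
  ring

/-- Twisting is division by λ and conjugation by the isometry h ↦ f h, so spectral statements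
transfer through `IsDominant.conj`. -/
theorem mulEquiv_kernelOp_twisted (hVm : Measurable V) (hfm : Measurable f) (hf : ∀ x, 0 < f x)
    (hlam : 0 < lam) (hT : HasFiniteNorm (tilted P F a) V) (h : LInf (twistedWeight V f)) :
    mulEquiv V hfm hf (kernelOp (twisted P F a lam f) (twistedWeight V f) h)
      = (lam : ℂ)⁻¹ • kernelOp (tilted P F a) V (mulEquiv V hfm hf h) := by
  refine LInf.ext' fun x => ?_
  have hx : (f x : ℂ) ≠ 0 := by exact_mod_cast (hf x).ne'
  rw [mulEquiv_apply, LInf.smul_apply, kernelOp_apply (hasFiniteNorm_twisted hVm hfm hf hlam hT),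
    kernelOp_apply hT, integral_twisted hfm hf hlam]
  simp only [mulEquiv_apply]
  field_simp

end Twisted

/-! ### Logarithmic growth of functions with bounded increments. -/

section LogBound

variable {X : Type*} [MeasurableSpace X] {w : X → ℝ≥0}

theorem norm_kernelOp_apply_le {K : Kernel X X} [IsMarkovKernel K] (hK : HasFiniteNorm K w)
    {h : LInf w} {c : ℝ} (hc : ∀ x, ‖h x‖ ≤ c) (x : X) : ‖kernelOp K w h x‖ ≤ c := by
  rw [kernelOp_apply hK]
  exact (norm_integral_le_of_norm_le_const (Eventually.of_forall hc)).trans (by simp)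

/-- The number n = ⌈log⁺ t / |log ρ|⌉ of steps is enough for ρⁿ to outweigh t. -/
theorem exists_pow_mul_le_one {ρ : ℝ} (hρ0 : 0 < ρ) (hρ1 : ρ < 1) :
    ∃ c : ℝ, 0 ≤ c ∧ ∀ t : ℝ, 0 ≤ t → ∃ n : ℕ, ρ ^ n * t ≤ 1 ∧ (n : ℝ) ≤ c * Real.posLog t + 1 := by
  have hL : 0 < -Real.log ρ := neg_pos.2 (Real.log_neg hρ0 hρ1)
  refine ⟨(-Real.log ρ)⁻¹, inv_nonneg.2 hL.le, fun t ht => ?_⟩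
  have hp : 0 ≤ Real.posLog t := Real.posLog_nonneg
  refine ⟨⌈(-Real.log ρ)⁻¹ * Real.posLog t⌉₊, ?_, (Nat.ceil_lt_add_one (by positivity)).le⟩
  have h1 : (-Real.log ρ)⁻¹ * Real.posLog t ≤ ⌈(-Real.log ρ)⁻¹ * Real.posLog t⌉₊ := Nat.le_ceil _
  generalize ⌈(-Real.log ρ)⁻¹ * Real.posLog t⌉₊ = n at h1
  rcases ht.eq_or_lt with rfl | ht
  · simp
  rw [inv_mul_le_iff₀ hL] at h1
  have h2 : Real.log t ≤ Real.posLog t := le_max_right _ _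
  refine (Real.log_nonpos_iff (by positivity)).1 ?_
  rw [Real.log_mul (by positivity) ht.ne', Real.log_pow]
  linarith

/-- A function which is moved only boundedly by a geometrically ergodic Markov kernel grows at
most logarithmically. -/
theorem IsDominant.exists_log_bound {K : Kernel X X} [IsMarkovKernel K] (hK : HasFiniteNorm K w)
    {e : LInf w} {φ : LInf w →L[ℂ] ℂ} (h : IsDominant (kernelOp K w) 1 e φ) (he : ∀ x, e x = 1)
    {G : LInf w} {κ : ℝ} (hκ : 0 ≤ κ) (hG : ∀ x, ‖kernelOp K w G x - G x‖ ≤ κ) :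
    ∃ C : ℝ, ∀ x, ‖G x‖ ≤ C * (1 + Real.posLog (w x)) := by
  obtain ⟨C, ρ, hC, hρ0, hρ1, hdec⟩ := h.norm_inv_pow_sub_le
  obtain ⟨c, hc, hn⟩ := exists_pow_mul_le_one hρ0 hρ1
  -- A Markov kernel contracts the supremum norm, so each step adds at most κ.
  have h1 : ∀ (n : ℕ) x, ‖((kernelOp K w ^ n) G - G) x‖ ≤ κ * n := by
    intro n
    induction n with
    | zero => intro x; simp [LInf.zero_apply]
    | succ n ih =>
      intro x
      have e1 : (kernelOp K w ^ (n + 1)) G - G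
          = kernelOp K w ((kernelOp K w ^ n) G - G) + (kernelOp K w G - G) := by
        rw [pow_succ', mul_apply_eq_comp, map_sub]; abel
      rw [e1, LInf.add_apply, Nat.cast_succ, mul_add, mul_one]
      exact (norm_add_le _ _).trans (add_le_add (norm_kernelOp_apply_le hK ih x) (hG x))
  refine ⟨κ * (c + 1) + ‖φ G‖ + C * ‖G‖, fun x => ?_⟩
  -- The number of steps depends on x: large enough that ρⁿ w(x) ≤ 1, so Kⁿ G(x) is near its limit,
  -- and small enough that κ n is logarithmic in w(x).
  obtain ⟨n, hn1, hn2⟩ := hn (w x) (w x).2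
  have h2 := (LInf.le_norm _ x).trans (mul_le_mul_of_nonneg_right (hdec n G) (w x).2)
  rw [one_pow, inv_one, one_smul] at h2
  have h3 : C * ρ ^ n * ‖G‖ * w x ≤ C * ‖G‖ := by
    calc C * ρ ^ n * ‖G‖ * w x = C * ‖G‖ * (ρ ^ n * w x) := by ring
      _ ≤ C * ‖G‖ := mul_le_of_le_one_right (by positivity) hn1
  have h4 : ‖G x‖ ≤ ‖((kernelOp K w ^ n) G - G) x‖ + ‖((kernelOp K w ^ n) G - φ G • e) x‖
      + ‖φ G‖ := by
    have e2 : G x = -((kernelOp K w ^ n) G - G) x + ((kernelOp K w ^ n) G - φ G • e) x + φ G := by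
      rw [LInf.sub_apply, LInf.sub_apply, LInf.smul_apply, he]; ring
    calc ‖G x‖ = ‖-((kernelOp K w ^ n) G - G) x + ((kernelOp K w ^ n) G - φ G • e) x + φ G‖ := by
          rw [← e2]
      _ ≤ _ := norm_add₃_le
      _ = _ := by rw [norm_neg]
  have h5 : κ * n ≤ κ * (c * Real.posLog (w x) + 1) := mul_le_mul_of_nonneg_left hn2 hκ
  have hp : 0 ≤ Real.posLog (w x : ℝ) := Real.posLog_nonneg
  have h6 : 0 ≤ ‖φ G‖ * Real.posLog (w x : ℝ) := by positivity
  have h7 : 0 ≤ C * ‖G‖ * Real.posLog (w x : ℝ) := by positivity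
  have h8 : 0 ≤ κ * Real.posLog (w x : ℝ) := by positivity
  have h9 : 0 ≤ κ * c := by positivity
  linarith [h1 n x]

end LogBound

/-! ### Uniformity and invariant law of the twisted kernel. -/

section TwistedKernel

variable {X : Type*} [MeasurableSpace X] {V : X → ℝ≥0} {hV : ∀ x, 1 ≤ V x} {P : Kernel X X}
  [IsSFiniteKernel P] {F : X → ℝ} {a lam : ℝ} {f : LInf V} {φ : LInf V →L[ℂ] ℂ}

theorem IsPrincipal.coe_re {K : Kernel X X} [IsSFiniteKernel K] (h : IsPrincipal K hV lam f φ)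
    (x : X) : ((f x).re : ℂ) = f x := by
  rw [h.isNonneg x, Complex.ofReal_re]

theorem IsPrincipal.re_pos {K : Kernel X X} [IsSFiniteKernel K] (h : IsPrincipal K hV lam f φ)
    (x : X) : 0 < (f x).re := by
  rw [h.isNonneg x, Complex.ofReal_re]
  exact norm_pos_iff.2 (h.apply_ne x)

theorem LInf.measurable_re (f : LInf V) : Measurable fun x => (f x).re :=
  Complex.measurable_re.comp f.measurable

theorem IsPrincipal.exists_one_le (h : IsPrincipal (tilted P F a) hV lam f φ) :
    ∃ C : ℝ≥0, ∀ x, 1 ≤ C * twistedWeight V (fun x => (f x).re) x :=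
  exists_one_le_twistedWeight h.re_pos
    ⟨‖f‖₊, fun x => (Complex.re_le_norm _).trans (f.le_norm x)⟩

theorem IsPrincipal.isMarkovKernel (h : IsPrincipal (tilted P F a) hV lam f φ)
    (hT : HasFiniteNorm (tilted P F a) V) :
    IsMarkovKernel (twisted P F a lam fun x => (f x).re) := by
  refine ⟨fun x => ⟨?_⟩⟩
  have hx := h.re_pos x
  have h1 := lintegral_twisted (P := P) (F := F) (a := a) (lam := lam) f.measurable_re x
    (measurable_const (a := (1 : ℝ≥0∞)))
  simp only [mul_one, lintegral_one] at h1
  rw [h1]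
  have hi : Integrable (fun y => (f y).re) (tilted P F a x) := (integrable_of_hasFiniteNorm hT f x).re
  have h2 : ∫ y, (f y).re ∂(tilted P F a x) = lam * (f x).re := by
    have h3 : kernelOp (tilted P F a) V f x = lam * f x := by rw [h.dom.eig]; rfl
    rw [kernelOp_apply hT] at h3
    have h4 : ∫ y, f y ∂(tilted P F a x) = ((∫ y, (f y).re ∂(tilted P F a x) : ℝ) : ℂ) := by
      rw [← integral_complex_ofReal]
      exact integral_congr_ae (Eventually.of_forall fun y => (h.coe_re y).symm)
    rw [h4, ← h.coe_re x] at h3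
    exact_mod_cast h3
  have h5 : ∫⁻ y, ((lam⁻¹ * (f x).re⁻¹ * (f y).re).toNNReal : ℝ≥0∞) ∂(tilted P F a x)
      = ENNReal.ofReal (∫ y, lam⁻¹ * (f x).re⁻¹ * (f y).re ∂(tilted P F a x)) := by
    rw [ofReal_integral_eq_lintegral_ofReal (hi.const_mul _)]
    · rfl
    · exact Eventually.of_forall fun y => mul_nonneg
        (mul_nonneg (inv_nonneg.2 h.lam_pos.le) (inv_nonneg.2 hx.le)) (h.re_pos y).le
  rw [h5, integral_const_mul, h2]
  have := h.lam_pos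
  have e : lam⁻¹ * (f x).re⁻¹ * (lam * (f x).re) = 1 := by field_simp
  rw [e, ENNReal.ofReal_one]

/-- The identification of `L_∞^{V/f}` with `L_∞^V` for a principal eigenfunction `f`. -/
def IsPrincipal.mulEquiv (h : IsPrincipal (tilted P F a) hV lam f φ) :
    LInf (twistedWeight V fun x => (f x).re) ≃ₗᵢ[ℂ] LInf V :=
  VGeo.mulEquiv V f.measurable_re h.re_pos

theorem IsPrincipal.mulEquiv_apply (h : IsPrincipal (tilted P F a) hV lam f φ)
    (g : LInf (twistedWeight V fun x => (f x).re)) (x : X) : h.mulEquiv g x = f x * g x := by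
  rw [← h.coe_re x]; rfl

theorem IsPrincipal.mulEquiv_symm_apply (h : IsPrincipal (tilted P F a) hV lam f φ)
    (g : LInf V) (x : X) : h.mulEquiv.symm g x = (f x)⁻¹ * g x := by
  rw [← h.coe_re x]; rfl

theorem IsPrincipal.mulEquiv_symm_self (h : IsPrincipal (tilted P F a) hV lam f φ) (x : X) :
    h.mulEquiv.symm f x = 1 := by
  rw [h.mulEquiv_symm_apply]
  exact inv_mul_cancel₀ (h.apply_ne x)

theorem IsPrincipal.isDominant_twisted (h : IsPrincipal (tilted P F a) hV lam f φ)
    (hVm : Measurable V) (hT : HasFiniteNorm (tilted P F a) V) :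
    IsDominant (kernelOp (twisted P F a lam fun x => (f x).re)
        (twistedWeight V fun x => (f x).re)) 1 (h.mulEquiv.symm f)
      (φ.comp (h.mulEquiv.toContinuousLinearEquiv :
        LInf (twistedWeight V fun x => (f x).re) →L[ℂ] LInf V)) := by
  have hl : (lam : ℂ) ≠ 0 := by exact_mod_cast h.lam_pos.ne'
  have h1 := h.dom.conj h.mulEquiv.toContinuousLinearEquiv (inv_ne_zero hl)
    (fun g => mulEquiv_kernelOp_twisted hVm f.measurable_re h.re_pos h.lam_pos hT g)
  rwa [inv_mul_cancel₀ hl] at h1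

theorem IsPrincipal.hasFiniteNorm_twisted (h : IsPrincipal (tilted P F a) hV lam f φ)
    (hVm : Measurable V) (hT : HasFiniteNorm (tilted P F a) V) :
    HasFiniteNorm (twisted P F a lam fun x => (f x).re) (twistedWeight V fun x => (f x).re) :=
  VGeo.hasFiniteNorm_twisted hVm f.measurable_re h.re_pos h.lam_pos hT

theorem IsPrincipal.isUniform_twisted (h : IsPrincipal (tilted P F a) hV lam f φ)
    (hVm : Measurable V) (hT : HasFiniteNorm (tilted P F a) V) :
    IsUniform (twisted P F a lam fun x => (f x).re) (twistedWeight V fun x => (f x).re) := by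
  have h1 := h.isDominant_twisted hVm hT
  have h2 := h.hasFiniteNorm_twisted hVm hT
  have hwm := measurable_twistedWeight hVm f.measurable_re
  obtain ⟨ν, hν⟩ := (h1.isSigmaCont hwm h2).exists_M1 hwm h.exists_one_le
  rw [← hν] at h1
  exact ⟨1, h2, h1.isUniformOpWith⟩

/-- The left eigenvector of the twisted kernel is h ↦ φ(f h), so the invariant law is f dφ. The last
clause inverts this relation; it later turns φ(F f) into m(F). -/
theorem IsPrincipal.exists_invariant (h : IsPrincipal (tilted P F a) hV lam f φ)
    (hVm : Measurable V) (hT : HasFiniteNorm (tilted P F a) V) :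
    ∃ m : Measure X, IsProbabilityMeasure m ∧
      Kernel.Invariant (twisted P F a lam fun x => (f x).re) m ∧
      (∀ ρ : Measure X, IsProbabilityMeasure ρ →
        Kernel.Invariant (twisted P F a lam fun x => (f x).re) ρ → ρ = m) ∧
      ∀ g : LInf V, φ g = ∫ x, (f x)⁻¹ * g x ∂m := by
  have := h.isMarkovKernel hT
  have hwm := measurable_twistedWeight hVm f.measurable_re
  obtain ⟨m, hm, hφ, h1, h2, h3⟩ := (h.isDominant_twisted hVm hT).existsUnique_invariant
    (h.hasFiniteNorm_twisted hVm hT) hwm h.exists_one_le h.mulEquiv_symm_self fun A hA => by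
      refine h.map_nonneg _ fun x => ?_
      change h.mulEquiv _ x = (‖h.mulEquiv _ x‖ : ℂ)
      rw [h.mulEquiv_apply, norm_mul, Complex.ofReal_mul, ← h.isNonneg x,
        ← LInf.isNonneg_ind h.exists_one_le hA x]
  refine ⟨m, h1, h2, h3, fun g => ?_⟩
  have h4 : φ g = integralCLM m hm (h.mulEquiv.symm g) := by
    rw [← hφ]
    change φ g = φ (h.mulEquiv (h.mulEquiv.symm g))
    rw [h.mulEquiv.apply_symm_apply]
  rw [h4, integralCLM_apply]
  simp only [h.mulEquiv_symm_apply]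

end TwistedKernel

/-! ### Eigenvectors through potential operators. -/

section Potential

variable {X : Type*} [MeasurableSpace X] {w : X → ℝ≥0} {T : LInf w →L[ℂ] LInf w} {lam : ℂ}
  {f : LInf w}

theorem IsDominant.exists_hasPotential {ν : M1 w} (h : IsDominant T lam f ν.toDual) :
    ∃ (s₀ : LInf w) (ν₀ : M1 w), ∃ ε > 0, ∀ z : ℂ, ‖lam‖ - ε ≤ ‖z‖ → HasPotential T s₀ ν₀ z := by
  obtain ⟨r, hr0, hr1, hr⟩ := h.gap
  -- With s₀ = λ f and ν₀ = ν, the operator T - s₀⊗ν₀ is the remainder, whose spectrum lies in the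
  -- disc of radius r; ε is half the gap.
  refine ⟨lam • f, ν, (‖lam‖ - r) / 2, by linarith, fun z hz => ?_⟩
  have e : rankOne (lam • f) ν = lam • ν.toDual.smulRight f := by
    ext1 v
    exact smul_comm (ν.toDual v) lam f
  rw [HasPotential, e]
  by_contra hn
  have := hr z (spectrum.mem_iff.2 hn)
  linarith

/-- Let B = λ - T + s₀⊗ν₀. The eigenvalue equations leave only the rank one term: B f = ν₀(f) s₀ and
φ B = φ(s₀) ν₀. -/
theorem IsDominant.potential_apply {φ : LInf w →L[ℂ] ℂ} (h : IsDominant T lam f φ) {s₀ : LInf w}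
    {ν₀ : M1 w} (hU : HasPotential T s₀ ν₀ lam) :
    f = ν₀.toDual f • potential T s₀ ν₀ lam s₀ ∧
      ∀ g, φ g = φ s₀ * ν₀.toDual (potential T s₀ ν₀ lam g) := by
  have hA : ∀ g, (algebraMap ℂ (LInf w →L[ℂ] LInf w) lam - (T - rankOne s₀ ν₀)) g
      = lam • g - T g + ν₀.toDual g • s₀ := fun g => by
    rw [Algebra.algebraMap_eq_smul_one]
    change lam • g - (T g - ν₀.toDual g • s₀) = _
    abel
  refine ⟨?_, fun g => ?_⟩
  · rw [← map_smul]
    refine (inverse_apply_eq hU ?_).symm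
    rw [hA, h.eig, sub_self, zero_add]
  · have h1 := congrArg φ (apply_inverse hU g)
    rw [hA, map_add, map_sub, map_smul, map_smul, h.adj, smul_eq_mul, sub_self, zero_add,
      smul_eq_mul, mul_comm] at h1
    exact h1.symm

/-- The normalizations ν(u) = 1 and ν(f) = 1 determine the scalars left open by `potential_apply`
and show that the denominators are nonzero. -/
theorem IsDominant.eq_potential {ν : M1 w} (h : IsDominant T lam f ν.toDual) {u : LInf w}
    (hu : ν.toDual u = 1) {s₀ : LInf w} {ν₀ : M1 w} (hU : HasPotential T s₀ ν₀ lam) :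
    ν₀.toDual (potential T s₀ ν₀ lam u) ≠ 0 ∧ ν.toDual (potential T s₀ ν₀ lam s₀) ≠ 0 ∧
      ν.toDual = (ν₀.toDual (potential T s₀ ν₀ lam u))⁻¹ •
        ν₀.toDual.comp (potential T s₀ ν₀ lam) ∧
      f = (ν.toDual (potential T s₀ ν₀ lam s₀))⁻¹ • potential T s₀ ν₀ lam s₀ := by
  obtain ⟨h1, h2⟩ := h.potential_apply hU
  have h3 := h2 u
  rw [hu] at h3
  have h4 := congrArg ν.toDual h1
  rw [h.pair, map_smul, smul_eq_mul] at h4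
  have h5 : ν₀.toDual (potential T s₀ ν₀ lam u) ≠ 0 := right_ne_zero_of_mul (h3 ▸ one_ne_zero)
  have h6 : ν.toDual (potential T s₀ ν₀ lam s₀) ≠ 0 := right_ne_zero_of_mul (h4 ▸ one_ne_zero)
  refine ⟨h5, h6, ?_, ?_⟩
  · ext1 g
    rw [h2 g, eq_inv_of_mul_eq_one_left h3.symm]
    rfl
  · rw [← eq_inv_of_mul_eq_one_left h4.symm]
    exact h1

end Potential

/-! ### Differentiated eigenvalue equations. -/

section Derivative

variable {X : Type*} [MeasurableSpace X] {V : X → ℝ≥0} {hV : ∀ x, 1 ≤ V x} {P : Kernel X X}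
  {F : X → ℝ}

theorem LInf.hasDerivAt_apply {f : ℝ → LInf V} {df : LInf V} {a : ℝ} (hf : HasDerivAt f df a)
    (x : X) : HasDerivAt (fun t => f t x) (df x) a := by
  have h1 : HasDerivAt (fun t => f t x) (0 + df x) a :=
    VGeo.hasDerivAt_apply (hasDerivAt_const a (LInf.eval V x)) hf
  rwa [zero_add] at h1

/-- The difference quotients are σ-continuous functionals, and so is their norm limit. -/
theorem hasDerivAt_toDual_eq {μ : ℝ → M1 V} (hVm : Measurable V) (hV : ∀ x, 1 ≤ V x)
    {dφ : LInf V →L[ℂ] ℂ} {a : ℝ} (h : HasDerivAt (fun t => (μ t).toDual) dφ a) :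
    ∃ dμ : M1 V, dμ.toDual = dφ := by
  refine IsSigmaCont.exists_M1 ?_ hVm ⟨1, by simpa using hV⟩
  refine IsSigmaCont.of_tendsto (Eventually.of_forall fun t => ?_) (hasDerivAt_iff_tendsto_slope.1 h)
  rw [slope_def_module, ← Complex.coe_smul]
  exact (((μ t).isSigmaCont hVm).sub ((μ a).isSigmaCont hVm)).smul _

variable {lam : ℝ → ℝ} {f : ℝ → LInf V} {φ : ℝ → LInf V →L[ℂ] ℂ} {dl a : ℝ} {df : LInf V}
  {dφ : LInf V →L[ℂ] ℂ}

/-- The product rule for T_t f_t = λ_t f_t. The derivative of the operator is M_F T_a, and T_a f_a =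
λ_a f_a turns its contribution into λ_a F f_a. -/
theorem deriv_eig [IsSFiniteKernel P] (hFm : Measurable F) (hF : ∀ x, |F x| ≤ 1)
    (hP : HasFiniteNorm P V)
    (h : ∀ᶠ t in 𝓝 a, IsPrincipal (tilted P F t) hV (lam t) (f t) (φ t))
    (hl : HasDerivAt lam dl a) (hf : HasDerivAt f df a) :
    (lam a : ℂ) • mulOp V F hFm hF (f a) + kernelOp (tilted P F a) V df
      = (dl : ℂ) • f a + (lam a : ℂ) • df := by
  have h1 := hasDerivAt_apply (hasStrictDerivAt_kernelOp_tilted hFm hF hP a).hasDerivAt hf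
  have h2 : HasDerivAt (fun t => (lam t : ℂ) • f t) ((lam a : ℂ) • df + (dl : ℂ) • f a) a :=
    hl.ofReal_comp.smul hf
  have h3 := (h2.congr_of_eventuallyEq (h.mono fun t ht => ht.dom.eig)).unique h1
  rw [mul_apply_eq_comp, h.self_of_nhds.dom.eig, map_smul] at h3
  rw [← h3, add_comm]

/-- Pairing with the left eigenvector cancels both terms in `df`. -/
theorem IsDominant.deriv_eigenvalue {E : Type*} [NormedAddCommGroup E] [NormedSpace ℂ E]
    {T : E →L[ℂ] E} {l dl : ℂ} {f df Mf : E} {φ : E →L[ℂ] ℂ} (h : IsDominant T l f φ)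
    (hd : l • Mf + T df = dl • f + l • df) : dl = l * φ Mf := by
  have h1 := congrArg φ hd
  simp only [map_add, map_smul, h.adj, h.pair, smul_eq_mul, mul_one] at h1
  exact (add_right_cancel h1).symm

theorem im_deriv_eq_zero [IsSFiniteKernel P]
    (h : ∀ᶠ t in 𝓝 a, IsPrincipal (tilted P F t) hV (lam t) (f t) (φ t))
    (hf : HasDerivAt f df a) (x : X) : (df x).im = 0 := by
  have h1 : HasDerivAt (fun t => (f t x).im) (df x).im a :=
    Complex.imCLM.hasFDerivAt.comp_hasDerivAt a (LInf.hasDerivAt_apply hf x)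
  refine (h1.congr_of_eventuallyEq (h.mono fun t ht => ?_)).unique (hasDerivAt_const a 0)
  change 0 = (f t x).im
  rw [ht.isNonneg x, Complex.ofReal_im]

theorem hasDerivAt_log_re (hf : HasDerivAt f df a) {x : X} (hx : (f a x).re ≠ 0) :
    HasDerivAt (fun t => Real.log (f t x).re) ((df x).re / (f a x).re) a := by
  have h1 : HasDerivAt (fun t => (f t x).re) (df x).re a :=
    Complex.reCLM.hasFDerivAt.comp_hasDerivAt a (LInf.hasDerivAt_apply hf x)
  exact h1.log hx

end Derivative

/-! ### The Poisson equation for the twisted kernel and its consequences. -/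

section Poisson

variable {X : Type*} [MeasurableSpace X] {V : X → ℝ≥0} {hV : ∀ x, 1 ≤ V x} {P : Kernel X X}
  [IsSFiniteKernel P] {F : X → ℝ} {hFm : Measurable F} {hF : ∀ x, |F x| ≤ 1} {a lam dl : ℝ}
  {f df : LInf V} {φ : LInf V →L[ℂ] ℂ}

/-- This is the differentiated eigenvalue equation divided by λ f(x); the function `h.mulEquiv.symm
df` is the quotient df/f, the logarithmic derivative. -/
theorem IsPrincipal.kernelOp_twisted_logDeriv (h : IsPrincipal (tilted P F a) hV lam f φ)
    (hVm : Measurable V) (hT : HasFiniteNorm (tilted P F a) V)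
    (hd : (lam : ℂ) • mulOp V F hFm hF f + kernelOp (tilted P F a) V df
      = (dl : ℂ) • f + (lam : ℂ) • df) (x : X) :
    kernelOp (twisted P F a lam fun x => (f x).re) (twistedWeight V fun x => (f x).re)
      (h.mulEquiv.symm df) x = h.mulEquiv.symm df x - F x + (dl / lam : ℝ) := by
  have h1 := congrArg (fun g : LInf V => g x)
    (mulEquiv_kernelOp_twisted hVm f.measurable_re h.re_pos h.lam_pos hT (h.mulEquiv.symm df))
  have h2 : VGeo.mulEquiv V f.measurable_re h.re_pos (h.mulEquiv.symm df) = df :=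
    h.mulEquiv.apply_symm_apply df
  have h3 := congrArg (fun g : LInf V => g x) hd
  simp only [LInf.add_apply, LInf.smul_apply, mulOp_apply] at h3
  simp only [h2] at h1
  rw [VGeo.mulEquiv_apply, h.coe_re, LInf.smul_apply] at h1
  have hl : (lam : ℂ) ≠ 0 := by exact_mod_cast h.lam_pos.ne'
  have hx := h.apply_ne x
  rw [h.mulEquiv_symm_apply]
  apply mul_left_cancel₀ hx
  rw [h1, eq_sub_of_add_eq' h3]
  push_cast
  field_simp
  ring

theorem IsPrincipal.mulEquiv_symm_eq_ofReal (h : IsPrincipal (tilted P F a) hV lam f φ)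
    (him : ∀ x, (df x).im = 0) (x : X) :
    h.mulEquiv.symm df x = (((df x).re / (f x).re : ℝ) : ℂ) := by
  rw [h.mulEquiv_symm_apply, Complex.ofReal_div, h.coe_re, div_eq_inv_mul]
  congr 1
  exact Complex.ext rfl (him x)

theorem IsPrincipal.poisson (h : IsPrincipal (tilted P F a) hV lam f φ)
    (hVm : Measurable V) (hT : HasFiniteNorm (tilted P F a) V)
    (hd : (lam : ℂ) • mulOp V F hFm hF f + kernelOp (tilted P F a) V df
      = (dl : ℂ) • f + (lam : ℂ) • df) (him : ∀ x, (df x).im = 0) (x : X) :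
    Integrable (fun y => (df y).re / (f y).re) (twisted P F a lam (fun y => (f y).re) x) ∧
      ∫ y, (df y).re / (f y).re ∂(twisted P F a lam (fun y => (f y).re) x)
        = (df x).re / (f x).re - F x + dl / lam := by
  have hK := h.hasFiniteNorm_twisted hVm hT
  have h1 := h.kernelOp_twisted_logDeriv hVm hT hd x
  rw [kernelOp_apply hK] at h1
  simp only [h.mulEquiv_symm_eq_ofReal him] at h1
  rw [integral_complex_ofReal] at h1
  refine ⟨?_, by exact_mod_cast h1⟩
  have h2 := (integrable_of_hasFiniteNorm hK (h.mulEquiv.symm df) x).re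
  refine h2.congr (Eventually.of_forall fun y => ?_)
  change (h.mulEquiv.symm df y).re = _
  rw [h.mulEquiv_symm_eq_ofReal him, Complex.ofReal_re]

/-- By the Poisson equation, one step of the twisted kernel changes df/f by -F + dl/lam, which is
bounded by 1 + |dl/lam|. -/
theorem IsPrincipal.log_bound (h : IsPrincipal (tilted P F a) hV lam f φ)
    (hVm : Measurable V) (hT : HasFiniteNorm (tilted P F a) V)
    (hd : (lam : ℂ) • mulOp V F hFm hF f + kernelOp (tilted P F a) V df
      = (dl : ℂ) • f + (lam : ℂ) • df) (him : ∀ x, (df x).im = 0) :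
    ∃ C : ℝ, ∀ x, |(df x).re / (f x).re| ≤ C * (1 + Real.posLog (V x / (f x).re)) := by
  have := h.isMarkovKernel hT
  obtain ⟨C, hC⟩ := (h.isDominant_twisted hVm hT).exists_log_bound
    (h.hasFiniteNorm_twisted hVm hT) h.mulEquiv_symm_self (G := h.mulEquiv.symm df)
    (κ := 1 + |dl / lam|) (by positivity) fun x => by
      rw [h.kernelOp_twisted_logDeriv hVm hT hd]
      have e : h.mulEquiv.symm df x - F x + (dl / lam : ℝ) - h.mulEquiv.symm df x
          = ((-F x + dl / lam : ℝ) : ℂ) := by push_cast; ring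
      rw [e, Complex.norm_real]
      refine (norm_add_le _ _).trans (add_le_add ?_ le_rfl)
      rw [norm_neg]
      exact hF x
  refine ⟨C, fun x => ?_⟩
  have h1 := hC x
  rwa [h.mulEquiv_symm_eq_ofReal him, Complex.norm_real, coe_twistedWeight h.re_pos] at h1

theorem IsPrincipal.exists_invariant_deriv (h : IsPrincipal (tilted P F a) hV lam f φ)
    (hVm : Measurable V) (hT : HasFiniteNorm (tilted P F a) V)
    (hd : (lam : ℂ) • mulOp V F hFm hF f + kernelOp (tilted P F a) V df
      = (dl : ℂ) • f + (lam : ℂ) • df) :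
    ∃ m : Measure X, (IsProbabilityMeasure m ∧
      Kernel.Invariant (twisted P F a lam fun x => (f x).re) m) ∧
      (∀ ρ : Measure X, IsProbabilityMeasure ρ →
        Kernel.Invariant (twisted P F a lam fun x => (f x).re) ρ → ρ = m) ∧
      dl / lam = ∫ x, F x ∂m := by
  obtain ⟨m, h1, h2, h3, h4⟩ := h.exists_invariant hVm hT
  refine ⟨m, ⟨h1, h2⟩, h3, ?_⟩
  have h5 := h.dom.deriv_eigenvalue hd
  rw [h4] at h5
  have e : ∀ x, (f x)⁻¹ * mulOp V F hFm hF f x = (F x : ℂ) := fun x => by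
    rw [mulOp_apply]
    have := h.apply_ne x
    field_simp
  simp only [e] at h5
  rw [integral_complex_ofReal] at h5
  rw [div_eq_iff h.lam_pos.ne', mul_comm]
  exact_mod_cast h5

end Poisson

/-! ### The parameter 0: the original Markov kernel. -/

section Untilted

variable {X : Type*} [MeasurableSpace X] {V : X → ℝ≥0} {hV : ∀ x, 1 ≤ V x} {P : Kernel X X}
  [IsMarkovKernel P] {F : X → ℝ} {lam : ℝ} {f : LInf V} {φ : LInf V →L[ℂ] ℂ} {π : Measure X}

theorem tilted_zero (P : Kernel X X) [IsSFiniteKernel P] (F : X → ℝ) : tilted P F 0 = P := by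
  rw [tilted]
  simp

theorem kernelOp_tilted_zero (P : Kernel X X) [IsSFiniteKernel P] (F : X → ℝ) :
    kernelOp (tilted P F 0) V = kernelOp P V := by
  congr 1
  exact tilted_zero P F

theorem kernelOp_one (hV : ∀ x, 1 ≤ V x) (hP : HasFiniteNorm P V) :
    kernelOp P V (LInf.one hV) = LInf.one hV := by
  refine LInf.ext' fun x => ?_
  rw [kernelOp_apply hP]
  change ∫ _, (1 : ℂ) ∂(P x) = 1
  simp

/-- The principal eigentriple of a Markov kernel. -/
theorem IsPrincipal.eq_of_isMarkovKernel (h : IsPrincipal (tilted P F 0) hV lam f φ)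
    (hP : HasFiniteNorm P V) [IsProbabilityMeasure π] (hπ : Kernel.Invariant P π)
    (hπV : ∫⁻ x, V x ∂π ≠ ∞) : lam = 1 ∧ f = LInf.one hV ∧ φ = integralCLM π hπV := by
  have hd := h.dom
  rw [kernelOp_tilted_zero] at hd
  have h1 := hd.adj (LInf.one hV)
  rw [kernelOp_one hV hP, h.mass, mul_one] at h1
  have hl : lam = 1 := by exact_mod_cast h1.symm
  subst hl
  rw [Complex.ofReal_one] at hd
  have h2 := hd.eq_smul_of_eig (g := LInf.one hV) (by rw [kernelOp_one hV hP, one_smul])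
  rw [h.mass, one_smul] at h2
  have h3 := hd.eq_smul_of_adj (ψ := integralCLM π hπV) fun g => by
    rw [one_mul, integralCLM_apply, integralCLM_apply]
    simp only [kernelOp_apply hP]
    exact integral_integral_of_invariant hπ (g.integrable_of_lintegral_ne_top hπV)
  rw [← h2] at h3
  have h4 : integralCLM π hπV (LInf.one hV) = 1 := by
    rw [integralCLM_apply]
    change ∫ _, (1 : ℂ) ∂π = 1
    simp
  rw [h4, one_smul] at h3
  exact ⟨rfl, h2.symm, h3.symm⟩

/-- The Poisson equation for the untilted kernel determines the derivative of the principal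
eigenfunction. -/
theorem poisson_unique (hV : ∀ x, 1 ≤ V x) (hP : HasFiniteNorm P V) {hFm : Measurable F}
    {hF : ∀ x, |F x| ≤ 1} {hπV : ∫⁻ x, V x ∂π ≠ ∞}
    (hd : IsDominant (kernelOp P V) 1 (LInf.one hV) (integralCLM π hπV)) {df : LInf V} {c : ℝ}
    (hdf : mulOp V F hFm hF (LInf.one hV) + kernelOp P V df = (c : ℂ) • LInf.one hV + df)
    (hdf0 : ∫ x, df x ∂π = 0) (him : ∀ x, (df x).im = 0) :
    c = ∫ x, F x ∂π ∧ (∃ C : ℝ, ∀ x, |(df x).re| ≤ C * V x) ∧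
    (∀ x, ∫ y, (df y).re ∂(P x) = (df x).re - F x + ∫ y, F y ∂π) ∧ ∫ x, (df x).re ∂π = 0 ∧
    ∀ G : X → ℝ, Measurable G → (∃ C : ℝ, ∀ x, |G x| ≤ C * V x) →
      (∀ x, ∫ y, G y ∂(P x) = G x - F x + ∫ y, F y ∂π) → ∫ x, G x ∂π = 0 →
      G = fun x => (df x).re := by
  have hre : ∀ x, ((df x).re : ℂ) = df x := fun x => Complex.ext rfl (him x).symm
  have hc : c = ∫ x, F x ∂π := by
    have h1 := hd.deriv_eigenvalue (Mf := mulOp V F hFm hF (LInf.one hV)) (df := df) (dl := (c : ℂ))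
      (by rw [one_smul, one_smul]; exact hdf)
    rw [one_mul, integralCLM_apply] at h1
    have e : ∀ x, mulOp V F hFm hF (LInf.one hV) x = (F x : ℂ) := fun x => mul_one _
    simp only [e] at h1
    rw [integral_complex_ofReal] at h1
    exact_mod_cast h1
  have hpt : ∀ x, kernelOp P V df x = df x - F x + (∫ y, F y ∂π : ℝ) := fun x => by
    have h1 : (F x : ℂ) * 1 + kernelOp P V df x = (c : ℂ) * 1 + df x :=
      congrArg (fun g : LInf V => g x) hdf
    rw [← hc]
    linear_combination h1
  refine ⟨hc, ⟨‖df‖, fun x => (Complex.abs_re_le_norm _).trans (df.le_norm x)⟩, fun x => ?_, ?_,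
    fun G hGm hGb hG hG0 => ?_⟩
  · have h1 := hpt x
    rw [kernelOp_apply hP, ← hre x] at h1
    have h2 : ∫ y, df y ∂(P x) = ((∫ y, (df y).re ∂(P x) : ℝ) : ℂ) := by
      rw [← integral_complex_ofReal]
      simp only [hre]
    rw [h2] at h1
    exact_mod_cast h1
  · have h2 : ∫ y, df y ∂π = ((∫ y, (df y).re ∂π : ℝ) : ℂ) := by
      rw [← integral_complex_ofReal]
      simp only [hre]
    rw [h2] at hdf0
    exact_mod_cast hdf0
  · set g : LInf V := LInf.mk (fun x => (G x : ℂ)) (Complex.measurable_ofReal.comp hGm) (by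
      obtain ⟨C, hC⟩ := hGb
      refine ⟨C.toNNReal, fun x => ?_⟩
      rw [Complex.norm_real]
      exact (hC x).trans (mul_le_mul_of_nonneg_right (Real.le_coe_toNNReal C) (V x).2)) with hg
    have hgx : ∀ x, g x = (G x : ℂ) := fun x => rfl
    -- The difference of two solutions is harmonic, hence a multiple of 1 by simplicity of the
    -- eigenvalue; its π-mean is 0, so it vanishes.
    have h1 : kernelOp P V (g - df) = (1 : ℂ) • (g - df) := by
      refine LInf.ext' fun x => ?_
      rw [one_smul, map_sub, LInf.sub_apply, LInf.sub_apply, hpt, kernelOp_apply hP]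
      simp only [hgx]
      rw [integral_complex_ofReal, hG]
      push_cast
      ring
    have h2 := hd.eq_smul_of_eig h1
    have h3 : integralCLM π hπV (g - df) = 0 := by
      rw [map_sub, integralCLM_apply, integralCLM_apply, hdf0, sub_zero]
      simp only [hgx]
      rw [integral_complex_ofReal, hG0, Complex.ofReal_zero]
    rw [h3, zero_smul, sub_eq_zero] at h2
    funext x
    rw [← h2, hgx, Complex.ofReal_re]

end Untilted

/-! ### The open set of principal parameters and the family over it. -/

section Family

variable {X : Type*} [MeasurableSpace X] {V : X → ℝ≥0} {hV : ∀ x, 1 ≤ V x} {P : Kernel X X}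
  {F : X → ℝ}

/-- The parameters at which the tilted kernel has a principal eigentriple. -/
def principalSet (P : Kernel X X) [IsSFiniteKernel P] (F : X → ℝ) (hV : ∀ x, 1 ≤ V x) : Set ℝ :=
  {a | ∃ (lam : ℝ) (f : LInf V) (φ : LInf V →L[ℂ] ℂ), IsPrincipal (tilted P F a) hV lam f φ}

/-- The triples are chosen parameter by parameter, with arbitrary values off the principal set.
Uniqueness of normalized triples later makes the choice compatible with differentiability. -/
theorem exists_principal_family [IsSFiniteKernel P] (hVm : Measurable V) :
    ∃ (lam : ℝ → ℝ) (f : ℝ → LInf V) (μ : ℝ → M1 V), ∀ a ∈ principalSet P F hV,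
      IsPrincipal (tilted P F a) hV (lam a) (f a) (μ a).toDual := by
  have hw : ∃ C : ℝ≥0, ∀ x, 1 ≤ C * V x := ⟨1, by simpa using hV⟩
  have h : ∀ a, ∃ (l : ℝ) (f : LInf V) (μ : M1 V), a ∈ principalSet P F hV →
      IsPrincipal (tilted P F a) hV l f μ.toDual := by
    intro a
    by_cases ha : a ∈ principalSet P F hV
    · obtain ⟨l, f, φ, hp⟩ := id ha
      obtain ⟨μ, rfl⟩ := hp.sigma.exists_M1 hVm hw
      exact ⟨l, f, μ, fun _ => hp⟩
    · obtain ⟨μ, -⟩ := IsSigmaCont.exists_M1 (φ := (0 : LInf V →L[ℂ] ℂ))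
        (fun _ _ _ _ _ => tendsto_const_nhds) hVm hw
      exact ⟨0, 0, μ, fun h => (ha h).elim⟩
  choose l f μ h using h
  exact ⟨l, f, μ, h⟩

theorem IsPrincipal.isNormalizedEigenpair {K : Kernel X X} [IsSFiniteKernel K] {lam : ℝ}
    {f : LInf V} {μ : M1 V} (h : IsPrincipal K hV lam f μ.toDual) :
    IsNormalizedEigenpair K (lam : ℂ) f μ where
  eigenfunction := h.dom.eig
  eigenmeasure := by
    ext1 g
    exact h.dom.adj g
  pairing := h.dom.pair
  mass := by
    have hw : ∃ C : ℝ≥0, ∀ x, 1 ≤ C * V x := ⟨1, by simpa using hV⟩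
    rw [← μ.toDual_ind hw MeasurableSet.univ, ← one_eq_ind hV hw, h.mass]

theorem IsPrincipal.eq_of_isNormalizedEigenpair {K : Kernel X X} [IsSFiniteKernel K] {lam : ℝ}
    {f g : LInf V} {μ ν : M1 V} (h : IsPrincipal K hV lam f μ.toDual)
    (hg : IsNormalizedEigenpair K (lam : ℂ) g ν) : g = f ∧ ν = μ := by
  have hw : ∃ C : ℝ≥0, ∀ x, 1 ≤ C * V x := ⟨1, by simpa using hV⟩
  have h1 := h.dom.eq_smul_of_eig hg.eigenfunction
  have h2 := h.dom.eq_smul_of_adj (ψ := ν.toDual) fun k =>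
    congrArg (fun ψ : LInf V →L[ℂ] ℂ => ψ k) hg.eigenmeasure
  have h3 := congrArg (fun ψ : LInf V →L[ℂ] ℂ => ψ (LInf.one hV)) h2
  have h4 : ν.toDual (LInf.one hV) = 1 := by
    rw [one_eq_ind hV hw, ν.toDual_ind hw MeasurableSet.univ, hg.mass]
  change ν.toDual (LInf.one hV) = ν.toDual f * μ.toDual (LInf.one hV) at h3
  rw [h4, h.mass, mul_one] at h3
  rw [← h3, one_smul] at h2
  have h5 := hg.pairing
  rw [h2] at h5
  rw [h5, one_smul] at h1
  exact ⟨h1, M1.toDual_injective hw h2⟩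

theorem IsPrincipal.isGPE {K : Kernel X X} [IsSFiniteKernel K] {lam : ℝ}
    {f : LInf V} {μ : M1 V} (h : IsPrincipal K hV lam f μ.toDual) (hK : HasFiniteNorm K V) :
    IsGPE K V (lam : ℂ) := ⟨hK, h.dom.isUniformOpWith⟩

variable [IsMarkovKernel P] (hFm : Measurable F) (hF : ∀ x, |F x| ≤ 1) (hVm : Measurable V)
  (hd : DriftV4 P V) {π : Measure X} [IsProbabilityMeasure π] (hπ : Kernel.Invariant P π)
  (hπV : ∫⁻ x, V x ∂π ≠ ∞) {lam : ℝ → ℝ} {f : ℝ → LInf V} {μ : ℝ → M1 V}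

include hFm hF hVm hd hπ hπV

theorem isOpen_principalSet : IsOpen (principalSet P F hV) := by
  refine isOpen_iff_mem_nhds.2 fun a ⟨l, f, φ, h⟩ => ?_
  obtain ⟨l, f, φ, -, -, -, h1⟩ := h.exists_local hFm hF hVm hV hd hπ hπV
  exact h1.mono fun t ht => ⟨_, _, _, ht⟩

/-- By uniqueness the chosen family coincides near a with the differentiable branch of
`IsPrincipal.exists_local`. -/
theorem differentiableAt_principal_family (h : ∀ a ∈ principalSet P F hV,
      IsPrincipal (tilted P F a) hV (lam a) (f a) (μ a).toDual) {a : ℝ}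
    (ha : a ∈ principalSet P F hV) : DifferentiableAt ℝ lam a ∧ DifferentiableAt ℝ f a ∧
      DifferentiableAt ℝ (fun t => (μ t).toDual) a := by
  obtain ⟨l, f₁, φ₁, h1, h2, h3, h4⟩ := (h a ha).exists_local hFm hF hVm hV hd hπ hπV
  have h5 : ∀ᶠ t in 𝓝 a, l t = lam t ∧ f₁ t = f t ∧ φ₁ t = (μ t).toDual :=
    h4.mono fun t ht => (h t ⟨_, _, _, ht⟩).unique ht
  exact ⟨h1.congr_of_eventuallyEq (h5.mono fun t ht => ht.1.symm),
    h2.congr_of_eventuallyEq (h5.mono fun t ht => ht.2.1.symm),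
    h3.congr_of_eventuallyEq (h5.mono fun t ht => ht.2.2.symm)⟩

theorem eventually_hasPotential (h : ∀ a ∈ principalSet P F hV,
      IsPrincipal (tilted P F a) hV (lam a) (f a) (μ a).toDual) {a₀ : ℝ}
    (ha : a₀ ∈ principalSet P F hV) {s₀ : LInf V} {ν₀ : M1 V}
    (hU : HasPotential (kernelOp (tilted P F a₀) V) s₀ ν₀ (lam a₀)) :
    ∀ᶠ a in 𝓝 a₀, HasPotential (kernelOp (tilted P F a) V) s₀ ν₀ (lam a) := by
  have hl := (differentiableAt_principal_family hFm hF hVm hd hπ hπV h ha).1.continuousAt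
  have hT := (hasStrictDerivAt_kernelOp_tilted hFm hF
    (hasFiniteNorm_of_drift hV hd) a₀).hasDerivAt.continuousAt
  have hc : ContinuousAt (fun a => algebraMap ℂ (LInf V →L[ℂ] LInf V) (lam a) -
      (kernelOp (tilted P F a) V - rankOne s₀ ν₀)) a₀ :=
    ((algebraMapCLM ℂ (LInf V →L[ℂ] LInf V)).continuous.continuousAt.comp
      (Complex.continuous_ofReal.continuousAt.comp hl)).sub (hT.sub continuousAt_const)
  exact hc.eventually (Units.isOpen.mem_nhds hU)

end Family

end VGeo

end

/-! ### Assembly of the proposition. -/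

theorem mainTheorem11 {X : Type*} [MeasurableSpace X] [MeasurableSpace.CountablyGenerated X]
    (P : Kernel X X) [IsMarkovKernel P]
    (V : X → ℝ≥0) (hVm : Measurable V) (hV : ∀ x, 1 ≤ V x)
    (hgeo : VGeo.IsGeometricallyErgodic P V)
    (π : Measure X) [IsProbabilityMeasure π] (hπ : Kernel.Invariant P π)
    (hπV : ∫⁻ x, (V x : ℝ≥0∞) ^ 2 ∂π < ∞)
    (F : X → ℝ) (hFm : Measurable F) (hF : ∀ x, |F x| ≤ 1) (hπF : ∫ x, F x ∂π = 0)
    (a₀ : ℝ) (hunif : VGeo.IsUniform (VGeo.tilted P F a₀) V)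
    -- the principal eigenfunction at `a₀` does not vanish `π`-almost everywhere
    (hpos : ∃ (lam₀ : ℂ) (h₀ : VGeo.LInf V), VGeo.IsGPE (VGeo.tilted P F a₀) V lam₀ ∧
      VGeo.kernelOp (VGeo.tilted P F a₀) V h₀ = lam₀ • h₀ ∧ ¬ (∀ᵐ x ∂π, h₀ x = 0)) :
    ∃ (O : Set ℝ) (lam : ℝ → ℝ) (f : ℝ → VGeo.LInf V) (μ : ℝ → VGeo.M1 V)
      (Fhat : ℝ → X → ℝ), IsOpen O ∧ a₀ ∈ O ∧
      -- the principal eigenvalue, eigenfunction and eigenmeasure, for `a ∈ O`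
      (∀ a ∈ O,
        VGeo.IsGPE (VGeo.tilted P F a) V (lam a : ℂ) ∧ 0 < lam a ∧
        VGeo.IsNormalizedEigenpair (VGeo.tilted P F a) (lam a : ℂ) (f a) (μ a) ∧
        (∀ (g : VGeo.LInf V) (ν : VGeo.M1 V),
          VGeo.IsNormalizedEigenpair (VGeo.tilted P F a) (lam a : ℂ) g ν → g = f a ∧ ν = μ a) ∧
        (∀ x, (f a x).im = 0 ∧ 0 < (f a x).re)) ∧
      -- the expression of the eigenfunction and eigenmeasure through potential operators
      (∃ (s₀ : VGeo.LInf V) (ν₀ : VGeo.M1 V), ∃ ε > 0, ∀ z : ℂ, lam a₀ - ε ≤ ‖z‖ →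
        VGeo.HasPotential (VGeo.kernelOp (VGeo.tilted P F a₀) V) s₀ ν₀ z) ∧
      (∀ (s₀ : VGeo.LInf V) (ν₀ : VGeo.M1 V),
        (∃ ε > 0, ∀ z : ℂ, lam a₀ - ε ≤ ‖z‖ →
          VGeo.HasPotential (VGeo.kernelOp (VGeo.tilted P F a₀) V) s₀ ν₀ z) →
        ∀ᶠ a in 𝓝 a₀,
          VGeo.HasPotential (VGeo.kernelOp (VGeo.tilted P F a) V) s₀ ν₀ (lam a) ∧
          (let U := VGeo.potential (VGeo.kernelOp (VGeo.tilted P F a) V) s₀ ν₀ (lam a);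
            ν₀.toDual (U (VGeo.LInf.one hV)) ≠ 0 ∧ (μ a).toDual (U s₀) ≠ 0 ∧
            (μ a).toDual = (ν₀.toDual (U (VGeo.LInf.one hV)))⁻¹ • ν₀.toDual.comp U ∧
            f a = ((μ a).toDual (U s₀))⁻¹ • U s₀)) ∧
      -- `Fhat a` is the derivative of `log f a`
      (∀ a ∈ O, ∀ x, HasDerivAt (fun t => Real.log (f t x).re) (Fhat a x) a) ∧
      (∀ a ∈ O,
        -- the twisted kernel is probabilistic
        IsMarkovKernel (VGeo.twisted P F a (lam a) fun x => (f a x).re) ∧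
        -- (i)
        VGeo.IsUniform (VGeo.twisted P F a (lam a) fun x => (f a x).re)
          (VGeo.twistedWeight V fun x => (f a x).re) ∧
        (∃ π' : Measure X,
          (IsProbabilityMeasure π' ∧
            Kernel.Invariant (VGeo.twisted P F a (lam a) fun x => (f a x).re) π') ∧
          (∀ ρ : Measure X, IsProbabilityMeasure ρ →
            Kernel.Invariant (VGeo.twisted P F a (lam a) fun x => (f a x).re) ρ → ρ = π') ∧
          -- (ii)
          HasDerivAt (fun t => Real.log (lam t)) (∫ x, F x ∂π') a ∧
          -- (iii), the Poisson equation
          (∀ x, Integrable (Fhat a) (VGeo.twisted P F a (lam a) (fun y => (f a y).re) x) ∧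
            ∫ y, Fhat a y ∂(VGeo.twisted P F a (lam a) (fun y => (f a y).re) x) =
              Fhat a x - F x + ∫ y, F y ∂π')) ∧
        -- (iv)
        (∃ df : VGeo.LInf V, HasDerivAt f df a) ∧
        (∃ dμ : VGeo.M1 V, HasDerivAt (fun t => (μ t).toDual) dμ.toDual a) ∧
        -- (v)
        Measurable (Fhat a) ∧
        ∃ C : ℝ, ∀ x, |Fhat a x| ≤ C * (1 + Real.posLog (V x / (f a x).re))) ∧
      -- (iii) at `a = 0`
      (0 ∈ O →
        (∃ C : ℝ, ∀ x, |Fhat 0 x| ≤ C * V x) ∧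
        (∀ x, ∫ y, Fhat 0 y ∂(P x) = Fhat 0 x - F x + ∫ y, F y ∂π) ∧
        ∫ x, Fhat 0 x ∂π = 0 ∧
        ∀ G : X → ℝ, Measurable G → (∃ C : ℝ, ∀ x, |G x| ≤ C * V x) →
          (∀ x, ∫ y, G y ∂(P x) = G x - F x + ∫ y, F y ∂π) →
          ∫ x, G x ∂π = 0 → G = Fhat 0) := by
  have hd : VGeo.DriftV4 P V := hgeo.2
  have hP := VGeo.hasFiniteNorm_of_drift hV hd
  have hT : ∀ a, VGeo.HasFiniteNorm (VGeo.tilted P F a) V := VGeo.hasFiniteNorm_tilted hFm hF hP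
  have hπ1 := VGeo.lintegral_ne_top_of_sq hV hπV
  obtain ⟨lam, f, μ, hp⟩ := VGeo.exists_principal_family (P := P) (F := F) (hV := hV) hVm
  have hdiff := fun a ha =>
    VGeo.differentiableAt_principal_family hFm hF hVm hd hπ hπ1 hp (a := a) ha
  have hO := VGeo.isOpen_principalSet (hV := hV) hFm hF hVm hd hπ hπ1
  have ha₀ : a₀ ∈ VGeo.principalSet P F hV := by
    obtain ⟨lam₀, h₀, hgpe, heig, hne⟩ := hpos
    obtain ⟨f₀, ν, hdom⟩ := hgpe.2.exists_isDominant
    -- By simplicity h₀ is a multiple of the dominant eigenfunction f₀, so f₀ cannot vanish π-a.e.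
    -- either.
    obtain ⟨g, ψ, hg⟩ := VGeo.exists_isPrincipal_tilted hFm hF hVm hV hd hπ hdom fun h0 => hne (by
      filter_upwards [h0] with x hx
      rw [hdom.eq_smul_of_eig heig, VGeo.LInf.smul_apply, hx, mul_zero])
    exact ⟨_, g, ψ, hg⟩
  have hev : ∀ a ∈ VGeo.principalSet P F hV, ∀ᶠ t in 𝓝 a,
      VGeo.IsPrincipal (VGeo.tilted P F t) hV (lam t) (f t) (μ t).toDual := fun a ha =>
    Filter.Eventually.mono (hO.mem_nhds ha) hp
  have heq : ∀ a (ha : a ∈ VGeo.principalSet P F hV), _ := fun a ha =>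
    VGeo.deriv_eig hFm hF hP (hev a ha) (hdiff a ha).1.hasDerivAt (hdiff a ha).2.1.hasDerivAt
  have him : ∀ a (ha : a ∈ VGeo.principalSet P F hV) x, _ := fun a ha x =>
    VGeo.im_deriv_eq_zero (hev a ha) (hdiff a ha).2.1.hasDerivAt x
  refine ⟨VGeo.principalSet P F hV, lam, f, μ, fun a x => (deriv f a x).re / (f a x).re, hO, ha₀,
    fun a ha => ⟨(hp a ha).isGPE (hT a), (hp a ha).lam_pos, (hp a ha).isNormalizedEigenpair,
      fun g ν h => (hp a ha).eq_of_isNormalizedEigenpair h, fun x => ⟨?_, (hp a ha).re_pos x⟩⟩,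
    ?_, fun s₀ ν₀ hU => ?_,
    fun a ha x => VGeo.hasDerivAt_log_re (hdiff a ha).2.1.hasDerivAt ((hp a ha).re_pos x).ne',
    fun a ha => ⟨(hp a ha).isMarkovKernel (hT a), (hp a ha).isUniform_twisted hVm (hT a), ?_,
      ⟨_, (hdiff a ha).2.1.hasDerivAt⟩, ?_,
      (deriv f a).measurable_re.div (f a).measurable_re,
      (hp a ha).log_bound hVm (hT a) (heq a ha) (him a ha)⟩, fun h0 => ?_⟩
  · rw [(hp a ha).isNonneg x, Complex.ofReal_im]
  · obtain ⟨s₀, ν₀, ε, hε, h⟩ := (hp a₀ ha₀).dom.exists_hasPotential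
    rw [Complex.norm_real, Real.norm_of_nonneg (hp a₀ ha₀).lam_pos.le] at h
    exact ⟨s₀, ν₀, ε, hε, h⟩
  · obtain ⟨ε, hε, hU⟩ := hU
    have h1 : VGeo.HasPotential (VGeo.kernelOp (VGeo.tilted P F a₀) V) s₀ ν₀ (lam a₀) := by
      refine hU _ ?_
      rw [Complex.norm_real, Real.norm_of_nonneg (hp a₀ ha₀).lam_pos.le]
      linarith
    filter_upwards [hev a₀ ha₀,
      VGeo.eventually_hasPotential hFm hF hVm hd hπ hπ1 hp ha₀ h1] with a ha hUa
    exact ⟨hUa, ha.dom.eq_potential ha.mass hUa⟩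
  · obtain ⟨m, hm1, hm2, hm3⟩ := (hp a ha).exists_invariant_deriv hVm (hT a) (heq a ha)
    refine ⟨m, hm1, hm2, ?_, fun x => ?_⟩
    · rw [← hm3]
      exact (hdiff a ha).1.hasDerivAt.log (hp a ha).lam_pos.ne'
    · rw [← hm3]
      exact (hp a ha).poisson hVm (hT a) (heq a ha) (him a ha) x
  · obtain ⟨dμ, hdμ⟩ := VGeo.hasDerivAt_toDual_eq hVm hV (hdiff a ha).2.2.hasDerivAt
    exact ⟨dμ, hdμ ▸ (hdiff a ha).2.2.hasDerivAt⟩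
  · obtain ⟨hl, hf, hφ⟩ := (hp 0 h0).eq_of_isMarkovKernel hP hπ hπ1
    have hdom := (hp 0 h0).dom
    have hdf := heq 0 h0
    rw [VGeo.kernelOp_tilted_zero, hl, hf] at hdf
    rw [VGeo.kernelOp_tilted_zero, hl, hf, hφ, Complex.ofReal_one] at hdom
    rw [Complex.ofReal_one, one_smul, one_smul] at hdf
    -- Differentiating μ_a(f_a) = 1 and μ_a(1) = 1 at 0, where f_0 = 1, gives two relations whose
    -- difference is μ_0(f'_0) = 0. Since μ_0 = π, this is the centering of the Poisson solution.
    have hpair : (μ 0).toDual (deriv f 0) = 0 := by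
      have h1 := VGeo.hasDerivAt_apply (hdiff 0 h0).2.2.hasDerivAt (hdiff 0 h0).2.1.hasDerivAt
      have h2 := VGeo.hasDerivAt_apply (hdiff 0 h0).2.2.hasDerivAt
        (hasDerivAt_const 0 (VGeo.LInf.one hV))
      have h3 := h1.unique ((hasDerivAt_const (0 : ℝ) (1 : ℂ)).congr_of_eventuallyEq
        ((hev 0 h0).mono fun t ht => ht.dom.pair))
      have h4 := h2.unique ((hasDerivAt_const (0 : ℝ) (1 : ℂ)).congr_of_eventuallyEq
        ((hev 0 h0).mono fun t ht => ht.mass))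
      rw [map_zero, add_zero] at h4
      rwa [hf, h4, zero_add] at h3
    rw [hφ, VGeo.integralCLM_apply] at hpair
    have hF0 : ∀ x, (deriv f 0 x).re / (f 0 x).re = (deriv f 0 x).re := fun x => by
      have : f 0 x = 1 := by rw [hf]; rfl
      rw [this, Complex.one_re, div_one]
    have h5 := VGeo.poisson_unique hV hP hdom hdf hpair (him 0 h0)
    simp only [hF0]
    exact h5.2
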